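/- **Theorem (local well-posedness in Sobolev spaces for $\nu=0$, $\kappa=0$).** Let $d\ge 2$, $s>\frac d2+1$ and $\mathbb{T}^d=\mathbb{R}^d/2\pi\mathbb{Z}^d$. For $\nu\ge 0$ let $(T^\nu_{ij})_{1\le i,j\le d}$ be Fourier multiplier operators on $\mathbb{T}^d$ with symbols $\widehat T^\nu_{ij}:\mathbb{Z}^d\to\mathbb{C}$ such that * $T^\nu_{ij}$ maps real functions to real functions, i.e. $\widehat T^\nu_{ij}(-k)=\overline{\widehat T^\nu_{ij}(k)}$ for all $k$; * $\sum_{i,j}\partial_i\partial_jT^\nu_{ij}=0$ for all $\nu\ge0$, i.e. $\sum_{i,j}k_ik_j\widehat T^\nu_{ij}(k)=0$ for all $k$; * (the operators $\partial_{x_i}T_{ij}^\nu$ are of order zero) there is $C_0>0$, independent of $\nu$, with $|k_i\widehat T^\nu_{ij}(k)|\le C_0$ for all $i,j\in\{1,\dots,d\}$, $k\in\mathbb{Z}^d$ and all $\nu\in(0,1]$, and also for $\nu=0$. Let $\theta_0,S\in H^s(\mathbb{T}^d)$ be real-valued with zero mean. Consider, for $\nu=0$, the problem $$\partial_t\theta+u\cdot\nabla\theta=S(x),\qquad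 u_j=\sum_{i}\partial_{x_i}T^0_{ij}[\theta],\qquad \theta(\cdot,0)=\theta_0. \tag{1}$$ Then there are $T>0$ and a real-valued function $\theta^0\in C^1([0,T]\times\mathbb{T}^d)\cap L^\infty(0,T;H^s(\mathbb{T}^d))$, with zero mean at every time $t\in[0,T]$, which solves (1) pointwise on $[0,T]\times\mathbb{T}^d$ (with the continuous representatives of $\theta_0$ and $S$) and hence also in the weak sense below. It is unique: * every $C^1$ pointwise solution of (1) on $[0,T]\times\mathbb{T}^d$ which lies in $L^\infty(0,T;H^s(\mathbb{T}^d))$ equals $\theta^0$ on $[0,T]\times\mathbb{T}^d$; * every weak solution $\theta\in L^\infty(0,T;H^s(\mathbb{T}^d))$ of (1) equals $\theta^0$ almost everywhere on $(0,T)\times\mathbb{T}^d$. Here $\theta$ is a weak solution if for every $\varphi\in C^\infty(\mathbb{T}^d)$ and almost every $t\in(0,T)$ $$\int_{\mathbb{T}^d}\theta(x,t)\varphi(x)\,dx=\int_{\mathbb{T}^d}\theta_0\varphi\,dx+\int_0^t\int_{\mathbb{T}^d}\big(S\varphi+\theta\,u\cdot\nabla\varphi\big)\,dx\,d\tau .$$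 -/

import Mathlib

open MeasureTheory

noncomputable section

namespace ActiveScalar

/-- The torus `ℝ^d / 2πℤ^d`. The point with coordinates `x = (x₁, …, x_d)` modulo `2π` is stored as
the point `x / (2π)` of Mathlib's unit torus `(ℝ/ℤ)^d`. All derivatives below are taken with respect
to `x`. -/
abbrev Torus (d : ℕ) : Type := UnitAddTorus (Fin d)

/-- The normalised Lebesgue measure `(2π)^(-d) dx` on the torus: the Haar probability measure that
Mathlib's Fourier coefficients on the torus are defined with. -/
abbrev torusMeasure (d : ℕ) : Measure (Torus d) := Measure.pi fun _ => AddCircle.haarAddCircle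

/-- The projection `ℝ^d → ℝ^d / 2πℤ^d`. -/
def toTorus {d : ℕ} (x : Fin d → ℝ) : Torus d :=
  fun i => ((x i / (2 * Real.pi) : ℝ) : UnitAddCircle)

/-- The partial derivative `∂f/∂x_j` of a function on the torus:
the derivative of `h ↦ f (x + h e_j)` at `h = 0`. -/
def partialDeriv {d : ℕ} (j : Fin d) (f : Torus d → ℝ) (x : Torus d) : ℝ :=
  deriv (fun h : ℝ => f (x + toTorus (Pi.single j h))) 0

/-- Infinitely differentiable functions on the torus. -/
def IsSmooth {d : ℕ} (f : Torus d → ℝ) : Prop :=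
  ContDiff ℝ ((⊤ : ℕ∞) : WithTop ℕ∞) (fun x : Fin d → ℝ => f (toTorus x))

/-- The Fourier coefficient `(2π)^(-d) ∫ f(x) e^{-i k·x} dx` of a real function. -/
def fourierCoeff {d : ℕ} (f : Torus d → ℝ) (k : Fin d → ℤ) : ℂ :=
  UnitAddTorus.mFourierCoeff (fun x => (f x : ℂ)) k

/-- The term `(1 + |k|²)^s |f̂(k)|²` of the squared `H^s` norm. -/
def sobolevTerm {d : ℕ} (s : ℝ) (f : Torus d → ℝ) (k : Fin d → ℤ) : ℝ :=
  (1 + ∑ i, (k i : ℝ) ^ 2) ^ s * ‖fourierCoeff f k‖ ^ 2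

/-- Membership in the Sobolev space `H^s(𝕋^d)` of real functions (used for `s ≥ 0`). -/
def MemHs {d : ℕ} (s : ℝ) (f : Torus d → ℝ) : Prop :=
  MemLp f 2 (torusMeasure d) ∧ Summable (sobolevTerm s f)

/-- The norm of `H^s(𝕋^d)`. -/
def hsNorm {d : ℕ} (s : ℝ) (f : Torus d → ℝ) : ℝ :=
  Real.sqrt (∑' k, sobolevTerm s f k)

/-- Membership in `L^∞(0, T; H^s(𝕋^d))`. -/
def MemLinftyHs {d : ℕ} (T s : ℝ) (θ : ℝ → Torus d → ℝ) : Prop :=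
  AEStronglyMeasurable (fun p : ℝ × Torus d => θ p.1 p.2)
      ((volume.restrict (Set.Ioo 0 T)).prod (torusMeasure d)) ∧
    ∃ M : ℝ, ∀ᵐ t ∂(volume.restrict (Set.Ioo 0 T)), MemHs s (θ t) ∧ hsNorm s (θ t) ≤ M

/-- A matrix of Fourier multiplier operators `T_ij` on `𝕋^d`, given by its symbols:
`𝓣 i j k` is `T̂_ij(k)`. -/
abbrev MultiplierMatrix (d : ℕ) : Type := Fin d → Fin d → (Fin d → ℤ) → ℂ

/-- The symbol `i k_i T̂_ij(k)` of the operator `∂_{x_i} T_ij` (no summation). -/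
def derivSymbol {d : ℕ} (𝓣 : MultiplierMatrix d) (i j : Fin d) (k : Fin d → ℤ) : ℂ :=
  Complex.I * (k i : ℂ) * 𝓣 i j k

/-- The operators `T_ij` map real functions to real functions. -/
def IsReal {d : ℕ} (𝓣 : MultiplierMatrix d) : Prop :=
  ∀ i j k, 𝓣 i j (-k) = (starRingEnd ℂ) (𝓣 i j k)

/-- `∑_{i,j} ∂_i ∂_j T_ij = 0`: the symbol of this multiplier operator vanishes. -/
def IsDivergenceFree {d : ℕ} (𝓣 : MultiplierMatrix d) : Prop :=
  ∀ k : Fin d → ℤ, ∑ i, ∑ j, (Complex.I * (k i : ℂ)) * (Complex.I * (k j : ℂ)) * 𝓣 i j k = 0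

/-- The operators `∂_{x_i} T_ij^ν` are of order zero, uniformly for `ν ∈ (0, 1]`, and so are the
operators `∂_{x_i} T_ij^0`. -/
def OrderZeroDrift {d : ℕ} (𝓣 : NNReal → MultiplierMatrix d) : Prop :=
  ∃ C₀ : ℝ, 0 < C₀ ∧
    (∀ i j, ∀ ν : NNReal, 0 < ν → ν ≤ 1 → ∀ k, ‖derivSymbol (𝓣 ν) i j k‖ ≤ C₀) ∧
    (∀ i j, ∀ k, ‖derivSymbol (𝓣 0) i j k‖ ≤ C₀)

/-- The drift velocity `u_j[f] = ∑_i ∂_{x_i} T_ij [f]`, as a Fourier series. The series has a real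
sum when the operators `T_ij` are real, and it converges absolutely when `f` is in `H^s`, `s > d/2`,
and the operators `∂_{x_i} T_ij` are of order zero. -/
def drift {d : ℕ} (𝓣 : MultiplierMatrix d) (j : Fin d) (f : Torus d → ℝ) (x : Torus d) : ℝ :=
  (∑' k : Fin d → ℤ, (∑ i, derivSymbol 𝓣 i j k) * fourierCoeff f k * UnitAddTorus.mFourier k x).re

/-- Weak solutions on `(0, T)` of `∂_t θ + u·∇θ = S`, `u_j = ∂_{x_i} T_ij [θ]`, `θ(·, 0) = θ₀`, tested
against smooth functions of `x` and integrated in time, with `u·∇θ = ∇·(uθ)` for the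
divergence-free field `u`. -/
def IsWeakSolution {d : ℕ} (𝓣 : MultiplierMatrix d) (θ₀ S : Torus d → ℝ) (T : ℝ)
    (θ : ℝ → Torus d → ℝ) : Prop :=
  ∀ φ : Torus d → ℝ, IsSmooth φ → ∀ᵐ t ∂(volume.restrict (Set.Ioo 0 T)),
    ∫ x, θ t x * φ x ∂(torusMeasure d) = (∫ x, θ₀ x * φ x ∂(torusMeasure d)) +
      ∫ τ in (0 : ℝ)..t, ((∫ x, S x * φ x ∂(torusMeasure d)) +
        ∫ x, ∑ j, θ τ x * drift 𝓣 j (θ τ) x * partialDeriv j φ x ∂(torusMeasure d))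

/-- Classical solutions on `[0, T]`: `θ` is `C¹` on `[0, T] × 𝕋^d`, and the equation and the initial
condition hold pointwise. As `θ₀` and `S` are given up to null sets only, `x` ranges over almost all
points; for the continuous representatives of `θ₀` and `S` it then ranges over all points. -/
def IsClassicalSolution {d : ℕ} (𝓣 : MultiplierMatrix d) (θ₀ S : Torus d → ℝ) (T : ℝ)
    (θ : ℝ → Torus d → ℝ) : Prop :=
  ContDiffOn ℝ 1 (fun p : ℝ × (Fin d → ℝ) => θ p.1 (toTorus p.2))
      (Set.Icc (0 : ℝ) T ×ˢ Set.univ) ∧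
    (∀ᵐ x ∂(torusMeasure d), θ 0 x = θ₀ x) ∧
    ∀ᵐ x ∂(torusMeasure d), ∀ t ∈ Set.Icc (0 : ℝ) T,
      derivWithin (fun τ => θ τ x) (Set.Icc 0 T) t +
        ∑ j, drift 𝓣 j (θ t) x * partialDeriv j (θ t) x = S x

end ActiveScalar

end

/-! In Fourier coefficients the problem is the infinite system `a_k' = S_k - adv m a a k`, where `m`
is the symbol of the map from `θ` to `u`. The symbol is bounded, so `u` is as regular as `θ`. Since
`s > d/2 + 1`, a sequence bounded in `H^s` is summable even with one derivative
(`exists_wiener_bound`), and quadratic terms are controlled by Young's inequality for convolutions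
of `ℓ¹` with `ℓ²` sequences.

The nonlinearity loses a derivative, but `u` is real and divergence free, so `u·∇` is skew-adjoint
(`re_sum_advKernel_eq_zero`). In the `H^s` energy identity only the commutator of the weight with
`u·∇` survives. The difference of the weights at `k` and `l` gains a factor `jb (k - l)`
(`abs_jb_rpow_sub_le`), so the derivative loss disappears and the energy grows at a rate bounded by
a cubic expression in the norm (`exists_energy_bound`). Hence Galerkin approximations exist on a
common time interval with a common `H^s` bound (`exists_galerkin`).

The second estimate is in `ℓ²`. If two families, both bounded in `H^s`, solve the equation for the
modes of a box of size `n` with the same data there, then they differ on those modes by a quantity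
that tends to zero with `n` (`exists_closeness`); the error comes from the high modes and is of size
`(n+1)^(1-s)`. This one estimate makes the Galerkin sequence Cauchy, without a compactness argument,
and gives uniqueness.

The real part of a coefficient solution is again a solution (`symm_adv`). Its Fourier series is `C¹`
because the coefficients of its first derivatives are bounded in `H^(s-1)` and `s - 1 > d/2`.
Conversely, a weak solution tested with exponentials has coefficients that agree for almost every
time with a solution of the same system (`IsWeakSolution.ae_fourierCoeff_eq`), so weak uniqueness
reduces to the coefficient estimate; classical uniqueness follows because classical solutions are
weak.

Norm bounds are stated through finite partial sums: they carry summability with them and survive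
pointwise limits. -/

noncomputable section

namespace ActiveScalar

/-! ### Summation bounds through finite partial sums -/

/-- All finite partial sums of `f` are at most `A`. -/
def SumLe {ι : Type*} (f : ι → ℝ) (A : ℝ) : Prop := ∀ F : Finset ι, ∑ k ∈ F, f k ≤ A

/-- The `ℓ²` norm of `f` is at most `A`. -/
def SqSumLe {ι : Type*} (f : ι → ℝ) (A : ℝ) : Prop := ∀ F : Finset ι, ∑ k ∈ F, f k ^ 2 ≤ A ^ 2

section Sequences

variable {ι : Type*} {f g : ι → ℝ} {A B : ℝ}

lemma SumLe.nonneg (hf : SumLe f A) : 0 ≤ A := by simpa using hf ∅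

lemma SumLe.summable (hf : SumLe f A) (h0 : ∀ k, 0 ≤ f k) : Summable f :=
  summable_of_sum_le h0 hf

lemma SumLe.mono (hg : SumLe g A) (h : ∀ k, f k ≤ g k) : SumLe f A := fun F =>
  (Finset.sum_le_sum fun k _ => h k).trans (hg F)

lemma SqSumLe.mono (hg : SqSumLe g A) (h : ∀ k, |f k| ≤ g k) : SqSumLe f A := fun F =>
  (Finset.sum_le_sum fun k _ => by
    rw [← sq_abs]; exact pow_le_pow_left₀ (abs_nonneg _) (h k) 2).trans (hg F)

lemma SqSumLe.of_le (hf : SqSumLe f A) (hA : 0 ≤ A) (h : A ≤ B) : SqSumLe f B := fun F =>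
  (hf F).trans (pow_le_pow_left₀ hA h 2)

lemma SqSumLe.summable (hf : SqSumLe f A) : Summable fun k => f k ^ 2 :=
  summable_of_sum_le (fun _ => sq_nonneg _) hf

lemma SqSumLe.single_le (hf : SqSumLe f A) (hA : 0 ≤ A) (k : ι) : |f k| ≤ A :=
  abs_le_of_sq_le_sq (by simpa using hf {k}) hA

lemma SqSumLe.const_mul (hf : SqSumLe f A) (c : ℝ) : SqSumLe (fun k => c * f k) (c * A) := by
  intro F
  simp only [mul_pow, ← Finset.mul_sum]
  exact mul_le_mul_of_nonneg_left (hf F) (sq_nonneg c)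

lemma SqSumLe.sum_mul_le (hf : SqSumLe f A) (hg : SqSumLe g B) (hA : 0 ≤ A) (hB : 0 ≤ B)
    (F : Finset ι) : ∑ k ∈ F, f k * g k ≤ A * B := by
  refine le_of_sq_le_sq ?_ (mul_nonneg hA hB)
  calc (∑ k ∈ F, f k * g k) ^ 2 ≤ (∑ k ∈ F, f k ^ 2) * ∑ k ∈ F, g k ^ 2 :=
        Finset.sum_mul_sq_le_sq_mul_sq F f g
    _ ≤ A ^ 2 * B ^ 2 := by
        have := hf F
        have := hg F
        gcongr
    _ = (A * B) ^ 2 := by ring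

lemma SqSumLe.add (hf : SqSumLe f A) (hg : SqSumLe g B) (hA : 0 ≤ A) (hB : 0 ≤ B) :
    SqSumLe (fun k => f k + g k) (A + B) := by
  intro F
  have h1 := hf F
  have h2 := hg F
  have h3 := hf.sum_mul_le hg hA hB F
  calc ∑ k ∈ F, (f k + g k) ^ 2
      = ∑ k ∈ F, f k ^ 2 + 2 * ∑ k ∈ F, f k * g k + ∑ k ∈ F, g k ^ 2 := by
        rw [Finset.mul_sum, ← Finset.sum_add_distrib, ← Finset.sum_add_distrib]
        exact Finset.sum_congr rfl fun _ _ => by ring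
    _ ≤ (A + B) ^ 2 := by nlinarith

lemma SqSumLe.comp_injective {κ : Type*} (hf : SqSumLe f A) {e : κ → ι}
    (he : Function.Injective e) : SqSumLe (fun k => f (e k)) A := by
  intro F
  have := hf (F.map ⟨e, he⟩)
  simpa using this

lemma SumLe.comp_injective {κ : Type*} (hf : SumLe f A) {e : κ → ι}
    (he : Function.Injective e) : SumLe (fun k => f (e k)) A := by
  intro F
  have := hf (F.map ⟨e, he⟩)
  simpa using this

/-- Fatou's lemma for `ℓ²`: each finite partial sum is continuous in the coordinates. It carries the
uniform `H^s` bound over to the limit of the Galerkin approximations. -/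
lemma SqSumLe.of_tendsto {κ : Type*} {l : Filter κ} [l.NeBot] {u : κ → ι → ℝ}
    (h : ∀ᶠ n in l, SqSumLe (u n) A) (hlim : ∀ k, Filter.Tendsto (fun n => u n k) l (nhds (f k))) :
    SqSumLe f A := fun F =>
  le_of_tendsto (tendsto_finsetSum F fun k _ => (hlim k).pow 2) (h.mono fun _ hn => hn F)

end Sequences

/-! ### Young's inequalities for convolutions of sequences. -/

section Convolution

variable {ι : Type*} [AddCommGroup ι] {f g : ι → ℝ} {A B : ℝ}

/-- An `ℓ²` sequence is bounded, so the summable factor dominates. -/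
lemma SumLe.summable_conv (hf : SumLe f A) (hf0 : ∀ k, 0 ≤ f k) (hg : SqSumLe g B) (hB : 0 ≤ B)
    (hg0 : ∀ k, 0 ≤ g k) (k : ι) : Summable fun l => f (k - l) * g l := by
  have h1 : SumLe (fun l => f (k - l)) A := hf.comp_injective (sub_right_injective (b := k))
  refine Summable.of_nonneg_of_le (fun l => mul_nonneg (hf0 _) (hg0 _)) (fun l => ?_)
    ((h1.summable fun l => hf0 _).mul_right B)
  exact mul_le_mul_of_nonneg_left ((le_abs_self _).trans (hg.single_le hB l)) (hf0 _)

/-- Young's inequality `ℓ¹ * ℓ² ⊆ ℓ²`. -/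
lemma SumLe.conv (hf : SumLe f A) (hf0 : ∀ k, 0 ≤ f k) (hg : SqSumLe g B) (hB : 0 ≤ B)
    (hg0 : ∀ k, 0 ≤ g k) : SqSumLe (fun k => ∑' l, f (k - l) * g l) (A * B) := by
  intro F
  have hlim : Filter.Tendsto (fun G : Finset ι => ∑ k ∈ F, (∑ l ∈ G, f (k - l) * g l) ^ 2)
      Filter.atTop (nhds (∑ k ∈ F, (∑' l, f (k - l) * g l) ^ 2)) :=
    tendsto_finsetSum F fun k _ => (hf.summable_conv hf0 hg hB hg0 k).hasSum.pow 2
  -- The inner series is replaced by finite sums over `G`, so that only finite sums have to be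
  -- interchanged.
  refine le_of_tendsto hlim (Filter.Eventually.of_forall fun G => ?_)
  have hA := hf.nonneg
  calc ∑ k ∈ F, (∑ l ∈ G, f (k - l) * g l) ^ 2
      ≤ ∑ k ∈ F, A * ∑ l ∈ G, f (k - l) * g l ^ 2 := by
        refine Finset.sum_le_sum fun k _ => ?_
        have h1 : ∑ l ∈ G, f (k - l) ≤ A :=
          (hf.comp_injective (sub_right_injective (b := k))) G
        -- Cauchy–Schwarz after splitting `f * g` as `√f * (√f * g)`: one factor is summed to `A`,
        -- the other keeps `g²`.
        refine (Finset.sum_sq_le_sum_mul_sum_of_sq_le_mul G (f := fun l => f (k - l))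
          (g := fun l => f (k - l) * g l ^ 2) (fun _ _ => hf0 _)
          (fun _ _ => mul_nonneg (hf0 _) (sq_nonneg _)) (fun l _ => le_of_eq (by ring))).trans ?_
        exact mul_le_mul_of_nonneg_right h1
          (Finset.sum_nonneg fun _ _ => mul_nonneg (hf0 _) (sq_nonneg _))
    _ = A * ∑ l ∈ G, (∑ k ∈ F, f (k - l)) * g l ^ 2 := by
        rw [← Finset.mul_sum, Finset.sum_comm]
        simp only [Finset.sum_mul]
    _ ≤ A * ∑ l ∈ G, A * g l ^ 2 := by
        refine mul_le_mul_of_nonneg_left (Finset.sum_le_sum fun l _ => ?_) hA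
        exact mul_le_mul_of_nonneg_right
          ((hf.comp_injective (sub_left_injective (b := l))) F) (sq_nonneg _)
    _ ≤ A * (A * B ^ 2) := by
        rw [← Finset.mul_sum]
        exact mul_le_mul_of_nonneg_left (mul_le_mul_of_nonneg_left (hg G) hA) hA
    _ = (A * B) ^ 2 := by ring

lemma tsum_conv_comm (f g : ι → ℝ) (k : ι) :
    ∑' l, g (k - l) * f l = ∑' l, f (k - l) * g l := by
  rw [← (Equiv.subLeft k).tsum_eq fun l => f (k - l) * g l]
  exact tsum_congr fun l => by simp [mul_comm]

lemma SqSumLe.summable_conv (hf : SqSumLe f A) (hA : 0 ≤ A) (hf0 : ∀ k, 0 ≤ f k) (hg : SumLe g B)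
    (hg0 : ∀ k, 0 ≤ g k) (k : ι) : Summable fun l => f (k - l) * g l := by
  rw [← (Equiv.subLeft k).summable_iff]
  refine (hg.summable_conv hg0 hf hA hf0 k).congr fun l => by simp [mul_comm]

/-- Young's inequality `ℓ² * ℓ¹ ⊆ ℓ²`. -/
lemma SqSumLe.conv (hf : SqSumLe f A) (hA : 0 ≤ A) (hf0 : ∀ k, 0 ≤ f k) (hg : SumLe g B)
    (hg0 : ∀ k, 0 ≤ g k) : SqSumLe (fun k => ∑' l, f (k - l) * g l) (A * B) := by
  have h := hg.conv hg0 hf hA hf0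
  rw [mul_comm] at h
  exact h.mono fun k => by
    rw [← tsum_conv_comm f g, abs_of_nonneg (tsum_nonneg fun l => mul_nonneg (hg0 _) (hf0 _))]

end Convolution

/-! ### The weight `(1 + |k|²)^(1/2)` -/

section Weight

variable {d : ℕ}

/-- The weight `(1 + |k|²)^(1/2)`. -/
def jb (k : Fin d → ℤ) : ℝ := Real.sqrt (1 + ∑ i, (k i : ℝ) ^ 2)

lemma sum_sq_nonneg (k : Fin d → ℤ) : 0 ≤ ∑ i, (k i : ℝ) ^ 2 :=
  Finset.sum_nonneg fun _ _ => sq_nonneg _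

lemma one_le_jb (k : Fin d → ℤ) : 1 ≤ jb k :=
  Real.one_le_sqrt.mpr (by linarith [sum_sq_nonneg k])

lemma jb_pos (k : Fin d → ℤ) : 0 < jb k := one_pos.trans_le (one_le_jb k)

lemma jb_nonneg (k : Fin d → ℤ) : 0 ≤ jb k := (jb_pos k).le

lemma jb_sq (k : Fin d → ℤ) : jb k ^ 2 = 1 + ∑ i, (k i : ℝ) ^ 2 :=
  Real.sq_sqrt (by linarith [sum_sq_nonneg k])

lemma jb_neg (k : Fin d → ℤ) : jb (-k) = jb k := by simp [jb]

lemma abs_coord_le_jb (k : Fin d → ℤ) (i : Fin d) : |(k i : ℝ)| ≤ jb k := by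
  refine Real.le_sqrt_of_sq_le ?_
  rw [sq_abs]
  have := Finset.single_le_sum (f := fun i => (k i : ℝ) ^ 2) (fun _ _ => sq_nonneg _)
    (Finset.mem_univ i)
  linarith

lemma jb_add_le (k l : Fin d → ℤ) : jb (k + l) ≤ jb k + jb l := by
  refine Real.sqrt_le_iff.mpr ⟨add_nonneg (jb_nonneg k) (jb_nonneg l), ?_⟩
  have h1 : ∑ i, (k i : ℝ) * l i ≤ jb k * jb l := by
    refine le_of_sq_le_sq ?_ (mul_nonneg (jb_nonneg k) (jb_nonneg l))
    refine (Finset.sum_mul_sq_le_sq_mul_sq _ (fun i => (k i : ℝ)) fun i => (l i : ℝ)).trans ?_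
    rw [mul_pow, jb_sq, jb_sq]
    have := sum_sq_nonneg k
    have := sum_sq_nonneg l
    gcongr <;> linarith
  have h2 : ∑ i, (((k + l) i : ℤ) : ℝ) ^ 2 =
      ∑ i, (k i : ℝ) ^ 2 + 2 * ∑ i, (k i : ℝ) * l i + ∑ i, (l i : ℝ) ^ 2 := by
    rw [Finset.mul_sum, ← Finset.sum_add_distrib, ← Finset.sum_add_distrib]
    exact Finset.sum_congr rfl fun _ _ => by push_cast [Pi.add_apply]; ring
  have := jb_sq k
  have := jb_sq l
  rw [h2]
  nlinarith

lemma jb_le_sub_add (k l : Fin d → ℤ) : jb k ≤ jb (k - l) + jb l := by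
  simpa using jb_add_le (k - l) l

lemma abs_jb_sub_le (k l : Fin d → ℤ) : |jb k - jb l| ≤ jb (k - l) := by
  rw [abs_le]
  have h1 := jb_le_sub_add k l
  have h2 := jb_le_sub_add l k
  rw [← neg_sub k l, jb_neg] at h2
  constructor <;> linarith

lemma add_rpow_le {x y p : ℝ} (hx : 0 ≤ x) (hy : 0 ≤ y) (hp : 0 ≤ p) :
    (x + y) ^ p ≤ 2 ^ p * (x ^ p + y ^ p) := by
  have h2 : (0 : ℝ) ≤ 2 ^ p := by positivity
  rcases le_total x y with h | h
  · calc (x + y) ^ p ≤ (2 * y) ^ p := Real.rpow_le_rpow (by positivity) (by linarith) hp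
      _ = 2 ^ p * y ^ p := Real.mul_rpow (by norm_num) hy
      _ ≤ _ := mul_le_mul_of_nonneg_left (by linarith [Real.rpow_nonneg hx p]) h2
  · calc (x + y) ^ p ≤ (2 * x) ^ p := Real.rpow_le_rpow (by positivity) (by linarith) hp
      _ = 2 ^ p * x ^ p := Real.mul_rpow (by norm_num) hx
      _ ≤ _ := mul_le_mul_of_nonneg_left (by linarith [Real.rpow_nonneg hy p]) h2

lemma jb_rpow_le {p : ℝ} (hp : 0 ≤ p) (k l : Fin d → ℤ) :
    jb k ^ p ≤ 2 ^ p * (jb (k - l) ^ p + jb l ^ p) :=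
  (Real.rpow_le_rpow (jb_nonneg k) (jb_le_sub_add k l) hp).trans
    (add_rpow_le (jb_nonneg _) (jb_nonneg _) hp)

/-- Mean value theorem; the derivative `s * z ^ (s - 1)` is increasing because `s ≥ 1`. -/
lemma rpow_sub_rpow_le {x y s : ℝ} (hy : 0 < y) (hxy : y ≤ x) (hs : 1 ≤ s) :
    x ^ s - y ^ s ≤ s * x ^ (s - 1) * (x - y) := by
  have hx : 0 < x := hy.trans_le hxy
  rcases hxy.eq_or_lt with rfl | hlt
  · simp
  obtain ⟨c, hc, hc'⟩ := exists_hasDerivAt_eq_slope (fun z : ℝ => z ^ s)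
    (fun z => s * z ^ (s - 1)) hlt
    (Continuous.continuousOn (Real.continuous_rpow_const (by linarith)))
    (fun z _ => Real.hasDerivAt_rpow_const (Or.inr hs))
  rw [eq_div_iff (by linarith)] at hc'
  rw [← hc']
  have : c ^ (s - 1) ≤ x ^ (s - 1) :=
    Real.rpow_le_rpow (hy.trans hc.1).le hc.2.le (by linarith)
  gcongr

/-- The commutator gain. By the mean value theorem and the triangle inequality for `jb`, the
difference costs one factor `jb (k - l)` and leaves only the power `s - 1`. In the energy estimate
that factor falls on the velocity, and the missing power at `l` absorbs the derivative of the
transported function. -/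
lemma abs_jb_rpow_sub_le {s : ℝ} (hs : 1 ≤ s) (k l : Fin d → ℤ) :
    |jb k ^ s - jb l ^ s| ≤
      s * 2 ^ (s - 1) * jb (k - l) * (jb (k - l) ^ (s - 1) + jb l ^ (s - 1)) := by
  have hs1 : 0 ≤ s - 1 := by linarith
  have key : ∀ x y : Fin d → ℤ, jb y ≤ jb x → jb x ≤ jb (k - l) + jb l → jb x - jb y ≤ jb (k - l) →
      jb x ^ s - jb y ^ s ≤
        s * 2 ^ (s - 1) * jb (k - l) * (jb (k - l) ^ (s - 1) + jb l ^ (s - 1)) := by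
    intro x y h1 h2 h3
    refine (rpow_sub_rpow_le (jb_pos y) h1 hs).trans ?_
    have h4 : jb x ^ (s - 1) ≤ 2 ^ (s - 1) * (jb (k - l) ^ (s - 1) + jb l ^ (s - 1)) :=
      (Real.rpow_le_rpow (jb_nonneg x) h2 hs1).trans (add_rpow_le (jb_nonneg _) (jb_nonneg _) hs1)
    have h5 : 0 ≤ jb x - jb y := by linarith
    have h6 : 0 ≤ jb (k - l) ^ (s - 1) + jb l ^ (s - 1) :=
      add_nonneg (Real.rpow_nonneg (jb_nonneg _) _) (Real.rpow_nonneg (jb_nonneg _) _)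
    calc s * jb x ^ (s - 1) * (jb x - jb y)
        ≤ s * (2 ^ (s - 1) * (jb (k - l) ^ (s - 1) + jb l ^ (s - 1))) * jb (k - l) := by
          gcongr
      _ = _ := by ring
  have hd := abs_le.mp (abs_jb_sub_le k l)
  rw [abs_le]
  rcases le_total (jb l) (jb k) with h | h
  · have h1 := key k l h (jb_le_sub_add k l) hd.2
    have h2 := Real.rpow_le_rpow (jb_nonneg l) h (by linarith : 0 ≤ s)
    constructor <;> linarith
  · have h1 := key l k h (by linarith [jb_nonneg (k - l)]) (by linarith)
    have h2 := Real.rpow_le_rpow (jb_nonneg k) h (by linarith : 0 ≤ s)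
    constructor <;> linarith

/-- Comparison with the lattice sum of `‖k‖^(-r)` in the sup norm over `ℤ^d ⊂ ℝ^d`, which converges
for `r` above the rank. -/
lemma summable_jb_rpow {r : ℝ} (hr : (d : ℝ) < r) :
    Summable fun k : Fin d → ℤ => jb k ^ (-r) := by
  have hr0 : 0 < r := (Nat.cast_nonneg d).trans_lt hr
  let b := Pi.basisFun ℝ (Fin d)
  let L := Submodule.span ℤ (Set.range b)
  have hrank : Module.finrank ℤ L = d := by
    rw [ZLattice.rank ℝ L]; simp
  have hmem : ∀ k : Fin d → ℤ, (fun i => (k i : ℝ)) ∈ L := by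
    intro k
    rw [b.mem_span_iff_repr_mem ℤ]
    intro i
    exact ⟨k i, by simp [b]⟩
  have hS := ZLattice.summable_norm_rpow L (-r) (by rw [hrank]; linarith)
  let e : (Fin d → ℤ) → L := fun k => ⟨fun i => (k i : ℝ), hmem k⟩
  have he : Function.Injective e := by
    intro k l hkl
    funext i
    have h : (k i : ℝ) = l i := congrFun (congrArg Subtype.val hkl) i
    exact_mod_cast h
  refine Summable.of_norm_bounded_eventually (hS.comp_injective he) ?_
  -- At the zero frequency the real power `0 ^ (-r)` has the value `0` and the comparison fails, so
  -- this single point is discarded.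
  have hfin : ({0} : Set (Fin d → ℤ)).Finite := Set.finite_singleton 0
  filter_upwards [hfin.compl_mem_cofinite] with k hk
  have hnorm : ‖e k‖ ≤ jb k := by
    change ‖fun i => (k i : ℝ)‖ ≤ jb k
    exact (pi_norm_le_iff_of_nonneg (jb_nonneg k)).mpr fun i => abs_coord_le_jb k i
  have hpos : 0 < ‖e k‖ := by
    rw [norm_pos_iff]
    intro h
    apply hk
    apply he
    rw [h]
    ext i
    simp [e]
  rw [Real.norm_of_nonneg (Real.rpow_nonneg (jb_nonneg k) _)]
  exact Real.rpow_le_rpow_of_nonpos hpos hnorm (by linarith)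

lemma exists_sqSumLe_jb {σ : ℝ} (hσ : (d : ℝ) / 2 < σ) :
    ∃ K : ℝ, 0 ≤ K ∧ SqSumLe (fun k : Fin d → ℤ => jb k ^ (-σ)) K := by
  have h := summable_jb_rpow (d := d) (r := 2 * σ) (by linarith)
  refine ⟨Real.sqrt (∑' k : Fin d → ℤ, jb k ^ (-(2 * σ))), Real.sqrt_nonneg _, fun F => ?_⟩
  have h0 : ∀ k : Fin d → ℤ, 0 ≤ jb k ^ (-(2 * σ)) := fun k => Real.rpow_nonneg (jb_nonneg k) _
  rw [Real.sq_sqrt (tsum_nonneg h0)]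
  refine le_trans (le_of_eq (Finset.sum_congr rfl fun k _ => ?_)) (h.sum_le_tsum F fun k _ => h0 k)
  rw [← Real.rpow_natCast, ← Real.rpow_mul (jb_nonneg k)]
  congr 1
  push_cast
  ring

/-! ### Sobolev bounds for Fourier coefficients -/

/-- The `H^σ` norm of the sequence `a` of Fourier coefficients is at most `M`. -/
def HsBdd (σ : ℝ) (a : (Fin d → ℤ) → ℂ) (M : ℝ) : Prop := SqSumLe (fun k => jb k ^ σ * ‖a k‖) M

lemma one_le_jb_rpow {σ : ℝ} (hσ : 0 ≤ σ) (k : Fin d → ℤ) : 1 ≤ jb k ^ σ :=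
  Real.one_le_rpow (one_le_jb k) hσ

lemma jb_rpow_pos (σ : ℝ) (k : Fin d → ℤ) : 0 < jb k ^ σ := Real.rpow_pos_of_pos (jb_pos k) σ

lemma jb_rpow_nonneg (σ : ℝ) (k : Fin d → ℤ) : 0 ≤ jb k ^ σ := (jb_rpow_pos σ k).le

lemma jb_mul_rpow (σ : ℝ) (k : Fin d → ℤ) : jb k * jb k ^ (σ - 1) = jb k ^ σ := by
  rw [Real.rpow_sub_one (jb_pos k).ne', mul_div_cancel₀ _ (jb_pos k).ne']

variable {a b : (Fin d → ℤ) → ℂ} {M σ : ℝ}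

lemma HsBdd.weaken {τ : ℝ} (ha : HsBdd σ a M) (h : τ ≤ σ) : HsBdd τ a M :=
  SqSumLe.mono ha fun k => by
    rw [abs_of_nonneg (mul_nonneg (jb_rpow_nonneg _ _) (norm_nonneg _))]
    exact mul_le_mul_of_nonneg_right (Real.rpow_le_rpow_of_exponent_le (one_le_jb k) h)
      (norm_nonneg _)

lemma HsBdd.sqSumLe (ha : HsBdd σ a M) (h : 0 ≤ σ) : SqSumLe (fun k => ‖a k‖) M :=
  SqSumLe.mono ha fun k => by
    rw [abs_of_nonneg (norm_nonneg _)]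
    exact le_mul_of_one_le_left (norm_nonneg _) (one_le_jb_rpow h k)

lemma HsBdd.sqSumLe_jb_mul (ha : HsBdd σ a M) (h : 1 ≤ σ) : SqSumLe (fun k => jb k * ‖a k‖) M := by
  have := ha.weaken h
  simpa [HsBdd] using this

lemma HsBdd.norm_le (ha : HsBdd σ a M) (hM : 0 ≤ M) (k : Fin d → ℤ) :
    ‖a k‖ ≤ M * jb k ^ (-σ) := by
  have h := (le_abs_self _).trans (SqSumLe.single_le ha hM k)
  rw [Real.rpow_neg (jb_nonneg k), ← div_eq_mul_inv, le_div_iff₀ (jb_rpow_pos σ k), mul_comm]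
  exact h

lemma HsBdd.add {N : ℝ} (ha : HsBdd σ a M) (hb : HsBdd σ b N) (hM : 0 ≤ M) (hN : 0 ≤ N) :
    HsBdd σ (fun k => a k + b k) (M + N) :=
  SqSumLe.mono (SqSumLe.add ha hb hM hN) fun k => by
    rw [abs_of_nonneg (mul_nonneg (jb_rpow_nonneg _ _) (norm_nonneg _)), ← mul_add]
    exact mul_le_mul_of_nonneg_left (norm_add_le _ _) (jb_rpow_nonneg _ _)

lemma HsBdd.mono_norm (hb : HsBdd σ b M) (h : ∀ k, ‖a k‖ ≤ ‖b k‖) : HsBdd σ a M :=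
  SqSumLe.mono hb fun k => by
    rw [abs_of_nonneg (mul_nonneg (jb_rpow_nonneg _ _) (norm_nonneg _))]
    exact mul_le_mul_of_nonneg_left (h k) (jb_rpow_nonneg _ _)

lemma HsBdd.sub {N : ℝ} (ha : HsBdd σ a M) (hb : HsBdd σ b N) (hM : 0 ≤ M) (hN : 0 ≤ N) :
    HsBdd σ (fun k => a k - b k) (M + N) := by
  simp only [sub_eq_add_neg]
  exact ha.add (hb.mono_norm fun k => by simp) hM hN

/-- `H^σ` embeds into the weighted `ℓ¹` space with weight `(1 + |k|²)^(τ/2)` if `σ - τ > d/2`. -/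
lemma exists_sumLe_of_hsBdd {τ : ℝ} (h : (d : ℝ) / 2 < σ - τ) :
    ∃ K : ℝ, 0 ≤ K ∧ ∀ (c : (Fin d → ℤ) → ℝ) (M : ℝ), 0 ≤ M → SqSumLe (fun k => jb k ^ σ * c k) M →
      SumLe (fun k => jb k ^ τ * c k) (K * M) := by
  obtain ⟨K, hK, hK'⟩ := exists_sqSumLe_jb h
  refine ⟨K, hK, fun c M hM hc F => ?_⟩
  refine le_trans (le_of_eq (Finset.sum_congr rfl fun k _ => ?_)) (hK'.sum_mul_le hc hK hM F)
  rw [← mul_assoc, ← Real.rpow_add (jb_pos k)]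
  ring_nf

end Weight

end ActiveScalar

end

noncomputable section

namespace ActiveScalar

/-! ### The transport nonlinearity on the Fourier side -/

section Advection

variable {d : ℕ}

/-- The properties of the symbol `m_j` of the operator that maps `θ` to the `j`-th component of the
velocity: bounded by `C`, real operators, divergence free. -/
structure IsVelocitySymbol (m : Fin d → (Fin d → ℤ) → ℂ) (C : ℝ) : Prop where
  nonneg : 0 ≤ C
  norm_le : ∀ j k, ‖m j k‖ ≤ C
  map_neg : ∀ j k, m j (-k) = (starRingEnd ℂ) (m j k)
  sum_mul_eq_zero : ∀ k, ∑ j, m j k * (k j : ℂ) = 0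

/-- The Fourier coefficients of the real part of `∑ a_k e_k`. -/
def symm (a : (Fin d → ℤ) → ℂ) (k : Fin d → ℤ) : ℂ := (a k + (starRingEnd ℂ) (a (-k))) / 2

lemma symm_neg (a : (Fin d → ℤ) → ℂ) (k : Fin d → ℤ) :
    symm a (-k) = (starRingEnd ℂ) (symm a k) := by
  simp [symm, add_comm, map_ofNat]

lemma symm_of_real {a : (Fin d → ℤ) → ℂ} (ha : ∀ k, a (-k) = (starRingEnd ℂ) (a k)) :
    symm a = a := by
  funext k
  simp [symm, ha]

lemma norm_symm_le (a : (Fin d → ℤ) → ℂ) (k : Fin d → ℤ) :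
    ‖symm a k‖ ≤ 1 / 2 * ‖a k‖ + 1 / 2 * ‖a (-k)‖ := by
  have h := norm_add_le (a k) ((starRingEnd ℂ) (a (-k)))
  rw [RCLike.norm_conj] at h
  rw [symm, norm_div, RCLike.norm_ofNat]
  linarith

lemma HsBdd.symm {σ M : ℝ} {a : (Fin d → ℤ) → ℂ} (ha : HsBdd σ a M) (hM : 0 ≤ M) :
    HsBdd σ (symm a) M := by
  have h1 := SqSumLe.const_mul ha (1 / 2)
  have h2 := SqSumLe.const_mul (SqSumLe.comp_injective ha (neg_injective (G := Fin d → ℤ))) (1 / 2)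
  have h3 := h1.add h2 (by positivity) (by positivity)
  rw [show 1 / 2 * M + 1 / 2 * M = M by ring] at h3
  refine h3.mono fun k => ?_
  rw [abs_of_nonneg (mul_nonneg (jb_rpow_nonneg _ _) (norm_nonneg _)), jb_neg]
  have := mul_le_mul_of_nonneg_left (norm_symm_le a k) (jb_rpow_nonneg σ k)
  linarith

lemma hsBdd_zero_iff {a : (Fin d → ℤ) → ℂ} {M : ℝ} :
    HsBdd 0 a M ↔ SqSumLe (fun k => ‖a k‖) M := by simp [HsBdd]

lemma sqSumLe_norm_symm {a : (Fin d → ℤ) → ℂ} {M : ℝ} (ha : SqSumLe (fun k => ‖a k‖) M)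
    (hM : 0 ≤ M) : SqSumLe (fun k => ‖symm a k‖) M :=
  hsBdd_zero_iff.mp ((hsBdd_zero_iff.mpr ha).symm hM)

variable (m : Fin d → (Fin d → ℤ) → ℂ)

/-- The symbol of `u[a]·∇` as an infinite matrix. -/
def advKernel (a : (Fin d → ℤ) → ℂ) (k l : Fin d → ℤ) : ℂ :=
  ∑ j, m j (k - l) * symm a (k - l) * (Complex.I * (l j : ℂ))

/-- The `k`-th Fourier coefficient of `u[a]·∇b`, where `u[a]` is the velocity of the real part
of `a`. -/
def adv (a b : (Fin d → ℤ) → ℂ) (k : Fin d → ℤ) : ℂ := ∑' l, advKernel m a k l * b l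

variable {m} {C : ℝ} {a b c : (Fin d → ℤ) → ℂ}

lemma norm_advKernel_le (hm : IsVelocitySymbol m C) (a : (Fin d → ℤ) → ℂ) (k l : Fin d → ℤ) :
    ‖advKernel m a k l‖ ≤ d * C * (‖symm a (k - l)‖ * jb l) := by
  refine (norm_sum_le _ _).trans ((Finset.sum_le_card_nsmul _ _
    (C * (‖symm a (k - l)‖ * jb l)) fun j _ => ?_).trans (le_of_eq ?_))
  · rw [norm_mul, norm_mul, norm_mul, Complex.norm_I, one_mul, Complex.norm_intCast, mul_assoc]
    exact mul_le_mul (hm.norm_le _ _)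
      (mul_le_mul_of_nonneg_left (abs_coord_le_jb l j) (norm_nonneg _))
      (mul_nonneg (norm_nonneg _) (abs_nonneg _)) hm.nonneg
  · simp [mul_assoc]

lemma norm_advTerm_le (hm : IsVelocitySymbol m C) (a b : (Fin d → ℤ) → ℂ) (k l : Fin d → ℤ) :
    ‖advKernel m a k l * b l‖ ≤ d * C * (‖symm a (k - l)‖ * (jb l * ‖b l‖)) := by
  rw [norm_mul]
  calc _ ≤ d * C * (‖symm a (k - l)‖ * jb l) * ‖b l‖ :=
        mul_le_mul_of_nonneg_right (norm_advKernel_le hm a k l) (norm_nonneg _)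
    _ = _ := by ring

/-- The identity `u·∇b = ∇·(ub)`: the two sides differ by `∑ j, m j (k - l) * (k - l) j`, which
vanishes for a divergence-free velocity. -/
lemma advKernel_eq_left (hm : IsVelocitySymbol m C) (a : (Fin d → ℤ) → ℂ) (k l : Fin d → ℤ) :
    advKernel m a k l = ∑ j, m j (k - l) * symm a (k - l) * (Complex.I * (k j : ℂ)) := by
  have h := hm.sum_mul_eq_zero (k - l)
  have h2 : ∑ j, m j (k - l) * symm a (k - l) * (Complex.I * (k j : ℂ)) - advKernel m a k l =
      Complex.I * symm a (k - l) * ∑ j, m j (k - l) * (((k - l) j : ℤ) : ℂ) := by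
    rw [advKernel, ← Finset.sum_sub_distrib, Finset.mul_sum]
    refine Finset.sum_congr rfl fun j _ => ?_
    push_cast [Pi.sub_apply]
    ring
  rw [h, mul_zero, sub_eq_zero] at h2
  exact h2.symm

/-- Skew-adjointness of the kernel, from the conservative form and the reality of the velocity. No
reality of `a` is needed, because the kernel is built from `symm a`; the Galerkin approximations may
therefore be complex. -/
lemma conj_advKernel (hm : IsVelocitySymbol m C) (a : (Fin d → ℤ) → ℂ) (k l : Fin d → ℤ) :
    (starRingEnd ℂ) (advKernel m a k l) = -advKernel m a l k := by
  rw [advKernel_eq_left hm a l k, advKernel, map_sum, ← Finset.sum_neg_distrib]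
  refine Finset.sum_congr rfl fun j _ => ?_
  rw [← neg_sub k l, hm.map_neg, symm_neg]
  simp

/-- The operator `u·∇` with a divergence-free real `u` is skew-adjoint. -/
lemma re_sum_advKernel_eq_zero (hm : IsVelocitySymbol m C) (a c : (Fin d → ℤ) → ℂ)
    (F : Finset (Fin d → ℤ)) :
    (∑ k ∈ F, ∑ l ∈ F, advKernel m a k l * c l * (starRingEnd ℂ) (c k)).re = 0 := by
  set z := ∑ k ∈ F, ∑ l ∈ F, advKernel m a k l * c l * (starRingEnd ℂ) (c k) with hz
  have h : (starRingEnd ℂ) z = -z := by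
    rw [hz, map_sum]
    simp only [map_sum]
    rw [Finset.sum_comm, ← Finset.sum_neg_distrib]
    refine Finset.sum_congr rfl fun k _ => ?_
    rw [← Finset.sum_neg_distrib]
    refine Finset.sum_congr rfl fun l _ => ?_
    rw [map_mul, map_mul, conj_advKernel hm, Complex.conj_conj]
    ring
  have h2 := congrArg Complex.re h
  rw [Complex.conj_re, Complex.neg_re] at h2
  linarith

/-- The velocity is taken in `ℓ¹` and the gradient in `ℓ²` here; the `_right` versions exchange the
roles. The difference estimate needs both, since the difference may sit in either factor and is then
measured in `ℓ²`. -/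
lemma summable_adv_of_sumLe_left (hm : IsVelocitySymbol m C) {A B : ℝ}
    (ha : SumLe (fun k => ‖symm a k‖) A) (hb : SqSumLe (fun k => jb k * ‖b k‖) B) (hB : 0 ≤ B)
    (k : Fin d → ℤ) : Summable fun l => advKernel m a k l * b l :=
  Summable.of_norm_bounded ((ha.summable_conv (fun _ => norm_nonneg _) hb hB
    (fun l => mul_nonneg (jb_nonneg l) (norm_nonneg _)) k).mul_left (d * C))
    fun l => norm_advTerm_le hm a b k l

lemma summable_adv_of_sumLe_right (hm : IsVelocitySymbol m C) {A B : ℝ}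
    (ha : SqSumLe (fun k => ‖symm a k‖) A) (hA : 0 ≤ A) (hb : SumLe (fun k => jb k * ‖b k‖) B)
    (k : Fin d → ℤ) : Summable fun l => advKernel m a k l * b l :=
  Summable.of_norm_bounded ((ha.summable_conv hA (fun _ => norm_nonneg _) hb
    (fun l => mul_nonneg (jb_nonneg l) (norm_nonneg _)) k).mul_left (d * C))
    fun l => norm_advTerm_le hm a b k l

lemma norm_adv_le (hm : IsVelocitySymbol m C) (k : Fin d → ℤ)
    (h : Summable fun l => ‖symm a (k - l)‖ * (jb l * ‖b l‖)) :
    ‖adv m a b k‖ ≤ d * C * ∑' l, ‖symm a (k - l)‖ * (jb l * ‖b l‖) :=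
  tsum_of_norm_bounded (h.hasSum.mul_left (d * C)) fun l => norm_advTerm_le hm a b k l

lemma sqSumLe_adv_of_sumLe_left (hm : IsVelocitySymbol m C) {A B : ℝ}
    (ha : SumLe (fun k => ‖symm a k‖) A) (hb : SqSumLe (fun k => jb k * ‖b k‖) B) (hB : 0 ≤ B) :
    SqSumLe (fun k => ‖adv m a b k‖) (d * C * (A * B)) :=
  ((ha.conv (fun _ => norm_nonneg _) hb hB
    (fun l => mul_nonneg (jb_nonneg l) (norm_nonneg _))).const_mul (d * C)).mono fun k => by
      rw [abs_of_nonneg (norm_nonneg _)]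
      exact norm_adv_le hm k (ha.summable_conv (fun _ => norm_nonneg _) hb hB
        (fun l => mul_nonneg (jb_nonneg l) (norm_nonneg _)) k)

lemma sqSumLe_adv_of_sumLe_right (hm : IsVelocitySymbol m C) {A B : ℝ}
    (ha : SqSumLe (fun k => ‖symm a k‖) A) (hA : 0 ≤ A) (hb : SumLe (fun k => jb k * ‖b k‖) B) :
    SqSumLe (fun k => ‖adv m a b k‖) (d * C * (A * B)) :=
  ((ha.conv hA (fun _ => norm_nonneg _) hb
    (fun l => mul_nonneg (jb_nonneg l) (norm_nonneg _))).const_mul (d * C)).mono fun k => by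
      rw [abs_of_nonneg (norm_nonneg _)]
      exact norm_adv_le hm k (ha.summable_conv hA (fun _ => norm_nonneg _) hb
        (fun l => mul_nonneg (jb_nonneg l) (norm_nonneg _)) k)

/-- In conservative form every term carries a factor `k j`. This is why the mean is conserved. -/
lemma adv_zero_mode (hm : IsVelocitySymbol m C) (a b : (Fin d → ℤ) → ℂ) : adv m a b 0 = 0 := by
  simp [adv, advKernel_eq_left hm]

lemma adv_add_right {k : Fin d → ℤ} (hb : Summable fun l => advKernel m a k l * b l)
    (hc : Summable fun l => advKernel m a k l * c l) :
    adv m a (fun l => b l + c l) k = adv m a b k + adv m a c k := by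
  simp only [adv, mul_add]
  exact hb.tsum_add hc

lemma adv_sub_right {k : Fin d → ℤ} (hb : Summable fun l => advKernel m a k l * b l)
    (hc : Summable fun l => advKernel m a k l * c l) :
    adv m a (fun l => b l - c l) k = adv m a b k - adv m a c k := by
  simp only [adv, mul_sub]
  exact hb.tsum_sub hc

lemma advKernel_add (a b : (Fin d → ℤ) → ℂ) (k l : Fin d → ℤ) :
    advKernel m (fun l => a l + b l) k l = advKernel m a k l + advKernel m b k l := by
  simp only [advKernel, ← Finset.sum_add_distrib, symm, map_add]
  exact Finset.sum_congr rfl fun _ _ => by ring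

lemma advKernel_sub (a b : (Fin d → ℤ) → ℂ) (k l : Fin d → ℤ) :
    advKernel m (fun l => a l - b l) k l = advKernel m a k l - advKernel m b k l := by
  simp only [advKernel, ← Finset.sum_sub_distrib, symm, map_sub]
  exact Finset.sum_congr rfl fun _ _ => by ring

lemma adv_add_left {k : Fin d → ℤ} (hb : Summable fun l => advKernel m a k l * c l)
    (hc : Summable fun l => advKernel m b k l * c l) :
    adv m (fun l => a l + b l) c k = adv m a c k + adv m b c k := by
  simp only [adv, advKernel_add, add_mul]
  exact hb.tsum_add hc

lemma adv_sub_left {k : Fin d → ℤ} (hb : Summable fun l => advKernel m a k l * c l)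
    (hc : Summable fun l => advKernel m b k l * c l) :
    adv m (fun l => a l - b l) c k = adv m a c k - adv m b c k := by
  simp only [adv, advKernel_sub, sub_mul]
  exact hb.tsum_sub hc

lemma abs_re_sum_mul_conj_le {ι : Type*} {x y : ι → ℂ} {A B : ℝ} (hx : SqSumLe (fun k => ‖x k‖) A)
    (hy : SqSumLe (fun k => ‖y k‖) B) (hA : 0 ≤ A) (hB : 0 ≤ B) (F : Finset ι) :
    |(∑ k ∈ F, x k * (starRingEnd ℂ) (y k)).re| ≤ A * B := by
  refine (Complex.abs_re_le_norm _).trans ((norm_sum_le _ _).trans ?_)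
  simp only [norm_mul, RCLike.norm_conj]
  exact hx.sum_mul_le hy hA hB F

/-- Constants of the embedding of `H^s`, `s > d/2 + 1`, into the Wiener algebra with one
derivative. -/
lemma exists_wiener_bound {s : ℝ} (hs : (d : ℝ) / 2 + 1 < s) :
    ∃ K : ℝ, 0 ≤ K ∧ ∀ (c : (Fin d → ℤ) → ℂ) (M : ℝ), 0 ≤ M → HsBdd s c M →
      SumLe (fun k => jb k * ‖c k‖) (K * M) ∧ SumLe (fun k => ‖c k‖) (K * M) := by
  obtain ⟨K, hK, h⟩ := exists_sumLe_of_hsBdd (d := d) (σ := s) (τ := 1) (by linarith)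
  refine ⟨K, hK, fun c M hM hc => ?_⟩
  have h1 := h (fun k => ‖c k‖) M hM hc
  simp only [Real.rpow_one] at h1
  exact ⟨h1, h1.mono fun k => le_mul_of_one_le_left (norm_nonneg _) (one_le_jb k)⟩

lemma one_lt_of_half_dim_lt {s : ℝ} (hs : (d : ℝ) / 2 + 1 < s) : 1 < s := by
  have : (0 : ℝ) ≤ d := Nat.cast_nonneg d
  linarith

/-- The nonlinearity loses one derivative: `u[a]·∇b ∈ H^{s-1}`. -/
lemma exists_hsBdd_adv (hm : IsVelocitySymbol m C) {s : ℝ} (hs : (d : ℝ) / 2 + 1 < s) :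
    ∃ K : ℝ, 0 ≤ K ∧ ∀ (a b : (Fin d → ℤ) → ℂ) (A B : ℝ), 0 ≤ A → 0 ≤ B → HsBdd s a A →
      HsBdd s b B → HsBdd (s - 1) (adv m a b) (K * (A * B)) := by
  obtain ⟨K, hK, hW⟩ := exists_wiener_bound hs
  have h1s := one_lt_of_half_dim_lt hs
  have hdC : 0 ≤ d * C := mul_nonneg (Nat.cast_nonneg d) hm.nonneg
  refine ⟨d * C * 2 ^ (s - 1) * (2 * K), by positivity, fun a b A B hA hB ha hb => ?_⟩
  have hsa := ha.symm hA
  have ha1 := (hW _ A hA hsa).2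
  have hb1 := (hW _ B hB hb).1
  have n1 : ∀ k : Fin d → ℤ, 0 ≤ jb k ^ (s - 1) * ‖symm a k‖ :=
    fun k => mul_nonneg (jb_rpow_nonneg _ _) (norm_nonneg _)
  have n2 : ∀ k : Fin d → ℤ, 0 ≤ jb k * ‖b k‖ := fun k => mul_nonneg (jb_nonneg _) (norm_nonneg _)
  have n3 : ∀ k : Fin d → ℤ, 0 ≤ jb k ^ s * ‖b k‖ :=
    fun k => mul_nonneg (jb_rpow_nonneg _ _) (norm_nonneg _)
  have hsa' : HsBdd (s - 1) (symm a) A := hsa.weaken (by linarith)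
  -- The weight at `k` is split between `k - l` and `l`. In the first term it falls on the velocity,
  -- with the gradient in `ℓ¹`; in the second it joins the derivative on `b` to the power `s`, with
  -- the velocity in `ℓ¹`.
  have hc1 := SqSumLe.conv hsa' hA n1 hb1 n2
  have hc2 := ha1.conv (fun _ => norm_nonneg _) hb hB n3
  have hs1 := SqSumLe.summable_conv hsa' hA n1 hb1 n2
  have hs2 := ha1.summable_conv (fun _ => norm_nonneg _) hb hB n3
  have hs0 := ha1.summable_conv (fun _ => norm_nonneg _) (hb.sqSumLe_jb_mul h1s.le) hB n2
  have h := (hc1.add hc2 (by positivity) (by positivity)).const_mul (d * C * 2 ^ (s - 1))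
  rw [show d * C * 2 ^ (s - 1) * (A * (K * B) + K * A * B) =
    d * C * 2 ^ (s - 1) * (2 * K) * (A * B) by ring] at h
  refine h.mono fun k => ?_
  rw [abs_of_nonneg (mul_nonneg (jb_rpow_nonneg _ _) (norm_nonneg _)),
    ← (hs1 k).tsum_add (hs2 k)]
  refine (mul_le_mul_of_nonneg_left (norm_adv_le hm k (hs0 k)) (jb_rpow_nonneg _ _)).trans ?_
  rw [mul_left_comm, mul_assoc (d * C), ← tsum_mul_left (a := jb k ^ (s - 1)),
    ← tsum_mul_left (a := (2 : ℝ) ^ (s - 1))]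
  refine mul_le_mul_of_nonneg_left (Summable.tsum_le_tsum (fun l => ?_) ((hs0 k).mul_left _)
    (((hs1 k).add (hs2 k)).mul_left _)) hdC
  have hj := jb_rpow_le (p := s - 1) (by linarith) k l
  calc jb k ^ (s - 1) * (‖symm a (k - l)‖ * (jb l * ‖b l‖))
      ≤ 2 ^ (s - 1) * (jb (k - l) ^ (s - 1) + jb l ^ (s - 1)) *
          (‖symm a (k - l)‖ * (jb l * ‖b l‖)) :=
        mul_le_mul_of_nonneg_right hj (mul_nonneg (norm_nonneg _) (n2 l))
    _ = 2 ^ (s - 1) * (jb (k - l) ^ (s - 1) * ‖symm a (k - l)‖ * (jb l * ‖b l‖) +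
          ‖symm a (k - l)‖ * (jb l * jb l ^ (s - 1) * ‖b l‖)) := by ring
    _ = _ := by rw [jb_mul_rpow]

/-- The `H^s` energy estimate for finitely supported coefficients. -/
lemma exists_energy_bound (hm : IsVelocitySymbol m C) {s : ℝ} (hs : (d : ℝ) / 2 + 1 < s) :
    ∃ K : ℝ, 0 ≤ K ∧ ∀ (F : Finset (Fin d → ℤ)) (a : (Fin d → ℤ) → ℂ) (M : ℝ), 0 ≤ M →
      HsBdd s a M → (∀ k ∉ F, a k = 0) →
      |(∑ k ∈ F, ((jb k ^ s : ℝ) : ℂ) ^ 2 * adv m a a k * (starRingEnd ℂ) (a k)).re| ≤ K * M ^ 3 := by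
  obtain ⟨K, hK, hW⟩ := exists_wiener_bound hs
  have h1s := one_lt_of_half_dim_lt hs
  have hdC : 0 ≤ d * C := mul_nonneg (Nat.cast_nonneg d) hm.nonneg
  refine ⟨d * C * (s * 2 ^ (s - 1)) * (2 * K), by positivity, fun F a M hM ha haF => ?_⟩
  have hsa := ha.symm hM
  have hsa1 := (hW _ M hM hsa).1
  have ha1 := (hW _ M hM ha).1
  let c : (Fin d → ℤ) → ℂ := fun k => ((jb k ^ s : ℝ) : ℂ) * a k
  have hc : ∀ k, ‖c k‖ = jb k ^ s * ‖a k‖ := fun k => by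
    simp only [c]
    rw [norm_mul, Complex.norm_real, Real.norm_of_nonneg (jb_rpow_nonneg s k)]
  -- One of the two weights at `k` is written as `(jb k ^ s - jb l ^ s) + jb l ^ s`. The first part
  -- is the commutator; the second turns `a l` into `c l` and leaves the quadratic form of `u·∇` at
  -- `c`, whose real part is zero.
  have hdecomp : ∑ k ∈ F, ((jb k ^ s : ℝ) : ℂ) ^ 2 * adv m a a k * (starRingEnd ℂ) (a k) =
      ∑ k ∈ F, (∑ l ∈ F, ((jb k ^ s - jb l ^ s : ℝ) : ℂ) * (advKernel m a k l * a l)) *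
        (starRingEnd ℂ) (c k) +
      ∑ k ∈ F, ∑ l ∈ F, advKernel m a k l * c l * (starRingEnd ℂ) (c k) := by
    rw [← Finset.sum_add_distrib]
    refine Finset.sum_congr rfl fun k _ => ?_
    -- The support of `a` makes both sums run over the same finite set, as the skew-symmetry
    -- argument requires.
    have : adv m a a k = ∑ l ∈ F, advKernel m a k l * a l :=
      tsum_eq_sum fun l hl => by rw [haF l hl, mul_zero]
    rw [this, Finset.mul_sum, Finset.sum_mul, Finset.sum_mul, ← Finset.sum_add_distrib]
    refine Finset.sum_congr rfl fun l _ => ?_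
    simp only [c, map_mul, Complex.conj_ofReal]
    rw [Complex.ofReal_sub]
    ring
  rw [hdecomp, Complex.add_re, re_sum_advKernel_eq_zero hm, add_zero]
  have n1 : ∀ k : Fin d → ℤ, 0 ≤ jb k ^ s * ‖symm a k‖ :=
    fun k => mul_nonneg (jb_rpow_nonneg _ _) (norm_nonneg _)
  have n2 : ∀ k : Fin d → ℤ, 0 ≤ jb k * ‖a k‖ := fun k => mul_nonneg (jb_nonneg _) (norm_nonneg _)
  have n3 : ∀ k : Fin d → ℤ, 0 ≤ jb k ^ s * ‖a k‖ :=
    fun k => mul_nonneg (jb_rpow_nonneg _ _) (norm_nonneg _)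
  have n4 : ∀ k : Fin d → ℤ, 0 ≤ jb k * ‖symm a k‖ :=
    fun k => mul_nonneg (jb_nonneg _) (norm_nonneg _)
  have hs1 := SqSumLe.summable_conv hsa hM n1 ha1 n2
  have hs2 := hsa1.summable_conv n4 ha hM n3
  have hc1 := SqSumLe.conv hsa hM n1 ha1 n2
  have hc2 := hsa1.conv n4 ha hM n3
  have h := (hc1.add hc2 (by positivity) (by positivity)).const_mul (d * C * (s * 2 ^ (s - 1)))
  have h' : SqSumLe (fun k => ‖∑ l ∈ F, ((jb k ^ s - jb l ^ s : ℝ) : ℂ) *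
      (advKernel m a k l * a l)‖) (d * C * (s * 2 ^ (s - 1)) * (M * (K * M) + K * M * M)) := by
    refine h.mono fun k => ?_
    rw [abs_of_nonneg (norm_nonneg _), ← (hs1 k).tsum_add (hs2 k), ← tsum_mul_left]
    refine (norm_sum_le _ _).trans (le_trans (Finset.sum_le_sum fun l _ => ?_)
      ((((hs1 k).add (hs2 k)).mul_left (d * C * (s * 2 ^ (s - 1)))).sum_le_tsum F fun l _ => ?_))
    -- In each of the two resulting products one factor carries the full power `s` and lies in `ℓ²`,
    -- the other carries one derivative and lies in `ℓ¹`.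
    · rw [norm_mul, Complex.norm_real, Real.norm_eq_abs]
      calc |jb k ^ s - jb l ^ s| * ‖advKernel m a k l * a l‖
          ≤ s * 2 ^ (s - 1) * jb (k - l) * (jb (k - l) ^ (s - 1) + jb l ^ (s - 1)) *
            (d * C * (‖symm a (k - l)‖ * (jb l * ‖a l‖))) :=
            mul_le_mul (abs_jb_rpow_sub_le h1s.le k l) (norm_advTerm_le hm a a k l)
              (norm_nonneg _) (by
                have := jb_nonneg (k - l)
                have := jb_rpow_nonneg (s - 1) (k - l)
                have := jb_rpow_nonneg (s - 1) l
                positivity)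
        _ = d * C * (s * 2 ^ (s - 1)) *
            (jb (k - l) * jb (k - l) ^ (s - 1) * ‖symm a (k - l)‖ * (jb l * ‖a l‖) +
              jb (k - l) * ‖symm a (k - l)‖ * (jb l * jb l ^ (s - 1) * ‖a l‖)) := by ring
        _ = _ := by rw [jb_mul_rpow, jb_mul_rpow]
    · have := n1 (k - l)
      have := n2 l
      have := n3 l
      have := n4 (k - l)
      positivity
  have hcM : SqSumLe (fun k => ‖c k‖) M := by
    simp only [hc]
    exact ha
  refine (abs_re_sum_mul_conj_le h' hcM (by positivity) hM F).trans (le_of_eq ?_)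
  ring

/-- The `ℓ²` estimate for the difference of two nonlinearities, tested against the low modes of
the difference. -/
lemma exists_difference_bound (hm : IsVelocitySymbol m C) {s : ℝ} (hs : (d : ℝ) / 2 + 1 < s) :
    ∃ K : ℝ, 0 ≤ K ∧ ∀ (F : Finset (Fin d → ℤ)) (ε M : ℝ) (a b : (Fin d → ℤ) → ℂ), 0 ≤ M → 0 ≤ ε →
      (∀ k ∉ F, jb k ^ (1 - s) ≤ ε) → HsBdd s a M → HsBdd s b M →
      |(∑ k ∈ F, (adv m a a k - adv m b b k) * (starRingEnd ℂ) (a k - b k)).re| ≤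
        K * (M * ∑ k ∈ F, ‖a k - b k‖ ^ 2 + ε * M ^ 3) := by
  classical
  obtain ⟨K, hK, hW⟩ := exists_wiener_bound hs
  have h1s := one_lt_of_half_dim_lt hs
  have hdC : 0 ≤ d * C := mul_nonneg (Nat.cast_nonneg d) hm.nonneg
  -- Each of the two high-mode terms below contributes `4 * d * C * K * ε * M ^ 3`, after `W ≤ 2 *
  -- M` is used once; this gives the `8`.
  refine ⟨8 * (d * C) * K, by positivity, fun F ε M a b hM hε hF ha hb => ?_⟩
  -- Low modes `w` and high modes `q` of the difference. Testing against `w` alone makes the skew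
  -- term a finite sum.
  let w : (Fin d → ℤ) → ℂ := fun k => if k ∈ F then a k - b k else 0
  let q : (Fin d → ℤ) → ℂ := fun k => if k ∈ F then 0 else a k - b k
  have hwq : ∀ k, a k - b k = w k + q k := fun k => by by_cases h : k ∈ F <;> simp [w, q, h]
  have hab := ha.sub hb hM hM
  set W := Real.sqrt (∑ k ∈ F, ‖a k - b k‖ ^ 2) with hWdef
  have hW0 : 0 ≤ W := Real.sqrt_nonneg _
  have hWsq : W ^ 2 = ∑ k ∈ F, ‖a k - b k‖ ^ 2 :=
    Real.sq_sqrt (Finset.sum_nonneg fun _ _ => sq_nonneg _)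
  have hWM : W ≤ M + M := by
    refine le_of_sq_le_sq ?_ (by positivity)
    rw [hWsq]
    exact hab.sqSumLe (by linarith) F
  have hwle : ∀ k, ‖w k‖ ≤ ‖a k - b k‖ := fun k => by by_cases h : k ∈ F <;> simp [w, h]
  have hw2 : SqSumLe (fun k => ‖w k‖) W := by
    intro G
    rw [hWsq]
    calc ∑ k ∈ G, ‖w k‖ ^ 2 = ∑ k ∈ G with k ∈ F, ‖a k - b k‖ ^ 2 := by
          rw [Finset.sum_filter]
          refine Finset.sum_congr rfl fun k _ => ?_
          by_cases h : k ∈ F <;> simp [w, h]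
      _ ≤ _ := Finset.sum_le_sum_of_subset_of_nonneg
          (fun k hk => (Finset.mem_filter.mp hk).2) fun _ _ _ => sq_nonneg _
  have hwJ : SqSumLe (fun k => jb k * ‖w k‖) (M + M) := (hab.mono_norm hwle).sqSumLe_jb_mul h1s.le
  -- Outside `F` one derivative is bought from the `H^s` bound at the price `jb k ^ (1 - s) ≤ ε`.
  have hqJ : SqSumLe (fun k => jb k * ‖q k‖) (ε * (M + M)) := by
    refine (SqSumLe.const_mul hab ε).mono fun k => ?_
    rw [abs_of_nonneg (mul_nonneg (jb_nonneg k) (norm_nonneg _))]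
    by_cases h : k ∈ F
    · simp only [q, h, if_true, norm_zero, mul_zero]
      have := jb_rpow_nonneg s k
      positivity
    · simp only [q, h, if_false]
      calc jb k * ‖a k - b k‖ = jb k ^ (1 - s) * (jb k ^ s * ‖a k - b k‖) := by
            rw [← mul_assoc, ← Real.rpow_add (jb_pos k)]
            simp
        _ ≤ _ := mul_le_mul_of_nonneg_right (hF k h)
            (mul_nonneg (jb_rpow_nonneg s k) (norm_nonneg _))
  have hq2 : SqSumLe (fun k => ‖q k‖) (ε * (M + M)) := hqJ.mono fun k => by
    rw [abs_of_nonneg (norm_nonneg _)]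
    exact le_mul_of_one_le_left (norm_nonneg _) (one_le_jb k)
  have hεM : 0 ≤ ε * (M + M) := by positivity
  have hsa1 := (hW _ M hM (ha.symm hM)).2
  have hb1 := (hW _ M hM hb).1
  have hsw := sqSumLe_norm_symm hw2 hW0
  have hsq := sqSumLe_norm_symm hq2 hεM
  have haJ := ha.sqSumLe_jb_mul h1s.le
  have hbJ := hb.sqSumLe_jb_mul h1s.le
  have hsb1 := (hW _ M hM (hb.symm hM)).2
  -- The difference is `u[a]·∇(a - b) + u[a - b]·∇b`, with `a - b = w + q` in both terms.
  have hexp : ∀ k, adv m a a k - adv m b b k =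
      adv m a w k + adv m a q k + adv m w b k + adv m q b k := by
    intro k
    have e1 : adv m a (fun l => a l - b l) k = adv m a a k - adv m a b k :=
      adv_sub_right (summable_adv_of_sumLe_left hm hsa1 haJ hM k)
        (summable_adv_of_sumLe_left hm hsa1 hbJ hM k)
    have e2 : adv m (fun l => a l - b l) b k = adv m a b k - adv m b b k :=
      adv_sub_left (summable_adv_of_sumLe_left hm hsa1 hbJ hM k)
        (summable_adv_of_sumLe_left hm hsb1 hbJ hM k)
    simp only [hwq] at e1 e2
    rw [adv_add_right (summable_adv_of_sumLe_left hm hsa1 hwJ (by positivity) k)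
      (summable_adv_of_sumLe_left hm hsa1 hqJ hεM k)] at e1
    rw [adv_add_left (summable_adv_of_sumLe_right hm hsw hW0 hb1 k)
      (summable_adv_of_sumLe_right hm hsq hεM hb1 k)] at e2
    linear_combination -e1 - e2
  have hsum : ∑ k ∈ F, (adv m a a k - adv m b b k) * (starRingEnd ℂ) (a k - b k) =
      ∑ k ∈ F, ∑ l ∈ F, advKernel m a k l * w l * (starRingEnd ℂ) (w k) +
      ∑ k ∈ F, adv m a q k * (starRingEnd ℂ) (w k) + ∑ k ∈ F, adv m w b k * (starRingEnd ℂ) (w k) +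
      ∑ k ∈ F, adv m q b k * (starRingEnd ℂ) (w k) := by
    rw [← Finset.sum_add_distrib, ← Finset.sum_add_distrib, ← Finset.sum_add_distrib]
    refine Finset.sum_congr rfl fun k hk => ?_
    have h1 : a k - b k = w k := by simp [w, hk]
    have h2 : adv m a w k = ∑ l ∈ F, advKernel m a k l * w l :=
      tsum_eq_sum fun l hl => by simp [w, hl]
    rw [hexp, h1, h2, ← Finset.sum_mul]
    ring
  -- The term `u[a]·∇w` tested with `w` vanishes. Of the rest, `u[w]·∇b` is quadratic in `W`, and
  -- the two terms containing `q` are small with `ε`.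
  rw [hsum, Complex.add_re, Complex.add_re, Complex.add_re, re_sum_advKernel_eq_zero hm, zero_add]
  have b1 := abs_re_sum_mul_conj_le (sqSumLe_adv_of_sumLe_left hm hsa1 hqJ hεM) hw2
    (by positivity) hW0 F
  have b2 := abs_re_sum_mul_conj_le (sqSumLe_adv_of_sumLe_right hm hsw hW0 hb1) hw2
    (by positivity) hW0 F
  have b3 := abs_re_sum_mul_conj_le (sqSumLe_adv_of_sumLe_right hm hsq hεM hb1) hw2
    (by positivity) hW0 F
  refine (abs_add_le _ _).trans ((add_le_add_left (abs_add_le _ _) _).trans ?_)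
  refine (add_le_add (add_le_add b1 b2) b3).trans ?_
  rw [← hWsq]
  have hX : 0 ≤ d * C * K := by positivity
  have h1 : d * C * (K * M * (ε * (M + M))) * W ≤ d * C * (K * M * (ε * (M + M))) * (M + M) :=
    mul_le_mul_of_nonneg_left hWM (by positivity)
  have h2 : 0 ≤ d * C * K * (M * W ^ 2) := by positivity
  nlinarith [h1, h2]

end Advection

end ActiveScalar

end

noncomputable section

namespace ActiveScalar

open Set Filter Topology

/-! ### Solutions in terms of Fourier coefficients -/

/-- Grönwall on both sides of time zero; negative times are handled by reflection. Two-sided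
intervals are used so that the solution obtained is differentiable in a neighbourhood of the initial
time. -/
lemma gronwall_Icc {f f' : ℝ → ℝ} {α β K ε δ : ℝ} (hα : α ≤ 0) (hβ : 0 ≤ β) (hK : 0 ≤ K)
    (hε : 0 ≤ ε) (hδ : 0 ≤ δ) (hf : ∀ t ∈ Icc α β, HasDerivWithinAt f (f' t) (Icc α β) t)
    (h0 : |f 0| ≤ δ) (hb : ∀ t ∈ Icc α β, |f' t| ≤ K * |f t| + ε) {L : ℝ} (hL : β - α ≤ L) :
    ∀ t ∈ Icc α β, |f t| ≤ gronwallBound δ K ε L := by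
  have main : ∀ (g g' : ℝ → ℝ) (γ : ℝ), |g 0| ≤ δ → γ ≤ L →
      (∀ t ∈ Icc 0 γ, HasDerivWithinAt g (g' t) (Icc 0 γ) t) →
      (∀ t ∈ Icc 0 γ, |g' t| ≤ K * |g t| + ε) → ∀ t ∈ Icc 0 γ, |g t| ≤ gronwallBound δ K ε L := by
    intro g g' γ hg0 hγ hg hgb t ht
    have h := norm_le_gronwallBound_of_norm_deriv_right_le (f := g) (f' := g') (δ := δ) (K := K)
      (ε := ε) (a := 0) (b := γ) (fun x hx => (hg x hx).continuousWithinAt)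
      (fun x hx => (hg x (Ico_subset_Icc_self hx)).mono_of_mem_nhdsWithin
        (Icc_mem_nhdsGE_of_mem hx)) hg0 (fun x hx => hgb x (Ico_subset_Icc_self hx)) t ht
    exact h.trans (gronwallBound_mono hδ hε hK (by linarith [ht.2]))
  intro t ht
  rcases le_total 0 t with h | h
  · exact main f f' β h0 (by linarith)
      (fun τ hτ => (hf τ ⟨hα.trans hτ.1, hτ.2⟩).mono (Icc_subset_Icc_left hα))
      (fun τ hτ => hb τ ⟨hα.trans hτ.1, hτ.2⟩) t ⟨h, ht.2⟩
  · have := main (fun τ => f (-τ)) (fun τ => -f' (-τ)) (-α) (by simpa using h0) (by linarith)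
      (fun τ hτ => by
        have h1 := hf (-τ) ⟨by linarith [hτ.2], by linarith [hτ.1]⟩
        have h2 := h1.scomp τ (hasDerivAt_neg τ).hasDerivWithinAt (t' := Icc α β) (s := Icc 0 (-α))
          (fun x hx => ⟨by linarith [hx.2], by linarith [hx.1]⟩)
        simpa [Function.comp_def] using h2)
      (fun τ hτ => by
        rw [abs_neg]
        exact hb (-τ) ⟨by linarith [hτ.2], by linarith [hτ.1]⟩) (-t) ⟨by linarith, by linarith [ht.1]⟩
    simpa using this

section Coefficients

variable {d : ℕ}

/-- The cube of frequencies `|k_i| ≤ n`. -/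
def box (d n : ℕ) : Finset (Fin d → ℤ) := Fintype.piFinset fun _ => Finset.Icc (-(n : ℤ)) n

lemma mem_box {n : ℕ} {k : Fin d → ℤ} : k ∈ box d n ↔ ∀ i, |k i| ≤ n := by
  simp [box, Fintype.mem_piFinset, abs_le]

lemma box_mono : Monotone (box d) := fun n n' h k hk =>
  mem_box.mpr fun i => (mem_box.mp hk i).trans (by exact_mod_cast h)

lemma eventually_mem_box (k : Fin d → ℤ) : ∀ᶠ n in atTop, k ∈ box d n := by
  filter_upwards [eventually_ge_atTop (∑ i, (k i).natAbs)] with n hn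
  refine mem_box.mpr fun i => ?_
  rw [Int.abs_eq_natAbs]
  exact_mod_cast (Finset.single_le_sum (f := fun i => (k i).natAbs) (fun _ _ => Nat.zero_le _)
    (Finset.mem_univ i)).trans hn

/-- Some integer coordinate exceeds `n`, hence is at least `n + 1` in absolute value. -/
lemma jb_rpow_le_of_notMem_box {n : ℕ} {k : Fin d → ℤ} (hk : k ∉ box d n) {s : ℝ} (hs : 1 ≤ s) :
    jb k ^ (1 - s) ≤ ((n : ℝ) + 1) ^ (1 - s) := by
  rw [mem_box] at hk
  push Not at hk
  obtain ⟨i, hi⟩ := hk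
  refine Real.rpow_le_rpow_of_nonpos (by positivity) ?_ (by linarith)
  refine le_trans ?_ (abs_coord_le_jb k i)
  exact_mod_cast hi

lemma tendsto_box_rate {s : ℝ} (hs : 1 < s) :
    Tendsto (fun n : ℕ => ((n : ℝ) + 1) ^ (1 - s)) atTop (𝓝 0) := by
  have h := (tendsto_rpow_neg_atTop (y := s - 1) (by linarith)).comp
    (tendsto_atTop_add_const_right atTop (1 : ℝ) tendsto_natCast_atTop_atTop)
  simpa [Function.comp_def] using h

variable {m : Fin d → (Fin d → ℤ) → ℂ} {C : ℝ}

lemma hasDerivWithinAt_weighted_sum_sq {w w' : ℝ → (Fin d → ℤ) → ℂ} {I : Set ℝ} {t : ℝ}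
    (F : Finset (Fin d → ℤ)) (ρ : (Fin d → ℤ) → ℝ)
    (h : ∀ k ∈ F, HasDerivWithinAt (fun τ => w τ k) (w' t k) I t) :
    HasDerivWithinAt (fun τ => ∑ k ∈ F, ρ k * ‖w τ k‖ ^ 2)
      (2 * (∑ k ∈ F, (ρ k : ℂ) * w' t k * (starRingEnd ℂ) (w t k)).re) I t := by
  have h1 := HasDerivWithinAt.fun_sum fun k hk => ((h k hk).norm_sq).const_mul (ρ k)
  refine h1.congr_deriv ?_
  rw [Complex.re_sum, Finset.mul_sum]
  refine Finset.sum_congr rfl fun k _ => ?_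
  rw [Complex.inner, mul_assoc, Complex.re_ofReal_mul, mul_comm (w' t k)]
  ring

/-- Two solutions of the low modes of the equation with the same initial data stay close. -/
lemma exists_closeness (hm : IsVelocitySymbol m C) {s : ℝ} (hs : (d : ℝ) / 2 + 1 < s) {M : ℝ}
    (hM : 0 ≤ M) (L : ℝ) (S : (Fin d → ℤ) → ℂ) :
    ∃ δ : ℕ → ℝ, Tendsto δ atTop (𝓝 0) ∧ ∀ (α β : ℝ), α ≤ 0 → 0 ≤ β → β - α ≤ L →
      ∀ (n : ℕ) (a b : ℝ → (Fin d → ℤ) → ℂ),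
        (∀ t ∈ Icc α β, HsBdd s (a t) M) → (∀ t ∈ Icc α β, HsBdd s (b t) M) →
        (∀ k ∈ box d n, a 0 k = b 0 k) →
        (∀ k ∈ box d n, ∀ t ∈ Icc α β,
          HasDerivWithinAt (fun τ => a τ k) (S k - adv m (a t) (a t) k) (Icc α β) t) →
        (∀ k ∈ box d n, ∀ t ∈ Icc α β,
          HasDerivWithinAt (fun τ => b τ k) (S k - adv m (b t) (b t) k) (Icc α β) t) →
        ∀ t ∈ Icc α β, ∑ k ∈ box d n, ‖a t k - b t k‖ ^ 2 ≤ δ n := by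
  obtain ⟨K, hK, hdiff⟩ := exists_difference_bound hm hs
  have h1s := one_lt_of_half_dim_lt hs
  -- The initial difference is zero on the box, so the Grönwall bound is driven only by the
  -- high-mode error `(n + 1) ^ (1 - s)`; it tends to zero by continuity in the forcing. The same
  -- bound serves all intervals of length at most `L`.
  refine ⟨fun n => gronwallBound 0 (2 * K * M) (2 * K * M ^ 3 * ((n : ℝ) + 1) ^ (1 - s)) L, ?_, ?_⟩
  · have h1 := (tendsto_box_rate h1s).const_mul (2 * K * M ^ 3)
    rw [mul_zero] at h1
    have h2 := ((gronwallBound_continuous_ε 0 (2 * K * M) L).tendsto 0).comp h1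
    rwa [gronwallBound_ε0_δ0] at h2
  intro α β hα hβ hL n a b ha hb hab hda hdb t ht
  set ε := ((n : ℝ) + 1) ^ (1 - s) with hε
  have hε0 : 0 ≤ ε := by positivity
  have hnn : ∀ t, 0 ≤ ∑ k ∈ box d n, (1 : ℝ) * ‖a t k - b t k‖ ^ 2 := fun t =>
    Finset.sum_nonneg fun _ _ => by positivity
  have key := gronwall_Icc (f := fun τ => ∑ k ∈ box d n, (1 : ℝ) * ‖a τ k - b τ k‖ ^ 2)
    (f' := fun t => 2 * (∑ k ∈ box d n, ((1 : ℝ) : ℂ) * ((S k - adv m (a t) (a t) k) -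
      (S k - adv m (b t) (b t) k)) * (starRingEnd ℂ) (a t k - b t k)).re)
    (K := 2 * K * M) (ε := 2 * K * M ^ 3 * ε) (δ := 0) hα hβ (by positivity) (by positivity) le_rfl
    (fun t ht => hasDerivWithinAt_weighted_sum_sq (w := fun τ k => a τ k - b τ k)
      (w' := fun t k => (S k - adv m (a t) (a t) k) - (S k - adv m (b t) (b t) k))
      (box d n) (fun _ => 1) fun k hk => (hda k hk t ht).sub (hdb k hk t ht))
    (by
      rw [abs_of_nonneg (hnn 0), Finset.sum_eq_zero fun k hk => by simp [hab k hk]])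
    (fun t ht => by
      rw [abs_of_nonneg (hnn t)]
      have h := hdiff (box d n) ε M (a t) (b t) hM hε0
        (fun k hk => jb_rpow_le_of_notMem_box hk h1s.le) (ha t ht) (hb t ht)
      have e : ∑ k ∈ box d n, ((1 : ℝ) : ℂ) * ((S k - adv m (a t) (a t) k) -
          (S k - adv m (b t) (b t) k)) * (starRingEnd ℂ) (a t k - b t k) =
          -∑ k ∈ box d n, (adv m (a t) (a t) k - adv m (b t) (b t) k) *
            (starRingEnd ℂ) (a t k - b t k) := by
        rw [← Finset.sum_neg_distrib]
        refine Finset.sum_congr rfl fun k _ => ?_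
        rw [Complex.ofReal_one]
        ring
      rw [e, Complex.neg_re, mul_neg, abs_neg, abs_mul, abs_two]
      simp only [one_mul]
      linarith) hL t ht
  rw [abs_of_nonneg (hnn t)] at key
  simpa only [one_mul] using key

/-- Under a uniform `H^s` bound, convergence of each coefficient suffices. The `l`-th term is
dominated by a multiple of `jb (k - l) ^ (-s) * jb l ^ (1 - s)`, a product of two square-summable
sequences since `s - 1 > d/2`. -/
lemma tendsto_adv (hm : IsVelocitySymbol m C) {s : ℝ} (hs : (d : ℝ) / 2 + 1 < s) {M : ℝ}
    (hM : 0 ≤ M) {κ : Type*} {l : Filter κ} {u : κ → (Fin d → ℤ) → ℂ} {a : (Fin d → ℤ) → ℂ}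
    (hu : ∀ᶠ n in l, HsBdd s (u n) M) (hlim : ∀ k, Tendsto (fun n => u n k) l (𝓝 (a k)))
    (k : Fin d → ℤ) : Tendsto (fun n => adv m (u n) (u n) k) l (𝓝 (adv m a a k)) := by
  have hdC : 0 ≤ d * C := mul_nonneg (Nat.cast_nonneg d) hm.nonneg
  obtain ⟨K₁, -, h₁⟩ := exists_sqSumLe_jb (d := d) (σ := s) (by linarith)
  obtain ⟨K₂, -, h₂⟩ := exists_sqSumLe_jb (d := d) (σ := s - 1) (by linarith)
  have s₁ := (h₁.comp_injective (sub_right_injective (b := k))).summable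
  have s₂ := h₂.summable
  refine tendsto_tsum_of_dominated_convergence (bound := fun l =>
    d * C * M ^ 2 * ((jb (k - l) ^ (-s)) ^ 2 + (jb l ^ (-(s - 1))) ^ 2)) ((s₁.add s₂).mul_left _)
    (fun l => ?_) (hu.mono fun n hn l => ?_)
  · refine Tendsto.mul (tendsto_finsetSum _ fun j _ => ?_) (hlim l)
    refine Tendsto.mul_const _ (Tendsto.const_mul _ ?_)
    exact ((hlim _).add ((Complex.continuous_conj.tendsto _).comp (hlim _))).div_const _
  · refine (norm_advTerm_le hm _ _ k l).trans ?_
    rw [mul_assoc (d * C)]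
    refine mul_le_mul_of_nonneg_left ?_ hdC
    have e1 := (hn.symm hM).norm_le hM (k - l)
    have e2 := hn.norm_le hM l
    have e3 : jb l * (M * jb l ^ (-s)) = M * jb l ^ (-(s - 1)) := by
      rw [neg_sub, sub_eq_add_neg, Real.rpow_add (jb_pos l), Real.rpow_one]
      ring
    calc ‖symm (u n) (k - l)‖ * (jb l * ‖u n l‖)
        ≤ M * jb (k - l) ^ (-s) * (jb l * (M * jb l ^ (-s))) := by
          have := jb_nonneg l
          have := jb_rpow_nonneg (-s) (k - l)
          gcongr
      _ = M ^ 2 * (jb (k - l) ^ (-s) * jb l ^ (-(s - 1))) := by rw [e3]; ring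
      _ ≤ _ := by
          refine mul_le_mul_of_nonneg_left ?_ (sq_nonneg M)
          nlinarith [sq_nonneg (jb (k - l) ^ (-s) - jb l ^ (-(s - 1))),
            sq_nonneg (jb (k - l) ^ (-s) + jb l ^ (-(s - 1)))]

/-! ### Galerkin approximation -/

/-- A field bounded by `B` moves a point by at most `B * T` in time `T`, so Picard–Lindelöf applies
on the ball of that radius and on the whole interval. -/
lemma exists_global_flow {E : Type*} [NormedAddCommGroup E] [NormedSpace ℝ E] [CompleteSpace E]
    {V : E → E} {K : NNReal} (hK : LipschitzWith K V) {B : ℝ} (hB : ∀ x, ‖V x‖ ≤ B) (x₀ : E)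
    {T : ℝ} (hT : 0 ≤ T) : ∃ X : ℝ → E, X 0 = x₀ ∧
      ∀ t ∈ Icc (-T) T, HasDerivWithinAt X (V (X t)) (Icc (-T) T) t := by
  have hB0 : 0 ≤ B := (norm_nonneg _).trans (hB x₀)
  have h0 : (0 : ℝ) ∈ Icc (-T) T := ⟨by linarith, hT⟩
  have hPL : IsPicardLindelof (fun _ => V) (⟨0, h0⟩ : Icc (-T) T) x₀ (⟨B * T, by positivity⟩ : NNReal)
      0 (⟨B, hB0⟩ : NNReal) K :=
    IsPicardLindelof.of_time_independent (fun x _ => hB x) hK.lipschitzOnWith (by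
      change B * max (T - 0) (0 - -T) ≤ B * T - 0
      simp)
  exact hPL.exists_eq_forall_mem_Icc_hasDerivWithinAt₀

/-- Extension by zero of finitely many Fourier coefficients. -/
def extendZero (F : Finset (Fin d → ℤ)) (X : F → ℂ) (k : Fin d → ℤ) : ℂ :=
  if h : k ∈ F then X ⟨k, h⟩ else 0

lemma extendZero_of_mem {F : Finset (Fin d → ℤ)} (X : F → ℂ) {k : Fin d → ℤ} (h : k ∈ F) :
    extendZero F X k = X ⟨k, h⟩ := dif_pos h

lemma extendZero_of_notMem {F : Finset (Fin d → ℤ)} (X : F → ℂ) {k : Fin d → ℤ} (h : k ∉ F) :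
    extendZero F X k = 0 := dif_neg h

lemma contDiff_extendZero (F : Finset (Fin d → ℤ)) (k : Fin d → ℤ) :
    ContDiff ℝ 1 fun X : F → ℂ => extendZero F X k := by
  by_cases h : k ∈ F
  · simp only [extendZero_of_mem _ h]
    exact contDiff_apply ℝ ℂ _
  · simp only [extendZero_of_notMem _ h]
    exact contDiff_const

/-- A polynomial in finitely many coordinates and their conjugates, hence smooth over `ℝ`. -/
lemma contDiff_adv_extendZero (m : Fin d → (Fin d → ℤ) → ℂ) (F : Finset (Fin d → ℤ))
    (k : Fin d → ℤ) :
    ContDiff ℝ 1 fun X : F → ℂ => adv m (extendZero F X) (extendZero F X) k := by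
  have h : (fun X : F → ℂ => adv m (extendZero F X) (extendZero F X) k) =
      fun X => ∑ l ∈ F, advKernel m (extendZero F X) k l * extendZero F X l := by
    funext X
    exact tsum_eq_sum fun l hl => by rw [extendZero_of_notMem X hl, mul_zero]
  rw [h]
  refine ContDiff.sum fun l _ => ContDiff.mul (ContDiff.sum fun j _ => ?_) (contDiff_extendZero F l)
  refine (contDiff_const.mul (ContDiff.div_const ?_ _)).mul contDiff_const
  exact (contDiff_extendZero F _).add
    (Complex.conjCLE.contDiff.comp (contDiff_extendZero F _))

/-- The square of the `H^s` norm of finitely many Fourier coefficients. -/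
def energy (s : ℝ) (F : Finset (Fin d → ℤ)) (a : (Fin d → ℤ) → ℂ) : ℝ :=
  ∑ k ∈ F, (jb k ^ s) ^ 2 * ‖a k‖ ^ 2

lemma energy_nonneg (s : ℝ) (F : Finset (Fin d → ℤ)) (a : (Fin d → ℤ) → ℂ) : 0 ≤ energy s F a :=
  Finset.sum_nonneg fun _ _ => by positivity

lemma hsBdd_of_energy_le {s : ℝ} {F : Finset (Fin d → ℤ)} {a : (Fin d → ℤ) → ℂ} {R : ℝ}
    (ha : ∀ k ∉ F, a k = 0) (h : energy s F a ≤ R) : HsBdd s a (Real.sqrt R) := by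
  classical
  intro G
  rw [Real.sq_sqrt ((energy_nonneg s F a).trans h)]
  refine le_trans ?_ h
  calc ∑ k ∈ G, (jb k ^ s * ‖a k‖) ^ 2 = ∑ k ∈ G with k ∈ F, (jb k ^ s * ‖a k‖) ^ 2 := by
        rw [Finset.sum_filter]
        refine Finset.sum_congr rfl fun k _ => ?_
        by_cases hk : k ∈ F
        · simp [hk]
        · simp [hk, ha k hk]
    _ ≤ ∑ k ∈ F, (jb k ^ s * ‖a k‖) ^ 2 := Finset.sum_le_sum_of_subset_of_nonneg
        (fun k hk => (Finset.mem_filter.mp hk).2) fun _ _ _ => sq_nonneg _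
    _ = energy s F a := Finset.sum_congr rfl fun k _ => mul_pow _ _ _

lemma contDiff_energy_extendZero (s : ℝ) (F : Finset (Fin d → ℤ)) :
    ContDiff ℝ 1 fun X : F → ℂ => energy s F (extendZero F X) :=
  ContDiff.sum fun k _ => contDiff_const.mul ((contDiff_extendZero F k).norm_sq ℝ)

lemma norm_le_of_energy_extendZero_le {s : ℝ} (hs : 0 ≤ s) {F : Finset (Fin d → ℤ)} {X : F → ℂ}
    {R : ℝ} (h : energy s F (extendZero F X) ≤ R) : ‖X‖ ≤ Real.sqrt R := by
  refine (pi_norm_le_iff_of_nonneg (Real.sqrt_nonneg _)).mpr fun k => ?_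
  have h1 := (hsBdd_of_energy_le (fun k hk => extendZero_of_notMem X hk) h).sqSumLe hs
  have h2 := h1.single_le (Real.sqrt_nonneg _) k
  rwa [abs_of_nonneg (norm_nonneg _), extendZero_of_mem X k.2] at h2

/-- The Galerkin system with a cut-off of the nonlinearity at large `H^s` norm. -/
lemma exists_truncated_galerkin (m : Fin d → (Fin d → ℤ) → ℂ) {s : ℝ} (hs : 0 ≤ s)
    (η : ContDiffBump (0 : ℝ)) (θ₀ S : (Fin d → ℤ) → ℂ) (F : Finset (Fin d → ℤ)) {T : ℝ}
    (hT : 0 ≤ T) :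
    ∃ a : ℝ → (Fin d → ℤ) → ℂ, (∀ t, ∀ k ∉ F, a t k = 0) ∧ (∀ k ∈ F, a 0 k = θ₀ k) ∧
      ∀ k ∈ F, ∀ t ∈ Icc (-T) T, HasDerivWithinAt (fun τ => a τ k)
        (S k - (η (energy s F (a t)) : ℂ) * adv m (a t) (a t) k) (Icc (-T) T) t := by
  -- The cut-off in the energy makes the quadratic field compactly supported and `C¹`, hence bounded
  -- and globally Lipschitz; the truncated system then has a solution on any prescribed interval.
  let W : (F → ℂ) → (F → ℂ) := fun X k =>
    (η (energy s F (extendZero F X)) : ℂ) * adv m (extendZero F X) (extendZero F X) k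
  have hW : ContDiff ℝ 1 W := by
    refine contDiff_pi.mpr fun k => ContDiff.mul ?_ (contDiff_adv_extendZero m F k)
    exact Complex.ofRealCLM.contDiff.comp (η.contDiff.comp (contDiff_energy_extendZero s F))
  have hWc : HasCompactSupport W := by
    refine HasCompactSupport.intro (isCompact_closedBall (0 : F → ℂ) (Real.sqrt η.rOut))
      fun X hX => ?_
    have h1 : η.rOut ≤ energy s F (extendZero F X) := by
      by_contra hlt
      push Not at hlt
      exact hX (by
        rw [mem_closedBall_zero_iff]
        exact norm_le_of_energy_extendZero_le hs hlt.le)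
    have h2 : η (energy s F (extendZero F X)) = 0 := η.zero_of_le_dist (by
      rw [Real.dist_0_eq_abs, abs_of_nonneg (energy_nonneg s F _)]
      exact h1)
    funext k
    simp [W, h2]
  obtain ⟨K, hK⟩ := hW.lipschitzWith_of_hasCompactSupport hWc one_ne_zero
  obtain ⟨B, hB⟩ := hWc.exists_bound_of_continuous hW.continuous
  let S' : F → ℂ := fun k => S k
  have hV : LipschitzWith K fun X => S' - W X := by
    refine LipschitzWith.of_dist_le_mul fun X Y => ?_
    rw [dist_sub_left]
    exact hK.dist_le_mul X Y
  obtain ⟨X, hX0, hX⟩ := exists_global_flow hV (B := ‖S'‖ + B)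
    (fun X => (norm_sub_le _ _).trans (add_le_add_right (hB X) _)) (fun k : F => θ₀ k) hT
  refine ⟨fun t => extendZero F (X t), fun t k hk => extendZero_of_notMem _ hk, fun k hk => ?_,
    fun k hk t ht => ?_⟩
  · simp only [extendZero_of_mem _ hk, hX0]
  · have h := (hasDerivWithinAt_pi.mp (hX t ht)) ⟨k, hk⟩
    simp only [extendZero_of_mem _ hk]
    exact h

/-- Galerkin approximations exist on a common time interval, with a common `H^s` bound. -/
lemma exists_galerkin (hm : IsVelocitySymbol m C) {s : ℝ} (hs : (d : ℝ) / 2 + 1 < s)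
    {θ₀ S : (Fin d → ℤ) → ℂ} {M₀ : ℝ} (hM₀ : 0 ≤ M₀) (hθ₀ : HsBdd s θ₀ M₀) (hS : HsBdd s S M₀) :
    ∃ T M : ℝ, 0 < T ∧ 0 ≤ M ∧ ∀ n : ℕ, ∃ a : ℝ → (Fin d → ℤ) → ℂ,
      (∀ t, ∀ k ∉ box d n, a t k = 0) ∧ (∀ t ∈ Icc (-T) T, HsBdd s (a t) M) ∧ (∀ k ∈ box d n, a 0 k = θ₀ k) ∧
      ∀ k ∈ box d n, ∀ t ∈ Icc (-T) T, HasDerivWithinAt (fun τ => a τ k)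
        (S k - adv m (a t) (a t) k) (Icc (-T) T) t := by
  obtain ⟨K, hK, hE⟩ := exists_energy_bound hm hs
  have h1s := one_lt_of_half_dim_lt hs
  -- One unit above the bound on the initial energy. The cut-off equals `1` for energies up to `R`
  -- and `0` from `R + 1` on.
  set R := M₀ ^ 2 + 1 with hR
  have hR0 : 0 < R := by positivity
  let η : ContDiffBump (0 : ℝ) := ⟨R, R + 1, hR0, by linarith⟩
  -- The source contributes `2 * M₀ * √f ≤ M₀ ^ 2 + f` to the growth of the energy `f`, which gives
  -- Grönwall rate `1`. The cut-off nonlinearity contributes at most `2 * K * √(R + 1) ^ 3`.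
  set ε := M₀ ^ 2 + 2 * (K * Real.sqrt (R + 1) ^ 3) with hε
  have hε0 : 0 ≤ ε := by positivity
  -- At time zero the Grönwall bound is `M₀ ^ 2 < R`, so by continuity it stays below `R` for a
  -- short time. None of the constants depends on `n`.
  obtain ⟨T, hT, hTR⟩ : ∃ T : ℝ, 0 < T ∧ gronwallBound (M₀ ^ 2) 1 ε (2 * T) ≤ R := by
    have hc : ContinuousAt (fun T : ℝ => gronwallBound (M₀ ^ 2) 1 ε (2 * T)) 0 :=
      ContinuousAt.comp (g := gronwallBound (M₀ ^ 2) 1 ε) (f := fun T : ℝ => 2 * T)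
        (hasDerivAt_gronwallBound _ _ _ _).continuousAt (by fun_prop)
    have h0 : gronwallBound (M₀ ^ 2) 1 ε (2 * 0) < R := by
      rw [mul_zero, gronwallBound_x0]
      linarith
    have h1 := (hc.eventually_lt continuousAt_const h0).filter_mono
      (nhdsWithin_le_nhds (s := Ioi 0))
    obtain ⟨T, hT1, hT2⟩ := (h1.and self_mem_nhdsWithin).exists
    exact ⟨T, hT2, hT1.le⟩
  refine ⟨T, Real.sqrt R, hT, Real.sqrt_nonneg _, fun n => ?_⟩
  obtain ⟨a, haF, ha0, had⟩ :=
    exists_truncated_galerkin m (by linarith : 0 ≤ s) η θ₀ S (box d n) hT.le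
  have hen : ∀ t ∈ Icc (-T) T, |energy s (box d n) (a t)| ≤ R := by
    intro t ht
    refine le_trans (gronwall_Icc (f := fun t => energy s (box d n) (a t))
      (f' := fun t => 2 * (∑ k ∈ box d n, (((jb k ^ s) ^ 2 : ℝ) : ℂ) *
        (S k - (η (energy s (box d n) (a t)) : ℂ) * adv m (a t) (a t) k) *
          (starRingEnd ℂ) (a t k)).re)
      (K := 1) (ε := ε) (δ := M₀ ^ 2) (by linarith) hT.le zero_le_one hε0 (sq_nonneg _)
      (fun t ht => hasDerivWithinAt_weighted_sum_sq (w := a) (w' := fun t k =>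
        S k - (η (energy s (box d n) (a t)) : ℂ) * adv m (a t) (a t) k) (box d n)
        (fun k => (jb k ^ s) ^ 2) fun k hk => had k hk t ht) ?_ ?_ (L := 2 * T) (by linarith) t ht)
      hTR
    · rw [abs_of_nonneg (energy_nonneg _ _ _)]
      refine le_trans (le_of_eq (Finset.sum_congr rfl fun k hk => ?_)) (hθ₀ (box d n))
      rw [ha0 k hk, mul_pow]
    · intro t _
      set f := energy s (box d n) (a t) with hf
      have hf0 : 0 ≤ f := energy_nonneg _ _ _
      have hab : HsBdd s (a t) (Real.sqrt f) := hsBdd_of_energy_le (haF t) le_rfl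
      have hsplit : ∑ k ∈ box d n, (((jb k ^ s) ^ 2 : ℝ) : ℂ) *
          (S k - (η f : ℂ) * adv m (a t) (a t) k) * (starRingEnd ℂ) (a t k) =
          ∑ k ∈ box d n, (((jb k ^ s : ℝ) : ℂ) * S k) *
            (starRingEnd ℂ) (((jb k ^ s : ℝ) : ℂ) * a t k) -
          (η f : ℂ) * ∑ k ∈ box d n, ((jb k ^ s : ℝ) : ℂ) ^ 2 * adv m (a t) (a t) k *
            (starRingEnd ℂ) (a t k) := by
        rw [Finset.mul_sum, ← Finset.sum_sub_distrib]
        refine Finset.sum_congr rfl fun k _ => ?_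
        rw [map_mul, Complex.conj_ofReal, Complex.ofReal_pow]
        ring
      have hnrm : ∀ c : (Fin d → ℤ) → ℂ, (fun k => ‖((jb k ^ s : ℝ) : ℂ) * c k‖) =
          fun k => jb k ^ s * ‖c k‖ := fun c => by
        funext k
        rw [norm_mul, Complex.norm_real, Real.norm_of_nonneg (jb_rpow_nonneg s k)]
      have b1 := abs_re_sum_mul_conj_le (x := fun k => ((jb k ^ s : ℝ) : ℂ) * S k)
        (y := fun k => ((jb k ^ s : ℝ) : ℂ) * a t k) (A := M₀) (B := Real.sqrt f)
        (by rw [hnrm]; exact hS) (by rw [hnrm]; exact hab) hM₀ (Real.sqrt_nonneg _) (box d n)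
      have b2 : |η f * (∑ k ∈ box d n, ((jb k ^ s : ℝ) : ℂ) ^ 2 * adv m (a t) (a t) k *
            (starRingEnd ℂ) (a t k)).re| ≤ K * Real.sqrt (R + 1) ^ 3 := by
        by_cases hle : f ≤ R + 1
        · rw [abs_mul, abs_of_nonneg η.nonneg]
          refine (mul_le_of_le_one_left (abs_nonneg _) η.le_one).trans ?_
          refine (hE (box d n) (a t) _ (Real.sqrt_nonneg _) hab (haF t)).trans ?_
          have := Real.sqrt_le_sqrt hle
          gcongr
        · have : η f = 0 := η.zero_of_le_dist (by
            rw [Real.dist_0_eq_abs, abs_of_nonneg hf0]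
            exact (not_le.mp hle).le)
          rw [this, zero_mul, abs_zero]
          positivity
      rw [hsplit, Complex.sub_re, Complex.re_ofReal_mul, abs_mul, abs_two, abs_of_nonneg hf0]
      have b3 := abs_sub (∑ k ∈ box d n, (((jb k ^ s : ℝ) : ℂ) * S k) *
            (starRingEnd ℂ) (((jb k ^ s : ℝ) : ℂ) * a t k)).re (η f *
          (∑ k ∈ box d n, ((jb k ^ s : ℝ) : ℂ) ^ 2 * adv m (a t) (a t) k *
            (starRingEnd ℂ) (a t k)).re)
      have b4 := Real.sq_sqrt hf0
      nlinarith [sq_nonneg (M₀ - Real.sqrt f)]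
  refine ⟨a, haF, fun t ht => hsBdd_of_energy_le (haF t) ((le_abs_self _).trans (hen t ht)), ha0,
    fun k hk t ht => ?_⟩
  -- The energy never leaves the region where the cut-off is `1`, so the truncated system is the
  -- Galerkin system itself.
  have h1 : η (energy s (box d n) (a t)) = 1 := η.one_of_mem_closedBall (by
    rw [mem_closedBall_zero_iff, Real.norm_eq_abs]
    exact hen t ht)
  have h2 := had k hk t ht
  rwa [h1, Complex.ofReal_one, one_mul] at h2

end Coefficients

end ActiveScalar

end

/-! ### Limit of the Galerkin approximations and uniqueness for the coefficient system. -/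

noncomputable section

namespace ActiveScalar

open Set Filter Topology

/-- Extending `g` by its end values gives a function continuous on all of `ℝ`, to which the
fundamental theorem applies at the end points too. -/
lemma hasDerivWithinAt_integral_Icc {g : ℝ → ℂ} {α β : ℝ} (hα : α ≤ 0) (hβ : 0 ≤ β)
    (hg : ContinuousOn g (Icc α β)) (c : ℂ) {t : ℝ} (ht : t ∈ Icc α β) :
    HasDerivWithinAt (fun t => c + ∫ τ in (0 : ℝ)..t, g τ) (g t) (Icc α β) t := by
  have hαβ := hα.trans hβ
  have hG : Continuous (IccExtend hαβ ((Icc α β).domRestrict g)) :=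
    (continuousOn_iff_continuous_domRestrict.mp hg).Icc_extend'
  have hGe : ∀ τ ∈ Icc α β, IccExtend hαβ ((Icc α β).domRestrict g) τ = g τ := fun τ hτ => by
    rw [IccExtend_of_mem _ _ hτ, domRestrict_apply]
  have h := ((intervalIntegral.integral_hasDerivAt_right (hG.intervalIntegrable 0 t)
    (hG.stronglyMeasurableAtFilter _ _) hG.continuousAt).const_add c).hasDerivWithinAt (s := Icc α β)
  rw [hGe t ht] at h
  have he : ∀ x ∈ Icc α β, c + ∫ τ in (0 : ℝ)..x, g τ =
      c + ∫ τ in (0 : ℝ)..x, IccExtend hαβ ((Icc α β).domRestrict g) τ := by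
    intro x hx
    congr 1
    refine intervalIntegral.integral_congr fun τ hτ => (hGe τ ?_).symm
    exact uIcc_subset_Icc ⟨hα, hβ⟩ hx hτ
  exact h.congr he (he t ht)

lemma eq_add_integral_of_hasDerivWithinAt {E : Type*} [NormedAddCommGroup E] [NormedSpace ℝ E]
    [CompleteSpace E] {f g : ℝ → E} {α β : ℝ} (hα : α ≤ 0) (hβ : 0 ≤ β)
    (hf : ∀ t ∈ Icc α β, HasDerivWithinAt f (g t) (Icc α β) t) (hg : ContinuousOn g (Icc α β))
    {t : ℝ} (ht : t ∈ Icc α β) : f t = f 0 + ∫ τ in (0 : ℝ)..t, g τ := by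
  have hsub : uIcc 0 t ⊆ Icc α β := uIcc_subset_Icc ⟨hα, hβ⟩ ht
  rw [intervalIntegral.integral_eq_sub_of_hasDeriv_right (f := f) (f' := g)]
  · abel
  · exact fun x hx => ((hf x (hsub hx)).continuousWithinAt).mono hsub
  · intro x hx
    have hx' : x ∈ Ioo α β :=
      ⟨(le_min hα ht.1).trans_lt hx.1, hx.2.trans_le (max_le hβ ht.2)⟩
    exact ((hf x (Ioo_subset_Icc_self hx')).hasDerivAt (Icc_mem_nhds hx'.1 hx'.2)).hasDerivWithinAt
  · exact (hg.mono hsub).intervalIntegrable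

section Coefficients

variable {d : ℕ} {m : Fin d → (Fin d → ℤ) → ℂ} {C : ℝ}

lemma continuousOn_adv (hm : IsVelocitySymbol m C) {s : ℝ} (hs : (d : ℝ) / 2 + 1 < s) {M : ℝ}
    (hM : 0 ≤ M) {I : Set ℝ} {a : ℝ → (Fin d → ℤ) → ℂ} (ha : ∀ t ∈ I, HsBdd s (a t) M)
    (hc : ∀ k, ContinuousOn (fun t => a t k) I) (k : Fin d → ℤ) :
    ContinuousOn (fun t => adv m (a t) (a t) k) I := fun t ht =>
  tendsto_adv hm hs hM (eventually_mem_nhdsWithin.mono ha) (fun l => hc l t ht) k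

lemma exists_norm_adv_le (hm : IsVelocitySymbol m C) {s : ℝ} (hs : (d : ℝ) / 2 + 1 < s) {M : ℝ}
    (hM : 0 ≤ M) : ∃ B : ℝ, ∀ a : (Fin d → ℤ) → ℂ, HsBdd s a M → ∀ k, ‖adv m a a k‖ ≤ B := by
  obtain ⟨K, hK, h⟩ := exists_hsBdd_adv hm hs
  refine ⟨K * (M * M), fun a ha k => ?_⟩
  have h1 := ((h a a M M hM hM ha ha).sqSumLe (by linarith [one_lt_of_half_dim_lt hs])).single_le
    (by positivity) k
  rwa [abs_of_nonneg (norm_nonneg _)] at h1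

/-- Local existence in terms of Fourier coefficients. -/
theorem exists_coeff_solution (hm : IsVelocitySymbol m C) {s : ℝ} (hs : (d : ℝ) / 2 + 1 < s)
    {θ₀ S : (Fin d → ℤ) → ℂ} {M₀ : ℝ} (hM₀ : 0 ≤ M₀) (hθ₀ : HsBdd s θ₀ M₀) (hS : HsBdd s S M₀) :
    ∃ T M : ℝ, 0 < T ∧ 0 ≤ M ∧ ∃ a : ℝ → (Fin d → ℤ) → ℂ,
      (∀ t ∈ Icc (-T) T, HsBdd s (a t) M) ∧ (∀ k, a 0 k = θ₀ k) ∧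
      ∀ k, ∀ t ∈ Icc (-T) T, HasDerivWithinAt (fun τ => a τ k)
        (S k - adv m (a t) (a t) k) (Icc (-T) T) t := by
  obtain ⟨T, M, hT, hM, hgal⟩ := exists_galerkin hm hs hM₀ hθ₀ hS
  choose A hAz hAbd hA0 hAd using hgal
  have hα : -T ≤ 0 := by linarith
  have h0 : (0 : ℝ) ∈ Icc (-T) T := ⟨hα, hT.le⟩
  obtain ⟨δ, hδ, hclose⟩ := exists_closeness hm hs hM (T - -T) S
  -- The finer approximation also solves the modes of the smaller box, with the same data there.
  have hdist : ∀ n n', n ≤ n' → ∀ k ∈ box d n, ∀ t ∈ Icc (-T) T,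
      ‖A n t k - A n' t k‖ ^ 2 ≤ δ n := by
    intro n n' hn k hk t ht
    refine le_trans ?_ (hclose (-T) T hα hT.le le_rfl n (A n) (A n') (hAbd n) (hAbd n')
      (fun k hk => by rw [hA0 n k hk, hA0 n' k (box_mono hn hk)]) (hAd n)
      (fun k hk => hAd n' k (box_mono hn hk)) t ht)
    exact Finset.single_le_sum (f := fun k => ‖A n t k - A n' t k‖ ^ 2)
      (fun _ _ => sq_nonneg _) hk
  -- Outside the time interval the limit is an arbitrary value and is never used.
  have hlim : ∀ t k, ∃ z, t ∈ Icc (-T) T → Tendsto (fun n => A n t k) atTop (𝓝 z) := by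
    intro t k
    by_cases ht : t ∈ Icc (-T) T
    · have hC : CauchySeq fun n => A n t k := by
        refine Metric.cauchySeq_iff'.mpr fun ε hε => ?_
        obtain ⟨N, hN1, hN2⟩ :=
          ((eventually_mem_box k).and (hδ.eventually_lt_const (pow_pos hε 2))).exists
        refine ⟨N, fun n hn => ?_⟩
        rw [dist_comm, dist_eq_norm]
        exact lt_of_pow_lt_pow_left₀ 2 hε.le ((hdist N n hn k hN1 t ht).trans_lt hN2)
      obtain ⟨z, hz⟩ := cauchySeq_tendsto_of_complete hC
      exact ⟨z, fun _ => hz⟩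
    · exact ⟨0, fun h => absurd h ht⟩
  choose a ha using hlim
  have hbd : ∀ t ∈ Icc (-T) T, HsBdd s (a t) M := fun t ht =>
    SqSumLe.of_tendsto (u := fun n k => jb k ^ s * ‖A n t k‖)
      (Eventually.of_forall fun n => hAbd n t ht) fun k => ((ha t k ht).norm).const_mul _
  have hAc : ∀ n, ∀ k ∈ box d n, ContinuousOn (fun t => A n t k) (Icc (-T) T) :=
    fun n k hk t ht => (hAd n k hk t ht).continuousWithinAt
  -- The bound `δ n` does not depend on `t`, so each mode converges uniformly in time.
  have hcont : ∀ k, ContinuousOn (fun t => a t k) (Icc (-T) T) := by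
    intro k
    have hu : TendstoUniformlyOn (fun n t => A n t k) (fun t => a t k) atTop (Icc (-T) T) := by
      refine Metric.tendstoUniformlyOn_iff.mpr fun ε hε => ?_
      filter_upwards [eventually_mem_box k, hδ.eventually_lt_const (pow_pos hε 2)] with n hn1 hn2
      intro t ht
      rw [dist_comm, dist_eq_norm]
      refine lt_of_pow_lt_pow_left₀ 2 hε.le (lt_of_le_of_lt ?_ hn2)
      refine le_of_tendsto (((ha t k ht).const_sub (A n t k)).norm.pow 2) ?_
      filter_upwards [eventually_ge_atTop n] with n' hn'
      exact hdist n n' hn' k hn1 t ht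
    exact hu.continuousOn ((eventually_mem_box k).mono fun n hn => hAc n k hn).frequently
  have ha0 : ∀ k, a 0 k = θ₀ k := fun k => tendsto_nhds_unique (ha 0 k h0)
    (tendsto_const_nhds.congr' ((eventually_mem_box k).mono fun n hn => (hA0 n k hn).symm))
  -- The limit is taken in the integrated equation by dominated convergence, so no convergence of
  -- time derivatives is needed. The integrand of the limit equation is continuous, and
  -- differentiating recovers the system.
  have hint : ∀ k, ∀ t ∈ Icc (-T) T,
      a t k = θ₀ k + ∫ τ in (0 : ℝ)..t, (S k - adv m (a τ) (a τ) k) := by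
    intro k t ht
    have hsub : uIoc 0 t ⊆ Icc (-T) T := uIoc_subset_uIcc.trans (uIcc_subset_Icc h0 ht)
    obtain ⟨B, hB⟩ := exists_norm_adv_le hm hs hM
    have hAc' : ∀ n l, ContinuousOn (fun t => A n t l) (Icc (-T) T) := fun n l => by
      by_cases hl : l ∈ box d n
      · exact hAc n l hl
      · simp only [hAz n _ l hl]
        exact continuousOn_const
    have hAg : ∀ n, ContinuousOn (fun τ => S k - adv m (A n τ) (A n τ) k) (Icc (-T) T) := fun n =>
      continuousOn_const.sub (continuousOn_adv hm hs hM (hAbd n) (hAc' n) k)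
    have hAint : ∀ᶠ n in atTop,
        θ₀ k + ∫ τ in (0 : ℝ)..t, (S k - adv m (A n τ) (A n τ) k) = A n t k := by
      filter_upwards [eventually_mem_box k] with n hn
      rw [← hA0 n k hn]
      exact (eq_add_integral_of_hasDerivWithinAt hα hT.le (hAd n k hn) (hAg n) ht).symm
    refine tendsto_nhds_unique (ha t k ht) (Tendsto.congr' hAint (Tendsto.const_add _ ?_))
    refine intervalIntegral.tendsto_integral_filter_of_dominated_convergence
      (fun _ => ‖S k‖ + B) (Eventually.of_forall fun n => ?_) (Eventually.of_forall fun n => ?_)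
      intervalIntegrable_const ?_
    · exact ((hAg n).mono hsub).aestronglyMeasurable measurableSet_uIoc
    · exact Eventually.of_forall fun τ hτ => (norm_sub_le _ _).trans
        (add_le_add_right (hB _ (hAbd n τ (hsub hτ)) k) _)
    · exact Eventually.of_forall fun τ hτ => Tendsto.const_sub _
        (tendsto_adv hm hs hM (Eventually.of_forall fun n => hAbd n τ (hsub hτ))
          (fun l => ha τ l (hsub hτ)) k)
  refine ⟨T, M, hT, hM, a, hbd, ha0, fun k t ht => ?_⟩
  have hg : ContinuousOn (fun τ => S k - adv m (a τ) (a τ) k) (Icc (-T) T) :=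
    continuousOn_const.sub (continuousOn_adv hm hs hM hbd hcont k)
  exact (hasDerivWithinAt_integral_Icc hα hT.le hg (θ₀ k) ht).congr (hint k) (hint k t ht)

/-- Uniqueness in terms of Fourier coefficients. -/
theorem coeff_solution_unique (hm : IsVelocitySymbol m C) {s : ℝ} (hs : (d : ℝ) / 2 + 1 < s)
    {S : (Fin d → ℤ) → ℂ} {M T : ℝ} (hM : 0 ≤ M) (hT : 0 ≤ T) {a b : ℝ → (Fin d → ℤ) → ℂ}
    (ha : ∀ t ∈ Icc 0 T, HsBdd s (a t) M) (hb : ∀ t ∈ Icc 0 T, HsBdd s (b t) M)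
    (h0 : ∀ k, a 0 k = b 0 k)
    (hda : ∀ k, ∀ t ∈ Icc 0 T,
      HasDerivWithinAt (fun τ => a τ k) (S k - adv m (a t) (a t) k) (Icc 0 T) t)
    (hdb : ∀ k, ∀ t ∈ Icc 0 T,
      HasDerivWithinAt (fun τ => b τ k) (S k - adv m (b t) (b t) k) (Icc 0 T) t) :
    ∀ t ∈ Icc 0 T, a t = b t := by
  intro t ht
  funext k
  -- A fixed mode lies in every large box, so its difference is bounded by `δ n` for all large `n`.
  obtain ⟨δ, hδ, hclose⟩ := exists_closeness hm hs hM (T - 0) S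
  have h : ‖a t k - b t k‖ ^ 2 ≤ 0 := by
    refine ge_of_tendsto hδ ((eventually_mem_box k).mono fun n hn => ?_)
    exact (Finset.single_le_sum (f := fun k => ‖a t k - b t k‖ ^ 2)
      (fun _ _ => sq_nonneg _) hn).trans (hclose 0 T le_rfl hT le_rfl n a b ha hb (fun k _ => h0 k)
        (fun k _ => hda k) (fun k _ => hdb k) t ht)
  have h2 : ‖a t k - b t k‖ = 0 := by
    have := norm_nonneg (a t k - b t k)
    nlinarith
  exact sub_eq_zero.mp (norm_eq_zero.mp h2)

end Coefficients

end ActiveScalar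

end

noncomputable section

namespace ActiveScalar

open Set Filter Topology

/-! ### Absolutely convergent Fourier series -/

section Trig

variable {d : ℕ}

open UnitAddTorus in
lemma norm_mFourier_apply (k : Fin d → ℤ) (x : Torus d) : ‖mFourier k x‖ = 1 := by
  simp only [mFourier, fourier_apply, ContinuousMap.coe_mk, norm_prod, Circle.norm_coe,
    Finset.prod_const_one]

open UnitAddTorus in
lemma mFourier_toTorus (k : Fin d → ℤ) (y : Fin d → ℝ) :
    mFourier k (toTorus y) = Complex.exp (Complex.I * ∑ i, (k i : ℂ) * (y i : ℂ)) := by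
  simp only [mFourier, ContinuousMap.coe_mk, toTorus]
  rw [Finset.mul_sum, Complex.exp_sum]
  refine Finset.prod_congr rfl fun i _ => ?_
  rw [fourier_coe_apply]
  congr 1
  push_cast
  have : (Real.pi : ℂ) ≠ 0 := by exact_mod_cast Real.pi_ne_zero
  field_simp

open UnitAddTorus in
lemma mFourier_add_apply (k : Fin d → ℤ) (x y : Torus d) :
    mFourier k (x + y) = mFourier k x * mFourier k y := by
  simp [mFourier, fourier_apply, Finset.prod_mul_distrib, AddCircle.toCircle_add, smul_add]

lemma toTorus_add (x y : Fin d → ℝ) : toTorus (x + y) = toTorus x + toTorus y := by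
  funext i
  simp only [toTorus, Pi.add_apply, add_div]
  exact AddCircle.coe_add _ _ _

/-- Allows continuity on the torus to be checked on periodic lifts. -/
lemma isOpenQuotientMap_toTorus : IsOpenQuotientMap (toTorus : (Fin d → ℝ) → Torus d) := by
  have h1 : IsOpenQuotientMap (fun t : ℝ => ((t / (2 * Real.pi) : ℝ) : UnitAddCircle)) :=
    QuotientAddGroup.isOpenQuotientMap_mk.comp
      (Homeomorph.mulRight₀ (2 * Real.pi)⁻¹ (by positivity)).isOpenQuotientMap
  exact IsOpenQuotientMap.piMap fun _ => h1

lemma toTorus_surjective : Function.Surjective (toTorus : (Fin d → ℝ) → Torus d) :=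
  isOpenQuotientMap_toTorus.surjective

lemma continuous_toTorus : Continuous (toTorus : (Fin d → ℝ) → Torus d) :=
  isOpenQuotientMap_toTorus.continuous

lemma integral_mFourier (k : Fin d → ℤ) :
    ∫ x, UnitAddTorus.mFourier k x ∂(torusMeasure d) = if k = 0 then 1 else 0 := by
  have h := (orthonormal_iff_ite.mp (UnitAddTorus.orthonormal_mFourier (d := Fin d))) 0 k
  rw [UnitAddTorus.mFourierLp, UnitAddTorus.mFourierLp, ContinuousMap.inner_toLp] at h
  simp only [UnitAddTorus.mFourier_zero, ContinuousMap.one_apply, map_one, mul_one] at h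
  refine Eq.trans h ?_
  simp [eq_comm]

lemma fourierCoeff_eq (f : Torus d → ℝ) (k : Fin d → ℤ) :
    fourierCoeff f k = ∫ x, UnitAddTorus.mFourier (-k) x * (f x : ℂ) ∂(torusMeasure d) := rfl

/-- The Fourier series with coefficients `c`. -/
def trig (c : (Fin d → ℤ) → ℂ) (x : Torus d) : ℂ := ∑' k, c k * UnitAddTorus.mFourier k x

variable {c c' : (Fin d → ℤ) → ℂ}

lemma norm_mul_mFourier (c : (Fin d → ℤ) → ℂ) (k : Fin d → ℤ) (x : Torus d) :
    ‖c k * UnitAddTorus.mFourier k x‖ = ‖c k‖ := by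
  rw [norm_mul, norm_mFourier_apply, mul_one]

lemma summable_trig (hc : Summable fun k => ‖c k‖) (x : Torus d) :
    Summable fun k => c k * UnitAddTorus.mFourier k x :=
  Summable.of_norm (by simpa only [norm_mul_mFourier] using hc)

lemma continuous_trig (hc : Summable fun k => ‖c k‖) : Continuous (trig c) :=
  continuous_tsum (fun k => continuous_const.mul (UnitAddTorus.mFourier k).continuous) hc
    fun k x => (norm_mul_mFourier c k x).le

lemma integral_mul_trig (hc : Summable fun k => ‖c k‖) {g : Torus d → ℂ} (hg : Continuous g) :
    ∫ x, g x * trig c x ∂(torusMeasure d) =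
      ∑' k, c k * ∫ x, g x * UnitAddTorus.mFourier k x ∂(torusMeasure d) := by
  obtain ⟨B, hB⟩ := isCompact_univ.exists_bound_of_continuousOn hg.continuousOn
  have hcont : ∀ k, Continuous fun x => g x * (c k * UnitAddTorus.mFourier k x) := fun k =>
    hg.mul (continuous_const.mul (UnitAddTorus.mFourier k).continuous)
  have hint : ∀ k, Integrable (fun x => g x * (c k * UnitAddTorus.mFourier k x))
      (torusMeasure d) := fun k =>
    (hcont k).integrable_of_hasCompactSupport (HasCompactSupport.of_compactSpace _)
  have h := integral_tsum_of_summable_integral_norm hint (by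
    refine Summable.of_nonneg_of_le (fun k => integral_nonneg fun x => norm_nonneg _) (fun k => ?_)
      (hc.mul_left B)
    refine (integral_mono_of_nonneg (Eventually.of_forall fun x => norm_nonneg _)
      (integrable_const (B * ‖c k‖)) (Eventually.of_forall fun x => ?_)).trans_eq ?_
    · simp only [norm_mul, norm_mFourier_apply, mul_one]
      exact mul_le_mul_of_nonneg_right (hB x (mem_univ x)) (norm_nonneg _)
    · simp)
  simp only [trig, ← tsum_mul_left]
  rw [← h]
  refine tsum_congr fun k => ?_
  rw [← integral_const_mul]
  exact integral_congr_ae (Eventually.of_forall fun x => by ring)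

lemma integral_mFourier_mul_trig (hc : Summable fun k => ‖c k‖) (k : Fin d → ℤ) :
    ∫ x, UnitAddTorus.mFourier (-k) x * trig c x ∂(torusMeasure d) = c k := by
  rw [integral_mul_trig hc (UnitAddTorus.mFourier (-k)).continuous, tsum_eq_single k]
  · simp only [← UnitAddTorus.mFourier_add, neg_add_cancel, integral_mFourier, if_true, mul_one]
  · intro l hl
    simp only [← UnitAddTorus.mFourier_add, integral_mFourier]
    rw [if_neg (fun h => hl (by rwa [neg_add_eq_zero, eq_comm] at h)), mul_zero]

lemma trig_conj (c : (Fin d → ℤ) → ℂ) (x : Torus d) :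
    (starRingEnd ℂ) (trig c x) = trig (fun k => (starRingEnd ℂ) (c (-k))) x := by
  rw [trig, trig, ← (Equiv.neg (Fin d → ℤ)).tsum_eq fun k =>
    (starRingEnd ℂ) (c (-k)) * UnitAddTorus.mFourier k x, Complex.conj_tsum]
  refine tsum_congr fun k => ?_
  simp [UnitAddTorus.mFourier_neg]

lemma ofReal_re_trig (hc : Summable fun k => ‖c k‖) (x : Torus d) :
    (((trig c x).re : ℝ) : ℂ) = trig (symm c) x := by
  have h1 : Summable fun k => ‖(starRingEnd ℂ) (c (-k))‖ := by
    simp only [RCLike.norm_conj]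
    exact (Equiv.neg (Fin d → ℤ)).summable_iff.mpr hc
  rw [Complex.re_eq_add_conj, trig_conj, trig, trig, trig,
    ← (summable_trig hc x).tsum_add (summable_trig h1 x), ← tsum_div_const]
  refine tsum_congr fun k => ?_
  rw [symm]
  ring

lemma ofReal_re_trig_of_symm (hc : Summable fun k => ‖c k‖)
    (h : ∀ k, c (-k) = (starRingEnd ℂ) (c k)) (x : Torus d) :
    (((trig c x).re : ℝ) : ℂ) = trig c x := by
  rw [ofReal_re_trig hc, symm_of_real h]

lemma summable_symm (hc : Summable fun k => ‖c k‖) : Summable fun k => ‖symm c k‖ :=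
  Summable.of_nonneg_of_le (fun _ => norm_nonneg _) (norm_symm_le c)
    ((hc.mul_left _).add (((Equiv.neg (Fin d → ℤ)).summable_iff.mpr hc).mul_left _))

lemma fourierCoeff_re_trig (hc : Summable fun k => ‖c k‖) (k : Fin d → ℤ) :
    fourierCoeff (fun x => (trig c x).re) k = symm c k := by
  rw [fourierCoeff_eq]
  simp only [ofReal_re_trig hc]
  exact integral_mFourier_mul_trig (summable_symm hc) k

lemma fourierCoeff_neg (f : Torus d → ℝ) (k : Fin d → ℤ) :
    fourierCoeff f (-k) = (starRingEnd ℂ) (fourierCoeff f k) := by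
  rw [fourierCoeff_eq, fourierCoeff_eq, ← integral_conj]
  refine integral_congr_ae (Eventually.of_forall fun x => ?_)
  simp [UnitAddTorus.mFourier_neg]

/-- An `L²` function with absolutely summable Fourier coefficients is the sum of its Fourier
series. -/
lemma ae_eq_trig {f : Torus d → ℝ} (hf : MemLp f 2 (torusMeasure d))
    (hc : Summable fun k => ‖fourierCoeff f k‖) :
    ∀ᵐ x ∂(torusMeasure d), (f x : ℂ) = trig (fourierCoeff f) x := by
  have h1 : MemLp (fun x => (f x : ℂ)) 2 (torusMeasure d) := hf.ofReal
  have h2 : MemLp (trig (fourierCoeff f)) 2 (torusMeasure d) :=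
    (continuous_trig hc).memLp_of_hasCompactSupport (HasCompactSupport.of_compactSpace _)
  have h3 : h1.toLp _ = h2.toLp _ := by
    apply UnitAddTorus.mFourierBasis.repr.injective
    ext k
    rw [UnitAddTorus.mFourierBasis_repr, UnitAddTorus.mFourierBasis_repr]
    have e1 : UnitAddTorus.mFourierCoeff (h1.toLp _) k = fourierCoeff f k :=
      integral_congr_ae (h1.coeFn_toLp.mono fun x hx => by simp only [hx])
    have e2 : UnitAddTorus.mFourierCoeff (h2.toLp _) k = fourierCoeff f k := by
      refine Eq.trans ?_ (integral_mFourier_mul_trig hc k)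
      exact integral_congr_ae (h2.coeFn_toLp.mono fun x hx => by simp only [hx, smul_eq_mul])
    exact e1.trans e2.symm
  exact (MemLp.toLp_eq_toLp_iff h1 h2).mp h3

/-- Coefficients of a product of Fourier series. -/
def convCoeff (c c' : (Fin d → ℤ) → ℂ) (k : Fin d → ℤ) : ℂ := ∑' l, c (k - l) * c' l

/-- `(k, l) ↦ (k - l, l)`. -/
def shearEquiv (d : ℕ) : (Fin d → ℤ) × (Fin d → ℤ) ≃ (Fin d → ℤ) × (Fin d → ℤ) where
  toFun p := (p.1 - p.2, p.2)
  invFun p := (p.1 + p.2, p.2)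
  left_inv p := by simp
  right_inv p := by simp

lemma summable_conv_prod (hc : Summable fun k => ‖c k‖) (hc' : Summable fun k => ‖c' k‖) :
    Summable fun p : (Fin d → ℤ) × (Fin d → ℤ) => ‖c (p.1 - p.2) * c' p.2‖ := by
  have h := (shearEquiv d).summable_iff.mpr (Summable.mul_norm hc hc')
  exact h

lemma summable_convCoeff (hc : Summable fun k => ‖c k‖) (hc' : Summable fun k => ‖c' k‖) :
    Summable fun k => ‖convCoeff c c' k‖ := by
  have h := summable_conv_prod hc hc'
  refine Summable.of_nonneg_of_le (fun _ => norm_nonneg _) (fun k => ?_) h.prod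
  exact norm_tsum_le_tsum_norm (h.prod_factor k)

/-- The absolutely convergent double series is reindexed by the shear, so that its terms are grouped
by total frequency. -/
lemma trig_mul_trig (hc : Summable fun k => ‖c k‖) (hc' : Summable fun k => ‖c' k‖) (x : Torus d) :
    trig c x * trig c' x = trig (convCoeff c c') x := by
  have h1 : Summable fun k => ‖c k * UnitAddTorus.mFourier k x‖ := by
    simpa only [norm_mul_mFourier] using hc
  have h2 : Summable fun k => ‖c' k * UnitAddTorus.mFourier k x‖ := by
    simpa only [norm_mul_mFourier] using hc'
  rw [trig, trig, tsum_mul_tsum_of_summable_norm h1 h2, ← (shearEquiv d).tsum_eq]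
  have h3 : Summable fun p : (Fin d → ℤ) × (Fin d → ℤ) =>
      c (p.1 - p.2) * UnitAddTorus.mFourier (p.1 - p.2) x *
        (c' p.2 * UnitAddTorus.mFourier p.2 x) :=
    (shearEquiv d).summable_iff.mpr (summable_mul_of_summable_norm h1 h2)
  refine (h3.tsum_prod).trans (tsum_congr fun k => ?_)
  rw [convCoeff, ← tsum_mul_right]
  refine tsum_congr fun l => ?_
  have : UnitAddTorus.mFourier k x =
      UnitAddTorus.mFourier (k - l) x * UnitAddTorus.mFourier l x := by
    rw [← UnitAddTorus.mFourier_add, sub_add_cancel]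
  rw [this]
  ring

/-! ### Derivatives -/

/-- The coefficients of the `j`-th partial derivative. -/
def gradCoeff (j : Fin d) (c : (Fin d → ℤ) → ℂ) (k : Fin d → ℤ) : ℂ := Complex.I * (k j : ℂ) * c k

lemma norm_gradCoeff_le (j : Fin d) (c : (Fin d → ℤ) → ℂ) (k : Fin d → ℤ) :
    ‖gradCoeff j c k‖ ≤ jb k * ‖c k‖ := by
  rw [gradCoeff, norm_mul, norm_mul, Complex.norm_I, one_mul, Complex.norm_intCast]
  exact mul_le_mul_of_nonneg_right (abs_coord_le_jb k j) (norm_nonneg _)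

lemma summable_gradCoeff (hc : Summable fun k => jb k * ‖c k‖) (j : Fin d) :
    Summable fun k => ‖gradCoeff j c k‖ :=
  Summable.of_nonneg_of_le (fun _ => norm_nonneg _) (norm_gradCoeff_le j c) hc

lemma summable_of_summable_jb_mul (hc : Summable fun k => jb k * ‖c k‖) :
    Summable fun k => ‖c k‖ :=
  Summable.of_nonneg_of_le (fun _ => norm_nonneg _)
    (fun k => le_mul_of_one_le_left (norm_nonneg _) (one_le_jb k)) hc

lemma mFourier_toTorus_single (k : Fin d → ℤ) (j : Fin d) (h : ℝ) :
    UnitAddTorus.mFourier k (toTorus (Pi.single j h)) = Complex.exp (Complex.I * k j * h) := by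
  rw [mFourier_toTorus, Finset.sum_eq_single j]
  · rw [Pi.single_eq_same, mul_assoc]
  · intro i _ hi
    rw [Pi.single_eq_of_ne hi, Complex.ofReal_zero, mul_zero]
  · simp

lemma hasDerivAt_trig (hc : Summable fun k => jb k * ‖c k‖) (j : Fin d) (x : Torus d) :
    HasDerivAt (fun h : ℝ => trig c (x + toTorus (Pi.single j h))) (trig (gradCoeff j c) x) 0 := by
  have hsum := summable_of_summable_jb_mul hc
  have hterm : ∀ (k : Fin d → ℤ) (h : ℝ), HasDerivAt
      (fun h : ℝ => c k * UnitAddTorus.mFourier k (x + toTorus (Pi.single j h)))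
      (gradCoeff j c k * UnitAddTorus.mFourier k (x + toTorus (Pi.single j h))) h := by
    intro k h
    simp only [mFourier_add_apply, mFourier_toTorus_single, gradCoeff]
    have h1 : HasDerivAt (fun h : ℝ => Complex.I * (k j : ℂ) * (h : ℂ)) (Complex.I * (k j : ℂ)) h := by
      simpa using (Complex.ofRealCLM.hasDerivAt (x := h)).const_mul (Complex.I * (k j : ℂ))
    convert! ((h1.cexp).const_mul (UnitAddTorus.mFourier k x)).const_mul (c k) using 1
    ring
  have h := hasDerivAt_tsum (summable_gradCoeff hc j) hterm
    (fun k h => (norm_mul_mFourier _ k _).le) (y₀ := 0) (summable_trig hsum _) 0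
  have h0 : x + toTorus (Pi.single j (0 : ℝ)) = x := by
    funext i
    simp [toTorus]
  simp only [h0] at h
  exact h

lemma partialDeriv_re_trig (hc : Summable fun k => jb k * ‖c k‖) (j : Fin d) (x : Torus d) :
    partialDeriv j (fun x => (trig c x).re) x = (trig (gradCoeff j c) x).re :=
  (Complex.reCLM.hasFDerivAt.comp_hasDerivAt (0 : ℝ) (hasDerivAt_trig hc j x)).deriv

lemma partialDeriv_toTorus {f : Torus d → ℝ} (j : Fin d) (y : Fin d → ℝ)
    (hf : DifferentiableAt ℝ (fun y => f (toTorus y)) y) :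
    HasDerivAt (fun h : ℝ => f (toTorus y + toTorus (Pi.single j h)))
      (fderiv ℝ (fun y => f (toTorus y)) y (Pi.single j 1)) 0 := by
  have h1 : HasDerivAt (fun h : ℝ => y + Pi.single j h) (Pi.single j (1 : ℝ)) 0 :=
    (hasDerivAt_single j (0 : ℝ)).const_add y
  have h2 : HasFDerivAt (fun y => f (toTorus y)) (fderiv ℝ (fun y => f (toTorus y)) y)
      (y + Pi.single j (0 : ℝ)) := by simpa using hf.hasFDerivAt
  have h3 := h2.comp_hasDerivAt (0 : ℝ) h1
  simpa only [Function.comp_def, toTorus_add] using h3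

lemma IsSmooth.differentiable {φ : Torus d → ℝ} (hφ : IsSmooth φ) :
    Differentiable ℝ fun y => φ (toTorus y) := ContDiff.differentiable hφ (by simp)

lemma IsSmooth.continuous {φ : Torus d → ℝ} (hφ : IsSmooth φ) : Continuous φ :=
  isOpenQuotientMap_toTorus.isQuotientMap.continuous_iff.mpr (ContDiff.continuous hφ)

lemma IsSmooth.continuous_partialDeriv {φ : Torus d → ℝ} (hφ : IsSmooth φ) (j : Fin d) :
    Continuous (partialDeriv j φ) := by
  refine isOpenQuotientMap_toTorus.isQuotientMap.continuous_iff.mpr ?_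
  have h : partialDeriv j φ ∘ toTorus =
      fun y => fderiv ℝ (fun y => φ (toTorus y)) y (Pi.single j 1) :=
    funext fun y => (partialDeriv_toTorus j y (hφ.differentiable y)).deriv
  rw [h]
  exact (ContDiff.continuous_fderiv hφ (by simp)).clm_apply continuous_const

/-- `partialDeriv` only records derivatives at `h = 0`; translating the base point gives them along
the whole line, as needed for differentiation under the integral. -/
lemma IsSmooth.hasDerivAt {φ : Torus d → ℝ} (hφ : IsSmooth φ) (j : Fin d) (x : Torus d) (h : ℝ) :
    HasDerivAt (fun h : ℝ => φ (x + toTorus (Pi.single j h)))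
      (partialDeriv j φ (x + toTorus (Pi.single j h))) h := by
  obtain ⟨y, hy⟩ := toTorus_surjective (x + toTorus (Pi.single j h))
  have h1 := partialDeriv_toTorus j y (hφ.differentiable y)
  have h2 : HasDerivAt (fun h' : ℝ => φ (toTorus y + toTorus (Pi.single j h')))
      (partialDeriv j φ (toTorus y)) (h - h) := by
    rw [sub_self]
    exact h1.differentiableAt.hasDerivAt
  have h3 := h2.comp_sub_const h h
  rw [hy] at h3
  refine h3.congr_of_eventuallyEq (Eventually.of_forall fun h' => ?_)
  simp only
  rw [add_assoc, ← toTorus_add, ← Pi.single_add, add_sub_cancel]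

/-- Integration by parts against an exponential. -/
lemma integral_mFourier_mul_partialDeriv {φ : Torus d → ℝ} (hφ : IsSmooth φ) (j : Fin d)
    (k : Fin d → ℤ) :
    ∫ x, (partialDeriv j φ x : ℂ) * UnitAddTorus.mFourier k x ∂(torusMeasure d) =
      -(Complex.I * (k j : ℂ)) *
        ∫ x, (φ x : ℂ) * UnitAddTorus.mFourier k x ∂(torusMeasure d) := by
  have hc := hφ.continuous_partialDeriv j
  obtain ⟨B, hB⟩ := isCompact_univ.exists_bound_of_continuousOn hc.continuousOn
  have hcadd : ∀ h : ℝ, Continuous fun x : Torus d => x + toTorus (Pi.single j h) := fun h =>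
    continuous_id.add continuous_const
  have hcF : ∀ h : ℝ, Continuous fun x : Torus d =>
      (φ (x + toTorus (Pi.single j h)) : ℂ) * UnitAddTorus.mFourier k x := fun h =>
    (Complex.continuous_ofReal.comp (hφ.continuous.comp (hcadd h))).mul
      (UnitAddTorus.mFourier k).continuous
  have h0 : ∀ x : Torus d, x + toTorus (Pi.single j (0 : ℝ)) = x := fun x => by
    funext i
    simp [toTorus]
  -- The integral of `φ(x + h e_j) e^{ik·x}` is differentiated at `h = 0` in two ways. Here the
  -- derivative falls on `φ`; below, translation invariance moves the shift to the exponential.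
  have hL := (hasDerivAt_integral_of_dominated_loc_of_deriv_le (μ := torusMeasure d)
    (F := fun (h : ℝ) x => (φ (x + toTorus (Pi.single j h)) : ℂ) * UnitAddTorus.mFourier k x)
    (F' := fun (h : ℝ) x =>
      (partialDeriv j φ (x + toTorus (Pi.single j h)) : ℂ) * UnitAddTorus.mFourier k x)
    (x₀ := (0 : ℝ)) (bound := fun _ => B) (s := univ) univ_mem
    (Eventually.of_forall fun h => (hcF h).aestronglyMeasurable)
    ((hcF 0).integrable_of_hasCompactSupport (HasCompactSupport.of_compactSpace _))
    ((Complex.continuous_ofReal.comp (hc.comp (hcadd 0))).mul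
      (UnitAddTorus.mFourier k).continuous).aestronglyMeasurable
    (Eventually.of_forall fun x h _ => by
      rw [norm_mul, norm_mFourier_apply, mul_one, Complex.norm_real]
      exact hB _ (mem_univ _))
    (integrable_const B)
    (Eventually.of_forall fun x h _ => (hφ.hasDerivAt j x h).ofReal_comp.mul_const _)).2
  simp only [h0] at hL
  have hR : ∀ h : ℝ, ∫ x, (φ (x + toTorus (Pi.single j h)) : ℂ) * UnitAddTorus.mFourier k x
      ∂(torusMeasure d) = Complex.exp (-(Complex.I * (k j : ℂ)) * h) *
        ∫ x, (φ x : ℂ) * UnitAddTorus.mFourier k x ∂(torusMeasure d) := by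
    intro h
    rw [← integral_const_mul, ← integral_add_right_eq_self (μ := torusMeasure d)
      (fun x => Complex.exp (-(Complex.I * (k j : ℂ)) * h) *
        ((φ x : ℂ) * UnitAddTorus.mFourier k x)) (toTorus (Pi.single j h))]
    refine integral_congr_ae (Eventually.of_forall fun x => ?_)
    simp only [mFourier_add_apply, mFourier_toTorus_single]
    have : Complex.exp (-(Complex.I * (k j : ℂ)) * h) * Complex.exp (Complex.I * k j * h) = 1 := by
      rw [← Complex.exp_add]
      simp
    linear_combination (-(φ (x + toTorus (Pi.single j h)) : ℂ) * UnitAddTorus.mFourier k x) * this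
  have hR' : HasDerivAt (fun h : ℝ => ∫ x, (φ (x + toTorus (Pi.single j h)) : ℂ) *
      UnitAddTorus.mFourier k x ∂(torusMeasure d)) (-(Complex.I * (k j : ℂ)) *
        ∫ x, (φ x : ℂ) * UnitAddTorus.mFourier k x ∂(torusMeasure d)) 0 := by
    simp only [hR]
    have h1 : HasDerivAt (fun h : ℝ => -(Complex.I * (k j : ℂ)) * (h : ℂ))
        (-(Complex.I * (k j : ℂ))) 0 := by
      simpa using (Complex.ofRealCLM.hasDerivAt (x := (0 : ℝ))).const_mul (-(Complex.I * (k j : ℂ)))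
    have h2 := (h1.cexp).mul_const
      (∫ x, (φ x : ℂ) * UnitAddTorus.mFourier k x ∂(torusMeasure d))
    simpa using h2
  exact hL.unique hR'

end Trig

end ActiveScalar

end

noncomputable section

namespace ActiveScalar

open Set Filter Topology

/-! ### Translation between functions on the torus and coefficient sequences. -/

section Bridge

variable {d : ℕ}

/-- The symbol of the operator `θ ↦ u_j`. -/
def driftSymbol (𝓣 : MultiplierMatrix d) (j : Fin d) (k : Fin d → ℤ) : ℂ :=
  ∑ i, derivSymbol 𝓣 i j k

lemma isVelocitySymbol_driftSymbol {𝓣 : MultiplierMatrix d} (hreal : IsReal 𝓣)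
    (hdiv : IsDivergenceFree 𝓣) {C₀ : ℝ} (hC₀ : 0 ≤ C₀)
    (hb : ∀ i j k, ‖derivSymbol 𝓣 i j k‖ ≤ C₀) :
    IsVelocitySymbol (driftSymbol 𝓣) (d * C₀) where
  nonneg := by positivity
  norm_le j k := (norm_sum_le _ _).trans ((Finset.sum_le_card_nsmul _ _ C₀ fun i _ =>
    hb i j k).trans (by simp))
  map_neg j k := by
    rw [driftSymbol, driftSymbol, map_sum]
    refine Finset.sum_congr rfl fun i _ => ?_
    simp [derivSymbol, hreal i j k]
  sum_mul_eq_zero k := by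
    have h := hdiv k
    rw [Finset.sum_comm] at h
    have h2 : Complex.I * ∑ j, driftSymbol 𝓣 j k * (k j : ℂ) = 0 := by
      rw [← h, Finset.mul_sum]
      refine Finset.sum_congr rfl fun j _ => ?_
      rw [driftSymbol, Finset.sum_mul, Finset.mul_sum]
      refine Finset.sum_congr rfl fun i _ => ?_
      rw [derivSymbol]
      ring
    exact (mul_eq_zero.mp h2).resolve_left Complex.I_ne_zero

lemma sobolevTerm_eq (s : ℝ) (f : Torus d → ℝ) (k : Fin d → ℤ) :
    sobolevTerm s f k = (jb k ^ s * ‖fourierCoeff f k‖) ^ 2 := by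
  rw [sobolevTerm, mul_pow, ← jb_sq, Real.rpow_pow_comm (jb_nonneg k)]

lemma MemHs.hsBdd {s M : ℝ} {f : Torus d → ℝ} (hf : MemHs s f) (hM : hsNorm s f ≤ M) :
    HsBdd s (fourierCoeff f) M := by
  have h0 : ∀ k, 0 ≤ sobolevTerm s f k := fun k => by rw [sobolevTerm_eq]; positivity
  intro F
  simp only [← sobolevTerm_eq]
  refine (hf.2.sum_le_tsum F fun k _ => h0 k).trans ?_
  rw [← Real.sq_sqrt (tsum_nonneg h0)]
  exact pow_le_pow_left₀ (Real.sqrt_nonneg _) hM 2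

lemma HsBdd.memHs {s M : ℝ} {f : Torus d → ℝ} (hf : MemLp f 2 (torusMeasure d)) (hM : 0 ≤ M)
    (h : HsBdd s (fourierCoeff f) M) : MemHs s f ∧ hsNorm s f ≤ M := by
  have h1 : Summable (sobolevTerm s f) := by
    have := SqSumLe.summable h
    simpa only [← sobolevTerm_eq] using this
  refine ⟨⟨hf, h1⟩, Real.sqrt_le_iff.mpr ⟨hM, ?_⟩⟩
  refine Real.tsum_le_of_sum_le (fun k => by rw [sobolevTerm_eq]; positivity) fun F => ?_
  simp only [sobolevTerm_eq]
  exact h F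

lemma HsBdd.summable_jb_mul {s M : ℝ} (hs : (d : ℝ) / 2 + 1 < s) (hM : 0 ≤ M)
    {c : (Fin d → ℤ) → ℂ} (h : HsBdd s c M) : Summable fun k => jb k * ‖c k‖ := by
  obtain ⟨K, -, hK⟩ := exists_wiener_bound hs
  exact (hK c M hM h).1.summable fun k => mul_nonneg (jb_nonneg k) (norm_nonneg _)

lemma HsBdd.summable_norm {s M : ℝ} (hs : (d : ℝ) / 2 < s) (hM : 0 ≤ M)
    {c : (Fin d → ℤ) → ℂ} (h : HsBdd s c M) : Summable fun k => ‖c k‖ := by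
  obtain ⟨K, -, hK⟩ := exists_sumLe_of_hsBdd (d := d) (σ := s) (τ := 0) (by linarith)
  have h1 := hK (fun k => ‖c k‖) M hM h
  simp only [Real.rpow_zero, one_mul] at h1
  exact h1.summable fun k => norm_nonneg _

/-! ### The transport term in physical variables -/

variable {m : Fin d → (Fin d → ℤ) → ℂ} {C : ℝ} {b : (Fin d → ℤ) → ℂ}

lemma trig_finsetSum {ι : Type*} (F : Finset ι) {c : ι → (Fin d → ℤ) → ℂ}
    (hc : ∀ j ∈ F, Summable fun k => ‖c j k‖) (x : Torus d) :
    ∑ j ∈ F, trig (c j) x = trig (fun k => ∑ j ∈ F, c j k) x := by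
  simp only [trig, Finset.sum_mul]
  exact (Summable.tsum_finsetSum fun j hj => summable_trig (hc j hj) x).symm

lemma IsVelocitySymbol.summable_mul (hm : IsVelocitySymbol m C) (hb : Summable fun k => ‖b k‖)
    (j : Fin d) : Summable fun k => ‖m j k * b k‖ :=
  Summable.of_nonneg_of_le (fun _ => norm_nonneg _) (fun k => by
    rw [norm_mul]
    exact mul_le_mul_of_nonneg_right (hm.norm_le j k) (norm_nonneg _)) (hb.mul_left C)

lemma adv_eq_sum_convCoeff (hm : IsVelocitySymbol m C) (hb : Summable fun k => jb k * ‖b k‖)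
    (hreal : ∀ k, b (-k) = (starRingEnd ℂ) (b k)) (k : Fin d → ℤ) :
    adv m b b k = ∑ j, convCoeff (fun k => m j k * b k) (gradCoeff j b) k := by
  have hb1 := summable_of_summable_jb_mul hb
  simp only [convCoeff]
  rw [← Summable.tsum_finsetSum fun j _ => ((summable_conv_prod (hm.summable_mul hb1 j)
    (summable_gradCoeff hb j)).prod_factor k).of_norm]
  refine tsum_congr fun l => ?_
  rw [advKernel, Finset.sum_mul]
  refine Finset.sum_congr rfl fun j _ => ?_
  rw [symm_of_real hreal, gradCoeff]
  ring

/-- The conservative form, in which no derivative falls on `b`. It matches the flux in the weak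
formulation, whereas `adv_eq_sum_convCoeff` matches the pointwise equation. -/
lemma adv_eq_sum_mul_convCoeff (hm : IsVelocitySymbol m C) (hb : Summable fun k => jb k * ‖b k‖)
    (hreal : ∀ k, b (-k) = (starRingEnd ℂ) (b k)) (k : Fin d → ℤ) :
    adv m b b k = ∑ j, Complex.I * (k j : ℂ) * convCoeff (fun k => m j k * b k) b k := by
  have hb1 := summable_of_summable_jb_mul hb
  simp only [convCoeff, ← tsum_mul_left]
  rw [← Summable.tsum_finsetSum fun j _ => (((summable_conv_prod (hm.summable_mul hb1 j)
    hb1).prod_factor k).of_norm).mul_left _]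
  refine tsum_congr fun l => ?_
  rw [advKernel_eq_left hm, Finset.sum_mul]
  refine Finset.sum_congr rfl fun j _ => ?_
  rw [symm_of_real hreal]
  ring

lemma summable_adv (hm : IsVelocitySymbol m C) (hb : Summable fun k => jb k * ‖b k‖)
    (hreal : ∀ k, b (-k) = (starRingEnd ℂ) (b k)) : Summable fun k => ‖adv m b b k‖ := by
  have hb1 := summable_of_summable_jb_mul hb
  refine Summable.of_nonneg_of_le (fun _ => norm_nonneg _) (fun k => ?_)
    (summable_sum (s := Finset.univ) fun j _ =>
      summable_convCoeff (hm.summable_mul hb1 j) (summable_gradCoeff hb j))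
  rw [adv_eq_sum_convCoeff hm hb hreal]
  exact norm_sum_le _ _

lemma sum_trig_mul_trig_gradCoeff (hm : IsVelocitySymbol m C)
    (hb : Summable fun k => jb k * ‖b k‖) (hreal : ∀ k, b (-k) = (starRingEnd ℂ) (b k))
    (x : Torus d) :
    ∑ j, trig (fun k => m j k * b k) x * trig (gradCoeff j b) x = trig (adv m b b) x := by
  have hb1 := summable_of_summable_jb_mul hb
  simp only [fun j => trig_mul_trig (hm.summable_mul hb1 j) (summable_gradCoeff hb j) x]
  rw [trig_finsetSum _ fun j _ =>
    summable_convCoeff (hm.summable_mul hb1 j) (summable_gradCoeff hb j)]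
  congr 1
  exact funext fun k => (adv_eq_sum_convCoeff hm hb hreal k).symm

lemma IsVelocitySymbol.mul_neg (hm : IsVelocitySymbol m C)
    (hreal : ∀ k, b (-k) = (starRingEnd ℂ) (b k)) (j : Fin d) (k : Fin d → ℤ) :
    m j (-k) * b (-k) = (starRingEnd ℂ) (m j k * b k) := by
  rw [hm.map_neg, hreal, map_mul]

lemma gradCoeff_neg (hreal : ∀ k, b (-k) = (starRingEnd ℂ) (b k)) (j : Fin d) (k : Fin d → ℤ) :
    gradCoeff j b (-k) = (starRingEnd ℂ) (gradCoeff j b k) := by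
  simp [gradCoeff, hreal]

/-- The transport term `u·∇f` of the function with Fourier coefficients `b`. -/
def transport (m : Fin d → (Fin d → ℤ) → ℂ) (b : (Fin d → ℤ) → ℂ) (x : Torus d) : ℝ :=
  ∑ j, (trig (fun k => m j k * b k) x).re * (trig (gradCoeff j b) x).re

/-- Hermitian symmetry makes all the series real, so taking real parts factor by factor changes
nothing. -/
lemma ofReal_transport (hm : IsVelocitySymbol m C)
    (hb : Summable fun k => jb k * ‖b k‖) (hreal : ∀ k, b (-k) = (starRingEnd ℂ) (b k))
    (x : Torus d) : (transport m b x : ℂ) = trig (adv m b b) x := by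
  have hb1 := summable_of_summable_jb_mul hb
  rw [transport, ← sum_trig_mul_trig_gradCoeff hm hb hreal, Complex.ofReal_sum]
  refine Finset.sum_congr rfl fun j _ => ?_
  rw [Complex.ofReal_mul, ofReal_re_trig_of_symm (hm.summable_mul hb1 j) (hm.mul_neg hreal j),
    ofReal_re_trig_of_symm (summable_gradCoeff hb j) (gradCoeff_neg hreal j)]

lemma continuous_transport (hm : IsVelocitySymbol m C) (hb : Summable fun k => jb k * ‖b k‖) :
    Continuous (transport m b) :=
  continuous_finsetSum _ fun j _ =>
    (Complex.continuous_re.comp (continuous_trig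
      (hm.summable_mul (summable_of_summable_jb_mul hb) j))).mul
    (Complex.continuous_re.comp (continuous_trig (summable_gradCoeff hb j)))

lemma fourierCoeff_transport (hm : IsVelocitySymbol m C)
    (hb : Summable fun k => jb k * ‖b k‖) (hreal : ∀ k, b (-k) = (starRingEnd ℂ) (b k))
    (k : Fin d → ℤ) : fourierCoeff (transport m b) k = adv m b b k := by
  rw [fourierCoeff_eq]
  simp only [ofReal_transport hm hb hreal]
  exact integral_mFourier_mul_trig (summable_adv hm hb hreal) k

/-- Integration by parts in the transport term. -/
lemma integral_flux_eq (hm : IsVelocitySymbol m C)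
    (hb : Summable fun k => jb k * ‖b k‖) (hreal : ∀ k, b (-k) = (starRingEnd ℂ) (b k))
    {φ : Torus d → ℝ} (hφ : IsSmooth φ) :
    ∫ x, ∑ j, (trig b x).re * (trig (fun k => m j k * b k) x).re * partialDeriv j φ x
      ∂(torusMeasure d) = -∫ x, transport m b x * φ x ∂(torusMeasure d) := by
  have hb1 := summable_of_summable_jb_mul hb
  have hcφ : Continuous fun x => (φ x : ℂ) := Complex.continuous_ofReal.comp hφ.continuous
  have hcd : ∀ j, Continuous fun x => (partialDeriv j φ x : ℂ) := fun j =>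
    Complex.continuous_ofReal.comp (hφ.continuous_partialDeriv j)
  have hconv : ∀ j, Summable fun k => ‖convCoeff (fun k => m j k * b k) b k‖ := fun j =>
    summable_convCoeff (hm.summable_mul hb1 j) hb1
  have hterm : ∀ j x, (((trig b x).re * (trig (fun k => m j k * b k) x).re *
      partialDeriv j φ x : ℝ) : ℂ) =
      (partialDeriv j φ x : ℂ) * trig (convCoeff (fun k => m j k * b k) b) x := by
    intro j x
    rw [Complex.ofReal_mul, Complex.ofReal_mul, ofReal_re_trig_of_symm hb1 hreal,
      ofReal_re_trig_of_symm (hm.summable_mul hb1 j) (hm.mul_neg hreal j),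
      ← trig_mul_trig (hm.summable_mul hb1 j) hb1]
    ring
  have hstep : ∀ j k, convCoeff (fun k => m j k * b k) b k *
      ∫ x, (partialDeriv j φ x : ℂ) * UnitAddTorus.mFourier k x ∂(torusMeasure d) =
      -(Complex.I * (k j : ℂ) * convCoeff (fun k => m j k * b k) b k *
        ∫ x, (φ x : ℂ) * UnitAddTorus.mFourier k x ∂(torusMeasure d)) := by
    intro j k
    rw [integral_mFourier_mul_partialDeriv hφ]
    ring
  have hsum : ∀ j, Summable fun k => convCoeff (fun k => m j k * b k) b k *
      ∫ x, (partialDeriv j φ x : ℂ) * UnitAddTorus.mFourier k x ∂(torusMeasure d) := by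
    intro j
    obtain ⟨B, hB⟩ := isCompact_univ.exists_bound_of_continuousOn (hcd j).continuousOn
    refine Summable.of_norm_bounded ((hconv j).mul_right B) fun k => ?_
    rw [norm_mul]
    refine mul_le_mul_of_nonneg_left ?_ (norm_nonneg _)
    refine (norm_integral_le_of_norm_le_const (C := B) (Eventually.of_forall fun x => ?_)).trans
      (by simp)
    rw [norm_mul, norm_mFourier_apply, mul_one]
    exact hB x (mem_univ x)
  have hintj : ∀ j, Integrable (fun x =>
      (partialDeriv j φ x : ℂ) * trig (convCoeff (fun k => m j k * b k) b) x) (torusMeasure d) :=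
    fun j => ((hcd j).mul (continuous_trig (hconv j))).integrable_of_hasCompactSupport
      (HasCompactSupport.of_compactSpace _)
  apply Complex.ofReal_injective
  rw [Complex.ofReal_neg, ← integral_complex_ofReal, ← integral_complex_ofReal]
  simp only [Complex.ofReal_sum, hterm]
  rw [integral_finsetSum _ fun j _ => hintj j]
  simp only [integral_mul_trig (hconv _) (hcd _)]
  rw [← Summable.tsum_finsetSum fun j _ => hsum j]
  have hR : ∫ x, ((transport m b x * φ x : ℝ) : ℂ) ∂(torusMeasure d) =
      ∑' k, adv m b b k * ∫ x, (φ x : ℂ) * UnitAddTorus.mFourier k x ∂(torusMeasure d) := by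
    rw [← integral_mul_trig (summable_adv hm hb hreal) hcφ]
    refine integral_congr_ae (Eventually.of_forall fun x => ?_)
    simp only
    rw [Complex.ofReal_mul, ofReal_transport hm hb hreal, mul_comm]
  rw [hR, ← tsum_neg]
  refine tsum_congr fun k => ?_
  -- Mode by mode, integration by parts gives the factor `-i k_j`; summing over `j` reassembles the
  -- conservative form of `adv`.
  rw [adv_eq_sum_mul_convCoeff hm hb hreal, Finset.sum_mul, ← Finset.sum_neg_distrib]
  exact Finset.sum_congr rfl fun j _ => hstep j k

/-! ### Regularity of Fourier series with time-dependent coefficients -/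

/-- The pointwise decay `M * jb k ^ (-σ)` need not be summable when `σ` is just above `d/2`, so the
Weierstrass test does not apply directly. Cauchy–Schwarz on the tail bounds it by `M` times the
square root of the tail of `∑ jb k ^ (-2σ)`, which does not depend on `x`. -/
lemma tendstoUniformlyOn_of_sqSumLe {X E : Type*} [NormedAddCommGroup E] [CompleteSpace E]
    {f : (Fin d → ℤ) → X → E} {g : X → (Fin d → ℤ) → ℝ} {I : Set X} {σ M : ℝ}
    (hσ : (d : ℝ) / 2 < σ) (hM : 0 ≤ M) (hg : ∀ x ∈ I, SqSumLe (fun k => jb k ^ σ * g x k) M)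
    (hfg : ∀ x ∈ I, ∀ k, ‖f k x‖ ≤ g x k) :
    TendstoUniformlyOn (fun (F : Finset (Fin d → ℤ)) x => ∑ k ∈ F, f k x)
      (fun x => ∑' k, f k x) atTop I := by
  classical
  have hρ := summable_jb_rpow (d := d) (r := 2 * σ) (by linarith)
  have hρ0 : ∀ k : Fin d → ℤ, 0 ≤ jb k ^ (-(2 * σ)) := fun k => jb_rpow_nonneg _ _
  obtain ⟨K, hK, hK'⟩ := exists_sumLe_of_hsBdd (d := d) (σ := σ) (τ := 0) (by linarith)
  have hsum : ∀ x ∈ I, Summable fun k => f k x := by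
    intro x hx
    have h1 := hK' (g x) M hM (hg x hx)
    simp only [Real.rpow_zero, one_mul] at h1
    exact Summable.of_norm_bounded (h1.summable fun k => (norm_nonneg _).trans (hfg x hx k))
      (hfg x hx)
  set tail : Finset (Fin d → ℤ) → ℝ := fun F =>
    ∑' k : Fin d → ℤ, jb k ^ (-(2 * σ)) - ∑ k ∈ F, jb k ^ (-(2 * σ)) with htail
  have htail0 : Tendsto (fun F => M * Real.sqrt (tail F)) atTop (𝓝 0) := by
    have h1 : Tendsto tail atTop (𝓝 0) := by
      have := hρ.hasSum.const_sub (∑' k : Fin d → ℤ, jb k ^ (-(2 * σ)))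
      rwa [sub_self] at this
    have h2 := ((Real.continuous_sqrt.tendsto 0).comp h1).const_mul M
    simpa using h2
  have hbound : ∀ x ∈ I, ∀ F : Finset (Fin d → ℤ),
      ‖∑' k, f k x - ∑ k ∈ F, f k x‖ ≤ M * Real.sqrt (tail F) := by
    intro x hx F
    refine le_of_tendsto (((hsum x hx).hasSum.sub_const (∑ k ∈ F, f k x)).norm) ?_
    filter_upwards [eventually_ge_atTop F] with G hG
    rw [← Finset.sum_sdiff hG, add_sub_cancel_right]
    have h1 : ∑ k ∈ G \ F, jb k ^ (-(2 * σ)) ≤ tail F := by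
      have h2 := hρ.sum_le_tsum G fun k _ => hρ0 k
      rw [← Finset.sum_sdiff hG] at h2
      simp only [htail]
      linarith
    refine ((norm_sum_le _ _).trans (Finset.sum_le_sum fun k _ => hfg x hx k)).trans ?_
    refine le_of_sq_le_sq ?_ (by positivity)
    rw [mul_pow, Real.sq_sqrt ((Finset.sum_nonneg fun k _ => hρ0 k).trans h1)]
    calc (∑ k ∈ G \ F, g x k) ^ 2
        = (∑ k ∈ G \ F, jb k ^ σ * g x k * jb k ^ (-σ)) ^ 2 := by
          congr 1
          refine Finset.sum_congr rfl fun k _ => ?_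
          rw [mul_comm, ← mul_assoc, ← Real.rpow_add (jb_pos k)]
          simp
      _ ≤ (∑ k ∈ G \ F, (jb k ^ σ * g x k) ^ 2) * ∑ k ∈ G \ F, (jb k ^ (-σ)) ^ 2 :=
          Finset.sum_mul_sq_le_sq_mul_sq _ _ _
      _ ≤ M ^ 2 * tail F := by
          have h3 : ∑ k ∈ G \ F, (jb k ^ (-σ)) ^ 2 = ∑ k ∈ G \ F, jb k ^ (-(2 * σ)) := by
            refine Finset.sum_congr rfl fun k _ => ?_
            rw [← Real.rpow_natCast, ← Real.rpow_mul (jb_nonneg k)]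
            congr 1
            push_cast
            ring
          rw [h3]
          exact mul_le_mul (hg x hx _) h1 (Finset.sum_nonneg fun k _ => hρ0 k) (sq_nonneg M)
  refine Metric.tendstoUniformlyOn_iff.mpr fun ε hε => ?_
  filter_upwards [htail0.eventually_lt_const hε] with F hF x hx
  rw [dist_eq_norm]
  exact (hbound x hx F).trans_lt hF

/-- The linear form `v ↦ i k·v`. -/
def waveForm (k : Fin d → ℤ) : (Fin d → ℝ) →L[ℝ] ℂ :=
  ∑ i, (Complex.I * (k i : ℂ)) • Complex.ofRealCLM.comp (ContinuousLinearMap.proj i)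

lemma waveForm_apply (k : Fin d → ℤ) (v : Fin d → ℝ) :
    waveForm k v = Complex.I * ∑ i, (k i : ℂ) * (v i : ℂ) := by
  simp [waveForm, Finset.mul_sum, mul_assoc]

lemma norm_waveForm_le (k : Fin d → ℤ) : ‖waveForm k‖ ≤ d * jb k := by
  refine ContinuousLinearMap.opNorm_le_bound _ (mul_nonneg (Nat.cast_nonneg d) (jb_nonneg k))
    fun v => ?_
  rw [waveForm_apply, norm_mul, Complex.norm_I, one_mul]
  refine (norm_sum_le _ _).trans ((Finset.sum_le_card_nsmul _ _ (jb k * ‖v‖) fun i _ => ?_).trans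
    (le_of_eq ?_))
  · rw [norm_mul, Complex.norm_intCast, Complex.norm_real]
    exact mul_le_mul (abs_coord_le_jb k i) (norm_le_pi_norm v i) (norm_nonneg _) (jb_nonneg k)
  · simp [mul_assoc]

lemma hasFDerivAt_mFourier_toTorus (k : Fin d → ℤ) (y : Fin d → ℝ) :
    HasFDerivAt (fun y => UnitAddTorus.mFourier k (toTorus y))
      (UnitAddTorus.mFourier k (toTorus y) • waveForm k) y := by
  have h : ∀ y : Fin d → ℝ, UnitAddTorus.mFourier k (toTorus y) = Complex.exp (waveForm k y) :=
    fun y => by rw [mFourier_toTorus, waveForm_apply]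
  simp only [h]
  exact (waveForm k).hasFDerivAt.cexp

/-- The derivative of `(t, y) ↦ a_k(t) e^{i k·y}`. -/
def modeDeriv (a a' : ℝ → (Fin d → ℤ) → ℂ) (k : Fin d → ℤ) (p : ℝ × (Fin d → ℝ)) :
    ℝ × (Fin d → ℝ) →L[ℝ] ℂ :=
  (a p.1 k * UnitAddTorus.mFourier k (toTorus p.2)) •
      (waveForm k).comp (ContinuousLinearMap.snd ℝ ℝ (Fin d → ℝ)) +
    UnitAddTorus.mFourier k (toTorus p.2) •
      (ContinuousLinearMap.fst ℝ ℝ (Fin d → ℝ)).smulRight (a' p.1 k)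

variable {a a' : ℝ → (Fin d → ℤ) → ℂ}

lemma hasFDerivAt_mode {k : Fin d → ℤ} {p : ℝ × (Fin d → ℝ)}
    (h : HasDerivAt (fun t => a t k) (a' p.1 k) p.1) :
    HasFDerivAt (fun p : ℝ × (Fin d → ℝ) => a p.1 k * UnitAddTorus.mFourier k (toTorus p.2))
      (modeDeriv a a' k p) p := by
  have h1 := h.hasFDerivAt.comp p (hasFDerivAt_fst (𝕜 := ℝ) (E := ℝ) (F := Fin d → ℝ) (p := p))
  have h2 := (hasFDerivAt_mFourier_toTorus k p.2).comp p
    (hasFDerivAt_snd (𝕜 := ℝ) (E := ℝ) (F := Fin d → ℝ) (p := p))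
  refine (h1.mul h2).congr_fderiv ?_
  ext v
  · simp [modeDeriv]
  · simp [modeDeriv, mul_assoc]

lemma norm_modeDeriv_le (k : Fin d → ℤ) (p : ℝ × (Fin d → ℝ)) :
    ‖modeDeriv a a' k p‖ ≤ d * (jb k * ‖a p.1 k‖) + ‖a' p.1 k‖ := by
  refine (norm_add_le _ _).trans (add_le_add ?_ ?_)
  · rw [norm_smul, norm_mul, norm_mFourier_apply, mul_one]
    have h1 : ‖(waveForm k).comp (ContinuousLinearMap.snd ℝ ℝ (Fin d → ℝ))‖ ≤ d * jb k :=
      (ContinuousLinearMap.opNorm_comp_le _ _).trans ((mul_le_of_le_one_right (norm_nonneg _)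
        (ContinuousLinearMap.norm_snd_le _ _ _)).trans (norm_waveForm_le k))
    calc _ ≤ ‖a p.1 k‖ * (d * jb k) := mul_le_mul_of_nonneg_left h1 (norm_nonneg _)
      _ = _ := by ring
  · rw [norm_smul, norm_mFourier_apply, one_mul, ContinuousLinearMap.norm_smulRight_apply]
    exact mul_le_of_le_one_left (norm_nonneg _) (ContinuousLinearMap.norm_fst_le _ _ _)

section Regularity

variable {s M M' : ℝ} {I : Set ℝ}

/-- The spatial part of the derivative costs one power of `jb`, and the time part is in `H^(s-1)` by
assumption; `s - 1 > d/2` is enough for uniform convergence. -/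
lemma tendstoUniformlyOn_modeDeriv (hs : (d : ℝ) / 2 + 1 < s) (hM : 0 ≤ M) (hM' : 0 ≤ M')
    (ha : ∀ t ∈ I, HsBdd s (a t) M) (ha' : ∀ t ∈ I, HsBdd (s - 1) (a' t) M') :
    TendstoUniformlyOn (fun (F : Finset (Fin d → ℤ)) p => ∑ k ∈ F, modeDeriv a a' k p)
      (fun p => ∑' k, modeDeriv a a' k p) atTop (I ×ˢ univ) := by
  refine tendstoUniformlyOn_of_sqSumLe (σ := s - 1) (M := d * M + M')
    (g := fun p k => d * (jb k * ‖a p.1 k‖) + ‖a' p.1 k‖) (by linarith) (by positivity)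
    (fun p hp => ?_) (fun p _ k => norm_modeDeriv_le k p)
  refine ((SqSumLe.const_mul (ha p.1 hp.1) (d : ℝ)).add (ha' p.1 hp.1) (by positivity)
    hM').mono fun k => ?_
  have := jb_nonneg k
  have := jb_rpow_nonneg (s - 1) k
  rw [abs_of_nonneg (by positivity), ← jb_mul_rpow s k]
  exact le_of_eq (by ring)

lemma hasFDerivAt_trig (hs : (d : ℝ) / 2 + 1 < s) (hI : IsOpen I) (hM : 0 ≤ M) (hM' : 0 ≤ M')
    (ha : ∀ t ∈ I, HsBdd s (a t) M) (ha' : ∀ t ∈ I, HsBdd (s - 1) (a' t) M')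
    (hd : ∀ k, ∀ t ∈ I, HasDerivAt (fun t => a t k) (a' t k) t) {p : ℝ × (Fin d → ℝ)}
    (hp : p.1 ∈ I) :
    HasFDerivAt (fun p : ℝ × (Fin d → ℝ) => trig (a p.1) (toTorus p.2))
      (∑' k, modeDeriv a a' k p) p :=
  hasFDerivAt_of_tendstoUniformlyOn (hI.prod isOpen_univ)
    (tendstoUniformlyOn_modeDeriv hs hM hM' ha ha')
    (fun F _ hp => HasFDerivAt.fun_sum fun k _ => hasFDerivAt_mode (hd k _ hp.1))
    (fun p hp => (summable_trig ((ha p.1 hp.1).summable_norm (by linarith) hM) _).hasSum)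
    ⟨hp, mem_univ _⟩

lemma contDiffOn_trig (hs : (d : ℝ) / 2 + 1 < s) (hI : IsOpen I) (hM : 0 ≤ M) (hM' : 0 ≤ M')
    (ha : ∀ t ∈ I, HsBdd s (a t) M) (ha' : ∀ t ∈ I, HsBdd (s - 1) (a' t) M')
    (hd : ∀ k, ∀ t ∈ I, HasDerivAt (fun t => a t k) (a' t k) t)
    (hc : ∀ k, ContinuousOn (fun t => a' t k) I) :
    ContDiffOn ℝ 1 (fun p : ℝ × (Fin d → ℝ) => trig (a p.1) (toTorus p.2)) (I ×ˢ univ) := by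
  have hF := fun p (hp : p ∈ I ×ˢ (univ : Set (Fin d → ℝ))) =>
    hasFDerivAt_trig hs hI hM hM' ha ha' hd hp.1
  have hcont : ContinuousOn (fun p => ∑' k, modeDeriv a a' k p)
      (I ×ˢ (univ : Set (Fin d → ℝ))) := by
    refine (tendstoUniformlyOn_modeDeriv hs hM hM' ha ha').continuousOn
      (Eventually.of_forall fun F => continuousOn_finsetSum _ fun k _ => ?_).frequently
    have h1 : ContinuousOn (fun p : ℝ × (Fin d → ℝ) => a p.1 k) (I ×ˢ univ) :=
      ContinuousOn.comp (g := fun t => a t k) (t := I)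
        (fun t ht => (hd k t ht).continuousAt.continuousWithinAt) continuousOn_fst
        fun p hp => hp.1
    have h2 : ContinuousOn (fun p : ℝ × (Fin d → ℝ) => a' p.1 k) (I ×ˢ univ) :=
      (hc k).comp continuousOn_fst fun p hp => hp.1
    have h3 : Continuous fun p : ℝ × (Fin d → ℝ) => UnitAddTorus.mFourier k (toTorus p.2) :=
      (UnitAddTorus.mFourier k).continuous.comp (continuous_toTorus.comp continuous_snd)
    refine ((h1.mul h3.continuousOn).smul continuousOn_const).add (h3.continuousOn.smul ?_)
    exact (ContinuousLinearMap.smulRightL ℝ (ℝ × (Fin d → ℝ)) ℂ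
      (ContinuousLinearMap.fst ℝ ℝ (Fin d → ℝ))).continuous.comp_continuousOn h2
  rw [show (1 : WithTop ℕ∞) = 0 + 1 from rfl,
    contDiffOn_succ_iff_fderiv_of_isOpen (hI.prod isOpen_univ)]
  refine ⟨fun p hp => (hF p hp).differentiableAt.differentiableWithinAt, by simp, ?_⟩
  rw [contDiffOn_zero]
  exact hcont.congr fun p hp => (hF p hp).fderiv

lemma hasDerivAt_trig_time (hs : (d : ℝ) / 2 + 1 < s) (hI : IsOpen I) (hM : 0 ≤ M) (hM' : 0 ≤ M')
    (ha : ∀ t ∈ I, HsBdd s (a t) M) (ha' : ∀ t ∈ I, HsBdd (s - 1) (a' t) M')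
    (hd : ∀ k, ∀ t ∈ I, HasDerivAt (fun t => a t k) (a' t k) t) {t : ℝ} (ht : t ∈ I)
    (x : Torus d) : HasDerivAt (fun t => trig (a t) x) (trig (a' t) x) t := by
  refine hasDerivAt_of_tendstoUniformlyOn (l := atTop) hI
    (f := fun (F : Finset (Fin d → ℤ)) t => ∑ k ∈ F, a t k * UnitAddTorus.mFourier k x)
    (f' := fun F t => ∑ k ∈ F, a' t k * UnitAddTorus.mFourier k x)
    (g' := fun t => trig (a' t) x) ?_ (Eventually.of_forall fun F t ht => ?_) (fun t ht => ?_) ht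
  · exact tendstoUniformlyOn_of_sqSumLe (σ := s - 1) (g := fun t k => ‖a' t k‖) (by linarith) hM'
      ha' fun t _ k => (norm_mul_mFourier _ k x).le
  · exact HasDerivAt.fun_sum fun k _ => (hd k t ht).mul_const _
  · exact (summable_trig ((ha t ht).summable_norm (by linarith) hM) x).hasSum

lemma continuousOn_trig (hs : (d : ℝ) / 2 < s) (hM : 0 ≤ M) (ha : ∀ t ∈ I, HsBdd s (a t) M)
    (hc : ∀ k, ContinuousOn (fun t => a t k) I) :
    ContinuousOn (fun p : ℝ × Torus d => trig (a p.1) p.2) (I ×ˢ univ) := by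
  refine (tendstoUniformlyOn_of_sqSumLe (X := ℝ × Torus d)
    (f := fun k p => a p.1 k * UnitAddTorus.mFourier k p.2) (g := fun p k => ‖a p.1 k‖) hs hM
    (fun p hp => ha p.1 hp.1) fun p _ k => (norm_mul_mFourier _ k _).le).continuousOn
    (Eventually.of_forall fun F => continuousOn_finsetSum _ fun k _ => ?_).frequently
  exact ((hc k).comp continuousOn_fst fun p hp => hp.1).mul
    ((UnitAddTorus.mFourier k).continuous.comp continuous_snd).continuousOn

end Regularity

end Bridge

end ActiveScalar

end

noncomputable section

namespace ActiveScalar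

open Set Filter Topology

/-! ### Real-valued solutions of the coefficient system. -/

section RealSolutions

variable {d : ℕ} {m : Fin d → (Fin d → ℤ) → ℂ} {C : ℝ}

lemma advKernel_symm (m : Fin d → (Fin d → ℤ) → ℂ) (a : (Fin d → ℤ) → ℂ) (k l : Fin d → ℤ) :
    advKernel m (symm a) k l = advKernel m a k l := by
  simp only [advKernel, symm_of_real (symm_neg a)]

lemma conj_advKernel_neg (hm : IsVelocitySymbol m C) (a : (Fin d → ℤ) → ℂ) (k l : Fin d → ℤ) :
    (starRingEnd ℂ) (advKernel m a (-k) (-l)) = advKernel m a k l := by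
  rw [advKernel, advKernel, map_sum]
  refine Finset.sum_congr rfl fun j _ => ?_
  rw [show -k - -l = -(k - l) by abel, hm.map_neg, symm_neg]
  simp

/-- The velocity depends on `a` only through `symm a` and is real, so `u·∇` commutes with taking
real parts. Hence the real part of a solution with real data is a solution, with no appeal to
uniqueness. -/
lemma symm_adv (hm : IsVelocitySymbol m C) {a : (Fin d → ℤ) → ℂ}
    (ha : Summable fun k => jb k * ‖a k‖) (k : Fin d → ℤ) :
    symm (adv m a a) k = adv m (symm a) (symm a) k := by
  have hc : (starRingEnd ℂ) (adv m a a (-k)) =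
      ∑' l, advKernel m a k l * (starRingEnd ℂ) (a (-l)) := by
    rw [adv, Complex.conj_tsum, ← (Equiv.neg (Fin d → ℤ)).tsum_eq]
    refine tsum_congr fun l => ?_
    rw [Equiv.neg_apply, map_mul, conj_advKernel_neg hm]
  have hs : ∀ b : (Fin d → ℤ) → ℂ, (Summable fun k => jb k * ‖b k‖) →
      Summable fun l => advKernel m a k l * b l := by
    intro b hb
    have h1 : SumLe (fun k => jb k * ‖b k‖) (∑' k, jb k * ‖b k‖) := fun F =>
      hb.sum_le_tsum F fun k _ => mul_nonneg (jb_nonneg k) (norm_nonneg _)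
    have h2 := summable_symm (summable_of_summable_jb_mul ha)
    have h3 : SqSumLe (fun k => ‖symm a k‖) (∑' k, ‖symm a k‖) := fun F =>
      (Finset.sum_sq_le_sq_sum_of_nonneg fun k _ => norm_nonneg _).trans
        (pow_le_pow_left₀ (Finset.sum_nonneg fun k _ => norm_nonneg _)
          (h2.sum_le_tsum F fun k _ => norm_nonneg _) 2)
    exact summable_adv_of_sumLe_right hm h3 (tsum_nonneg fun k => norm_nonneg _) h1 k
  have ha' : Summable fun k => jb k * ‖(starRingEnd ℂ) (a (-k))‖ := by
    have := (Equiv.neg (Fin d → ℤ)).summable_iff.mpr ha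
    simpa [Function.comp_def, jb_neg] using this
  rw [symm, hc, adv, adv, ← (hs _ ha).tsum_add (hs _ ha'), ← tsum_div_const]
  refine tsum_congr fun l => ?_
  rw [advKernel_symm, symm]
  ring

/-- Local existence of a real solution in terms of Fourier coefficients. -/
theorem exists_real_coeff_solution (hm : IsVelocitySymbol m C) {s : ℝ}
    (hs : (d : ℝ) / 2 + 1 < s) {θ₀ S : (Fin d → ℤ) → ℂ} {M₀ : ℝ} (hM₀ : 0 ≤ M₀)
    (hθ₀ : HsBdd s θ₀ M₀) (hS : HsBdd s S M₀) (hθ₀r : ∀ k, θ₀ (-k) = (starRingEnd ℂ) (θ₀ k))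
    (hSr : ∀ k, S (-k) = (starRingEnd ℂ) (S k)) :
    ∃ T M : ℝ, 0 < T ∧ 0 ≤ M ∧ ∃ a : ℝ → (Fin d → ℤ) → ℂ,
      (∀ t ∈ Icc (-T) T, HsBdd s (a t) M) ∧ (∀ k, a 0 k = θ₀ k) ∧
      (∀ t k, a t (-k) = (starRingEnd ℂ) (a t k)) ∧
      ∀ k, ∀ t ∈ Icc (-T) T, HasDerivWithinAt (fun τ => a τ k)
        (S k - adv m (a t) (a t) k) (Icc (-T) T) t := by
  obtain ⟨T, M, hT, hM, a, ha, ha0, had⟩ := exists_coeff_solution hm hs hM₀ hθ₀ hS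
  refine ⟨T, M, hT, hM, fun t => symm (a t), fun t ht => (ha t ht).symm hM, fun k => ?_,
    fun t k => symm_neg _ _, fun k t ht => ?_⟩
  · have : a 0 = θ₀ := funext ha0
    simp only [this, symm_of_real hθ₀r]
  · have h1 := ((had k t ht).add (Complex.conjCLE.toContinuousLinearMap.hasFDerivAt.comp_hasDerivWithinAt t
      (had (-k) t ht))).div_const 2
    refine h1.congr_deriv ?_
    have h2 := symm_adv hm ((ha t ht).summable_jb_mul hs hM) k
    rw [← h2]
    simp only [symm, ContinuousLinearEquiv.coe_coe, Complex.conjCLE_apply, map_sub]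
    rw [hSr k, Complex.conj_conj]
    ring

end RealSolutions

/-! ### Functions in `H^s` and classical solutions. -/

section Solutions

variable {d : ℕ} {𝓣 : MultiplierMatrix d} {C s T : ℝ}

lemma hsNorm_nonneg (s : ℝ) (f : Torus d → ℝ) : 0 ≤ hsNorm s f := Real.sqrt_nonneg _

lemma MemHs.summable_jb_mul {f : Torus d → ℝ} (hs : (d : ℝ) / 2 + 1 < s) (hf : MemHs s f) :
    Summable fun k => jb k * ‖fourierCoeff f k‖ :=
  (hf.hsBdd le_rfl).summable_jb_mul hs (hsNorm_nonneg s f)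

lemma MemHs.ae_eq_trig {f : Torus d → ℝ} (hs : (d : ℝ) / 2 + 1 < s) (hf : MemHs s f) :
    ∀ᵐ x ∂(torusMeasure d), f x = (trig (fourierCoeff f) x).re := by
  filter_upwards [ActiveScalar.ae_eq_trig hf.1
    (summable_of_summable_jb_mul (hf.summable_jb_mul hs))] with x hx
  rw [← hx, Complex.ofReal_re]

lemma MemHs.eq_trig {f : Torus d → ℝ} (hs : (d : ℝ) / 2 + 1 < s) (hf : MemHs s f)
    (hc : Continuous f) : f = fun x => (trig (fourierCoeff f) x).re :=
  (Continuous.ae_eq_iff_eq (torusMeasure d) hc (Complex.continuous_re.comp (continuous_trig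
    (summable_of_summable_jb_mul (hf.summable_jb_mul hs))))).mp (hf.ae_eq_trig hs)

lemma MemHs.integrable {f : Torus d → ℝ} (hf : MemHs s f) : Integrable f (torusMeasure d) :=
  hf.1.integrable one_le_two

lemma MemHs.integral_flux {f : Torus d → ℝ} (hs : (d : ℝ) / 2 + 1 < s)
    (hm : IsVelocitySymbol (driftSymbol 𝓣) C) (hf : MemHs s f) {φ : Torus d → ℝ}
    (hφ : IsSmooth φ) :
    ∫ x, ∑ j, f x * drift 𝓣 j f x * partialDeriv j φ x ∂(torusMeasure d) =
      -∫ x, transport (driftSymbol 𝓣) (fourierCoeff f) x * φ x ∂(torusMeasure d) := by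
  rw [← integral_flux_eq hm (hf.summable_jb_mul hs) (fourierCoeff_neg f) hφ]
  refine integral_congr_ae ((hf.ae_eq_trig hs).mono fun x hx => ?_)
  refine Finset.sum_congr rfl fun j _ => ?_
  rw [hx]
  rfl

lemma integrable_of_continuous {E : Type*} [NormedAddCommGroup E] {f : Torus d → E}
    (hf : Continuous f) : Integrable f (torusMeasure d) :=
  hf.integrable_of_hasCompactSupport (HasCompactSupport.of_compactSpace _)

lemma Integrable.mul_continuous {f g : Torus d → ℝ} (hf : Integrable f (torusMeasure d))
    (hg : Continuous g) : Integrable (fun x => f x * g x) (torusMeasure d) := by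
  obtain ⟨B, hB⟩ := isCompact_univ.exists_bound_of_continuousOn hg.continuousOn
  exact hf.mul_bdd hg.aestronglyMeasurable (Eventually.of_forall fun x => hB x (mem_univ x))

/-! ### Classical solutions are weak solutions -/

section Classical

variable {θ : ℝ → Torus d → ℝ}

lemma continuous_of_contDiffOn (h : ContDiffOn ℝ 1
    (fun p : ℝ × (Fin d → ℝ) => θ p.1 (toTorus p.2)) (Icc (0 : ℝ) T ×ˢ univ)) {t : ℝ}
    (ht : t ∈ Icc 0 T) : Continuous (θ t) := by
  refine isOpenQuotientMap_toTorus.isQuotientMap.continuous_iff.mpr ?_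
  exact h.continuousOn.comp_continuous (f := fun y : Fin d → ℝ => (t, y)) (by fun_prop)
    fun y => mk_mem_prod ht (mem_univ _)

/-- The time derivative is continuous up to the end points on the lift and descends to the torus
through the quotient map. Projecting time onto `[0, T]` makes it continuous everywhere. -/
lemma exists_time_derivative (hT : 0 < T) (h : ContDiffOn ℝ 1
    (fun p : ℝ × (Fin d → ℝ) => θ p.1 (toTorus p.2)) (Icc (0 : ℝ) T ×ˢ univ)) :
    ∃ G : ℝ × Torus d → ℝ, Continuous G ∧ ∀ x, ∀ t ∈ Icc 0 T,
      HasDerivWithinAt (fun τ => θ τ x) (G (t, x)) (Icc 0 T) t := by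
  set F := fun p : ℝ × (Fin d → ℝ) => θ p.1 (toTorus p.2) with hF
  have hU : UniqueDiffOn ℝ (Icc (0 : ℝ) T) := uniqueDiffOn_Icc hT
  have key : ∀ y : Fin d → ℝ, ∀ t ∈ Icc 0 T, HasDerivWithinAt (fun τ => θ τ (toTorus y))
      (fderivWithin ℝ F (Icc (0 : ℝ) T ×ˢ univ) (t, y) (1, 0)) (Icc 0 T) t := by
    intro y t ht
    have h1 := (h.differentiableOn one_ne_zero (t, y) ⟨ht, mem_univ _⟩).hasFDerivWithinAt
    have h2 : HasDerivWithinAt (fun τ : ℝ => (τ, y)) ((1 : ℝ), (0 : Fin d → ℝ)) (Icc 0 T) t :=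
      (hasDerivWithinAt_id t _).prodMk (hasDerivWithinAt_const t _ y)
    exact h1.comp_hasDerivWithinAt t h2 fun τ hτ => mk_mem_prod hτ (mem_univ _)
  refine ⟨fun p => derivWithin (fun τ => θ τ p.2) (Icc 0 T) (projIcc 0 T hT.le p.1), ?_, ?_⟩
  · refine (IsOpenQuotientMap.id.prodMap
      isOpenQuotientMap_toTorus).isQuotientMap.continuous_iff.mpr ?_
    have h3 : (fun p : ℝ × Torus d => derivWithin (fun τ => θ τ p.2) (Icc 0 T)
        (projIcc 0 T hT.le p.1)) ∘ Prod.map id toTorus = fun p : ℝ × (Fin d → ℝ) =>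
        fderivWithin ℝ F (Icc (0 : ℝ) T ×ˢ univ) (projIcc 0 T hT.le p.1, p.2) (1, 0) :=
      funext fun p => (key p.2 _ (projIcc 0 T hT.le p.1).2).derivWithin
        (hU _ (projIcc 0 T hT.le p.1).2)
    rw [h3]
    refine Continuous.clm_apply ?_ continuous_const
    refine (h.continuousOn_fderivWithin (hU.prod uniqueDiffOn_univ) le_rfl).comp_continuous
      (f := fun p : ℝ × (Fin d → ℝ) => ((projIcc 0 T hT.le p.1 : ℝ), p.2)) ?_
      fun p => ⟨(projIcc 0 T hT.le p.1).2, mem_univ _⟩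
    exact (continuous_subtype_val.comp (continuous_projIcc.comp continuous_fst)).prodMk
      continuous_snd
  · intro x t ht
    obtain ⟨y, rfl⟩ := toTorus_surjective x
    simp only [projIcc_of_mem hT.le ht]
    exact (key y t ht).differentiableWithinAt.hasDerivWithinAt

/-- Continuity makes `f` equal to its Fourier series at every point, so its pointwise derivatives
are given by the series. -/
lemma sum_drift_mul_partialDeriv {f : Torus d → ℝ} (hs : (d : ℝ) / 2 + 1 < s) (hf : MemHs s f)
    (hc : Continuous f) (x : Torus d) :
    ∑ j, drift 𝓣 j f x * partialDeriv j f x =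
      transport (driftSymbol 𝓣) (fourierCoeff f) x := by
  refine Finset.sum_congr rfl fun j _ => ?_
  have h : partialDeriv j f x = (trig (gradCoeff j (fourierCoeff f)) x).re := by
    rw [← partialDeriv_re_trig (hf.summable_jb_mul hs), ← hf.eq_trig hs hc]
  rw [h]
  rfl

/-- At each `x` the time derivative is integrated in `t`; after multiplication by `φ`, Fubini
exchanges the integrals and the transport term is integrated by parts. The identity is obtained at
every `t` in the open interval. -/
theorem IsClassicalSolution.isWeakSolution (hs : (d : ℝ) / 2 + 1 < s) (hT : 0 < T)
    (hm : IsVelocitySymbol (driftSymbol 𝓣) C) {θ₀ S : Torus d → ℝ} (hS : MemHs s S)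
    (hθ : IsClassicalSolution 𝓣 θ₀ S T θ) (hmem : MemLinftyHs T s θ) :
    IsWeakSolution 𝓣 θ₀ S T θ := by
  obtain ⟨hC1, h0, heq⟩ := hθ
  obtain ⟨M, hM⟩ := hmem.2
  obtain ⟨G, hG, hGd⟩ := exists_time_derivative hT hC1
  intro φ hφ
  have hφc := hφ.continuous
  refine (ae_restrict_iff' measurableSet_Ioo).mpr (Eventually.of_forall fun t ht => ?_)
  have htI : t ∈ Icc 0 T := Ioo_subset_Icc_self ht
  have h0I : (0 : ℝ) ∈ Icc 0 T := ⟨le_rfl, hT.le⟩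
  have hGφ : Continuous fun p : ℝ × Torus d => G p * φ p.2 := hG.mul (hφc.comp continuous_snd)
  have hpt : ∀ x, θ t x * φ x = θ 0 x * φ x + ∫ τ in (0 : ℝ)..t, G (τ, x) * φ x := by
    intro x
    have h1 := eq_add_integral_of_hasDerivWithinAt (f := fun τ => θ τ x) (g := fun τ => G (τ, x))
      le_rfl hT.le (hGd x) (by fun_prop) htI
    rw [h1, intervalIntegral.integral_mul_const, add_mul]
  have hint : Integrable (Function.uncurry fun (τ : ℝ) x => G (τ, x) * φ x)
      ((volume.restrict (uIoc 0 t)).prod (torusMeasure d)) := by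
    have h1 : IntegrableOn (fun p : ℝ × Torus d => G p * φ p.2) (uIcc 0 t ×ˢ univ)
        (volume.prod (torusMeasure d)) :=
      hGφ.continuousOn.integrableOn_compact (isCompact_uIcc.prod isCompact_univ)
    have h2 := h1.mono_set (prod_mono_left (t := univ) (uIoc_subset_uIcc (a := (0 : ℝ)) (b := t)))
    rwa [IntegrableOn, ← Measure.prod_restrict, Measure.restrict_univ] at h2
  have hI1 : Integrable (fun x => θ 0 x * φ x) (torusMeasure d) :=
    integrable_of_continuous ((continuous_of_contDiffOn hC1 h0I).mul hφc)
  have hI2 : Integrable (fun x => ∫ τ in (0 : ℝ)..t, G (τ, x) * φ x) (torusMeasure d) :=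
    ((integrable_of_continuous ((continuous_of_contDiffOn hC1 htI).mul hφc)).sub hI1).congr
      (Eventually.of_forall fun x => by
        have := hpt x
        simp only [Pi.sub_apply, Pi.mul_apply]
        linarith)
  simp only [hpt]
  rw [integral_add hI1 hI2]
  congr 1
  · exact integral_congr_ae (h0.mono fun x hx => by simp only [hx])
  rw [← intervalIntegral_integral_swap hint]
  refine intervalIntegral.integral_congr_ae ?_
  -- The `H^s` regularity is known only for almost every `τ`, which suffices under the time
  -- integral.
  have hM' := (ae_restrict_iff' measurableSet_Ioo).mp hM
  filter_upwards [hM'] with τ hτ hτt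
  rw [uIoc_of_le ht.1.le] at hτt
  have hτI : τ ∈ Ioo 0 T := ⟨hτt.1, hτt.2.trans_lt ht.2⟩
  obtain ⟨hmemτ, -⟩ := hτ hτI
  have hcτ := continuous_of_contDiffOn hC1 (Ioo_subset_Icc_self hτI)
  have htr := continuous_transport hm (hmemτ.summable_jb_mul hs)
  have hI3 : Integrable (fun x => transport (driftSymbol 𝓣) (fourierCoeff (θ τ)) x * φ x)
      (torusMeasure d) := integrable_of_continuous (htr.mul hφc)
  rw [hmemτ.integral_flux hs hm hφ, ← sub_eq_add_neg, ← integral_sub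
    (Integrable.mul_continuous hS.integrable hφc) hI3]
  refine integral_congr_ae (heq.mono fun x hx => ?_)
  have h1 := hx τ (Ioo_subset_Icc_self hτI)
  rw [sum_drift_mul_partialDeriv hs hmemτ hcτ, (hGd x τ (Ioo_subset_Icc_self hτI)).derivWithin
    (uniqueDiffOn_Icc hT τ (Ioo_subset_Icc_self hτI))] at h1
  simp only
  rw [← h1]
  ring

end Classical

end Solutions

end ActiveScalar

end

noncomputable section

namespace ActiveScalar

open Set Filter Topology

section WeakUniqueness

variable {d : ℕ} {𝓣 : MultiplierMatrix d} {C s T : ℝ}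

/-! ### Weak solutions in terms of Fourier coefficients -/

lemma contDiff_mFourier_toTorus (k : Fin d → ℤ) {n : WithTop ℕ∞} :
    ContDiff ℝ n fun y : Fin d → ℝ => UnitAddTorus.mFourier k (toTorus y) := by
  have h : (fun y : Fin d → ℝ => UnitAddTorus.mFourier k (toTorus y)) =
      fun y => Complex.exp (waveForm k y) :=
    funext fun y => by rw [mFourier_toTorus, waveForm_apply]
  rw [h]
  exact (waveForm k).contDiff.cexp

lemma isSmooth_re_mFourier (k : Fin d → ℤ) :
    IsSmooth fun x : Torus d => (UnitAddTorus.mFourier k x).re :=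
  Complex.reCLM.contDiff.comp (contDiff_mFourier_toTorus k)

lemma isSmooth_im_mFourier (k : Fin d → ℤ) :
    IsSmooth fun x : Torus d => (UnitAddTorus.mFourier k x).im :=
  Complex.imCLM.contDiff.comp (contDiff_mFourier_toTorus k)

lemma integrable_mFourier_mul {f : Torus d → ℝ} (hf : Integrable f (torusMeasure d))
    (k : Fin d → ℤ) :
    Integrable (fun x => UnitAddTorus.mFourier k x * (f x : ℂ)) (torusMeasure d) :=
  hf.ofReal.bdd_mul (UnitAddTorus.mFourier k).continuous.aestronglyMeasurable
    (Eventually.of_forall fun x => (norm_mFourier_apply k x).le)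

lemma re_fourierCoeff {f : Torus d → ℝ} (hf : Integrable f (torusMeasure d)) (k : Fin d → ℤ) :
    (fourierCoeff f k).re =
      ∫ x, f x * (UnitAddTorus.mFourier (-k) x).re ∂(torusMeasure d) := by
  rw [fourierCoeff_eq, ← Complex.reCLM_apply,
    ← ContinuousLinearMap.integral_comp_comm _ (integrable_mFourier_mul hf (-k))]
  refine integral_congr_ae (Eventually.of_forall fun x => ?_)
  simp [mul_comm]

lemma im_fourierCoeff {f : Torus d → ℝ} (hf : Integrable f (torusMeasure d)) (k : Fin d → ℤ) :
    (fourierCoeff f k).im =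
      ∫ x, f x * (UnitAddTorus.mFourier (-k) x).im ∂(torusMeasure d) := by
  rw [fourierCoeff_eq, ← Complex.imCLM_apply,
    ← ContinuousLinearMap.integral_comp_comm _ (integrable_mFourier_mul hf (-k))]
  refine integral_congr_ae (Eventually.of_forall fun x => ?_)
  simp [mul_comm]

lemma aestronglyMeasurable_fourierCoeff {θ : ℝ → Torus d → ℝ} {μ : Measure ℝ}
    (h : AEStronglyMeasurable (fun p : ℝ × Torus d => θ p.1 p.2) (μ.prod (torusMeasure d)))
    (k : Fin d → ℤ) : AEStronglyMeasurable (fun τ => fourierCoeff (θ τ) k) μ := by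
  have h1 : AEStronglyMeasurable (fun p : ℝ × Torus d =>
      UnitAddTorus.mFourier (-k) p.2 * (θ p.1 p.2 : ℂ)) (μ.prod (torusMeasure d)) :=
    ((UnitAddTorus.mFourier (-k)).continuous.comp continuous_snd).aestronglyMeasurable.mul
      (Complex.continuous_ofReal.comp_aestronglyMeasurable h)
  exact h1.integral_prod_right'

lemma aestronglyMeasurable_adv {m : Fin d → (Fin d → ℤ) → ℂ} (hm : IsVelocitySymbol m C)
    {b : ℝ → (Fin d → ℤ) → ℂ} {μ : Measure ℝ} (hs : (d : ℝ) / 2 + 1 < s) {M : ℝ} (hM : 0 ≤ M)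
    (hb : ∀ᵐ τ ∂μ, HsBdd s (b τ) M) (h : ∀ k, AEStronglyMeasurable (fun τ => b τ k) μ)
    (k : Fin d → ℤ) : AEStronglyMeasurable (fun τ => adv m (b τ) (b τ) k) μ := by
  obtain ⟨K, -, hK⟩ := exists_wiener_bound hs
  refine aestronglyMeasurable_of_tendsto_ae atTop
    (f := fun (F : Finset (Fin d → ℤ)) τ => ∑ l ∈ F, advKernel m (b τ) k l * b τ l)
    (fun F => ?_) (hb.mono fun τ hτ => ?_)
  · refine Finset.aestronglyMeasurable_fun_sum _ fun l _ => AEStronglyMeasurable.mul ?_ (h l)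
    refine Finset.aestronglyMeasurable_fun_sum _ fun j _ => ?_
    have h1 : AEStronglyMeasurable (fun τ => symm (b τ) (k - l)) μ := by
      simp only [symm, div_eq_mul_inv]
      exact ((h _).add (Complex.continuous_conj.comp_aestronglyMeasurable (h _))).mul_const _
    exact (h1.const_mul _).mul_const _
  · exact (summable_adv_of_sumLe_left hm (hK _ M hM (hτ.symm hM)).2
      (hτ.sqSumLe_jb_mul (one_lt_of_half_dim_lt hs).le) hM k).hasSum

/-- The Fourier coefficients of a weak solution satisfy the integrated equation. -/
lemma IsWeakSolution.fourierCoeff_eq_integral (hs : (d : ℝ) / 2 + 1 < s)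
    (hm : IsVelocitySymbol (driftSymbol 𝓣) C) {θ₀ S : Torus d → ℝ} (hθ₀ : MemHs s θ₀)
    (hS : MemHs s S) {θ : ℝ → Torus d → ℝ} (hw : IsWeakSolution 𝓣 θ₀ S T θ)
    (hmem : ∀ᵐ t ∂(volume.restrict (Ioo 0 T)), MemHs s (θ t)) (k : Fin d → ℤ)
    (hint : IntegrableOn (fun τ => fourierCoeff S k -
      adv (driftSymbol 𝓣) (fourierCoeff (θ τ)) (fourierCoeff (θ τ)) k) (Ioo 0 T)) :
    ∀ᵐ t ∂(volume.restrict (Ioo 0 T)), fourierCoeff (θ t) k = fourierCoeff θ₀ k +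
      ∫ τ in (0 : ℝ)..t, (fourierCoeff S k -
        adv (driftSymbol 𝓣) (fourierCoeff (θ τ)) (fourierCoeff (θ τ)) k) := by
  have hmem' := (ae_restrict_iff' measurableSet_Ioo).mp hmem
  have hflux : ∀ (φ : Torus d → ℝ), IsSmooth φ → ∀ t ∈ Ioo 0 T,
      ∫ τ in (0 : ℝ)..t, ((∫ x, S x * φ x ∂(torusMeasure d)) +
        ∫ x, ∑ j, θ τ x * drift 𝓣 j (θ τ) x * partialDeriv j φ x ∂(torusMeasure d)) =
      ∫ τ in (0 : ℝ)..t, ((∫ x, S x * φ x ∂(torusMeasure d)) -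
        ∫ x, transport (driftSymbol 𝓣) (fourierCoeff (θ τ)) x * φ x ∂(torusMeasure d)) := by
    intro φ hφ t ht
    refine intervalIntegral.integral_congr_ae ?_
    filter_upwards [hmem'] with τ hτ hτt
    rw [uIoc_of_le ht.1.le] at hτt
    rw [(hτ ⟨hτt.1, hτt.2.trans_lt ht.2⟩).integral_flux hs hm hφ, sub_eq_add_neg]
  have hcoef : ∀ t ∈ Ioo 0 T, IntervalIntegrable (fun τ => fourierCoeff S k -
      adv (driftSymbol 𝓣) (fourierCoeff (θ τ)) (fourierCoeff (θ τ)) k) volume 0 t := by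
    intro t ht
    rw [intervalIntegrable_iff_integrableOn_Ioc_of_le ht.1.le]
    exact hint.mono_set fun τ hτ => ⟨hτ.1, hτ.2.trans_lt ht.2⟩
  have htr : ∀ τ, MemHs s (θ τ) →
      Integrable (transport (driftSymbol 𝓣) (fourierCoeff (θ τ))) (torusMeasure d) ∧
      fourierCoeff (transport (driftSymbol 𝓣) (fourierCoeff (θ τ))) k =
        adv (driftSymbol 𝓣) (fourierCoeff (θ τ)) (fourierCoeff (θ τ)) k := fun τ hτ =>
    ⟨integrable_of_continuous (continuous_transport hm (hτ.summable_jb_mul hs)),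
      fourierCoeff_transport hm (hτ.summable_jb_mul hs) (fourierCoeff_neg _) k⟩
  -- Test functions are real, so the coefficient is recovered from the real and imaginary parts of
  -- the exponential.
  filter_upwards [hw _ (isSmooth_re_mFourier (-k)), hw _ (isSmooth_im_mFourier (-k)), hmem,
    ae_restrict_mem measurableSet_Ioo] with t h1 h2 hmt ht
  rw [hflux _ (isSmooth_re_mFourier _) t ht] at h1
  rw [hflux _ (isSmooth_im_mFourier _) t ht] at h2
  apply Complex.ext
  · rw [re_fourierCoeff hmt.integrable, h1, Complex.add_re, re_fourierCoeff hθ₀.integrable,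
      ← Complex.reCLM_apply (∫ τ in (0 : ℝ)..t, _),
      ← ContinuousLinearMap.intervalIntegral_comp_comm _ (hcoef t ht)]
    congr 1
    refine intervalIntegral.integral_congr_ae ?_
    filter_upwards [hmem'] with τ hτ hτt
    rw [uIoc_of_le ht.1.le] at hτt
    obtain ⟨e1, e2⟩ := htr τ (hτ ⟨hτt.1, hτt.2.trans_lt ht.2⟩)
    rw [Complex.reCLM_apply, Complex.sub_re, ← e2, re_fourierCoeff hS.integrable,
      re_fourierCoeff e1]
  · rw [im_fourierCoeff hmt.integrable, h2, Complex.add_im, im_fourierCoeff hθ₀.integrable,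
      ← Complex.imCLM_apply (∫ τ in (0 : ℝ)..t, _),
      ← ContinuousLinearMap.intervalIntegral_comp_comm _ (hcoef t ht)]
    congr 1
    refine intervalIntegral.integral_congr_ae ?_
    filter_upwards [hmem'] with τ hτ hτt
    rw [uIoc_of_le ht.1.le] at hτt
    obtain ⟨e1, e2⟩ := htr τ (hτ ⟨hτt.1, hτt.2.trans_lt ht.2⟩)
    rw [Complex.imCLM_apply, Complex.sub_im, ← e2, im_fourierCoeff hS.integrable,
      im_fourierCoeff e1]

/-- An inequality between continuous functions that holds almost everywhere holds everywhere. -/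
lemma le_of_ae_le_Icc (hT : 0 < T) {f : ℝ → ℝ} {B : ℝ} (hf : ContinuousOn f (Icc 0 T))
    (h : ∀ᵐ t ∂(volume.restrict (Ioo 0 T)), f t ≤ B) : ∀ t ∈ Icc 0 T, f t ≤ B := by
  have h1 : EqOn (fun t => max (f t) B) (fun _ => B) (Icc 0 T) := by
    refine Measure.eqOn_Icc_of_ae_eq volume hT.ne ?_ (hf.sup continuousOn_const)
      continuousOn_const
    rw [← restrict_Ioo_eq_restrict_Icc]
    exact h.mono fun t ht => max_eq_right ht
  intro t ht
  exact max_eq_right_iff.mp (h1 ht)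

/-- Weak solutions are determined by the solution of the system for the Fourier coefficients. -/
theorem IsWeakSolution.ae_fourierCoeff_eq (hs : (d : ℝ) / 2 + 1 < s) (hT : 0 < T)
    (hm : IsVelocitySymbol (driftSymbol 𝓣) C) {θ₀ S : Torus d → ℝ} (hθ₀ : MemHs s θ₀)
    (hS : MemHs s S) {θ : ℝ → Torus d → ℝ} (hmem : MemLinftyHs T s θ)
    (hw : IsWeakSolution 𝓣 θ₀ S T θ) {a : ℝ → (Fin d → ℤ) → ℂ} {M : ℝ} (hM : 0 ≤ M)
    (ha : ∀ t ∈ Icc 0 T, HsBdd s (a t) M) (ha0 : ∀ k, a 0 k = fourierCoeff θ₀ k)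
    (had : ∀ k, ∀ t ∈ Icc 0 T, HasDerivWithinAt (fun τ => a τ k)
      (fourierCoeff S k - adv (driftSymbol 𝓣) (a t) (a t) k) (Icc 0 T) t) :
    ∀ᵐ t ∂(volume.restrict (Ioo 0 T)), fourierCoeff (θ t) = a t := by
  obtain ⟨hmeas, M₁, hM₁⟩ := hmem
  set m := driftSymbol 𝓣 with hmdef
  set N := max M (max M₁ 0) with hN
  have hN0 : 0 ≤ N := (le_max_right _ _).trans (le_max_right _ _)
  have hbd : ∀ᵐ t ∂(volume.restrict (Ioo 0 T)), HsBdd s (fourierCoeff (θ t)) N :=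
    hM₁.mono fun t ht => ht.1.hsBdd (ht.2.trans ((le_max_left _ _).trans (le_max_right _ _)))
  obtain ⟨B, hB⟩ := exists_norm_adv_le hm hs hN0
  have hHint : ∀ k, IntegrableOn (fun τ => fourierCoeff S k -
      adv m (fourierCoeff (θ τ)) (fourierCoeff (θ τ)) k) (Ioo 0 T) := by
    intro k
    have h1 : AEStronglyMeasurable (fun τ => fourierCoeff S k -
        adv m (fourierCoeff (θ τ)) (fourierCoeff (θ τ)) k) (volume.restrict (Ioo 0 T)) :=
      aestronglyMeasurable_const.sub (aestronglyMeasurable_adv hm hs hN0 hbd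
        (aestronglyMeasurable_fourierCoeff hmeas) k)
    exact Integrable.of_bound h1 (‖fourierCoeff S k‖ + B)
      (hbd.mono fun τ hτ => (norm_sub_le _ _).trans (by gcongr; exact hB _ hτ k))
  -- The candidate for the time-continuous representative of the coefficients.
  let β : ℝ → (Fin d → ℤ) → ℂ := fun t k => fourierCoeff θ₀ k + ∫ τ in (0 : ℝ)..t,
    (fourierCoeff S k - adv m (fourierCoeff (θ τ)) (fourierCoeff (θ τ)) k)
  -- There are countably many frequencies, so one null set of times serves all of them.
  have hβ : ∀ᵐ t ∂(volume.restrict (Ioo 0 T)), fourierCoeff (θ t) = β t := by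
    have h1 := ae_all_iff.mpr fun k => hw.fourierCoeff_eq_integral hs hm hθ₀ hS
      (hM₁.mono fun t ht => ht.1) k (hHint k)
    exact h1.mono fun t ht => funext ht
  have hβc : ∀ k, ContinuousOn (fun t => β t k) (Icc 0 T) := by
    intro k
    have h1 : IntegrableOn (fun τ => fourierCoeff S k -
      adv m (fourierCoeff (θ τ)) (fourierCoeff (θ τ)) k) (uIcc 0 T) := by
      rw [uIcc_of_le hT.le, integrableOn_Icc_iff_integrableOn_Ioo]
      exact hHint k
    have h2 := intervalIntegral.continuousOn_primitive_interval h1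
    rw [uIcc_of_le hT.le] at h2
    exact continuousOn_const.add h2
  -- Each finite partial sum is continuous in time, so the almost everywhere bound holds at every
  -- time.
  have hβbd : ∀ t ∈ Icc 0 T, HsBdd s (β t) N := by
    intro t ht F
    refine le_of_ae_le_Icc hT (f := fun t => ∑ k ∈ F, (jb k ^ s * ‖β t k‖) ^ 2)
      (continuousOn_finsetSum _ fun k _ => (continuousOn_const.mul (hβc k).norm).pow 2) ?_ t ht
    filter_upwards [hβ, hbd] with t h1 h2
    rw [← h1]
    exact h2 F
  have hβd : ∀ k, ∀ t ∈ Icc 0 T, HasDerivWithinAt (fun τ => β τ k)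
      (fourierCoeff S k - adv m (β t) (β t) k) (Icc 0 T) t := by
    intro k t ht
    have hg : ContinuousOn (fun τ => fourierCoeff S k - adv m (β τ) (β τ) k) (Icc 0 T) :=
      continuousOn_const.sub (continuousOn_adv hm hs hN0 hβbd hβc k)
    have he : ∀ t ∈ Icc 0 T, β t k = fourierCoeff θ₀ k +
        ∫ τ in (0 : ℝ)..t, (fourierCoeff S k - adv m (β τ) (β τ) k) := by
      intro t ht
      simp only [β]
      congr 1
      refine intervalIntegral.integral_congr_ae ?_
      have h1 := (ae_restrict_iff' measurableSet_Ioo).mp hβ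
      -- The integral runs over a half-open interval that may contain `T`, while `β` is compared
      -- with the coefficients only on the open interval.
      have h2 : ∀ᵐ τ : ℝ, τ ≠ T := by simp [ae_iff]
      filter_upwards [h1, h2] with τ h3 h4 hτ
      rw [uIoc_of_le ht.1] at hτ
      rw [h3 ⟨hτ.1, lt_of_le_of_ne (hτ.2.trans ht.2) h4⟩]
    exact (hasDerivWithinAt_integral_Icc le_rfl hT.le hg _ ht).congr he (he t ht)
  have huniq := coeff_solution_unique hm hs hN0 hT.le hβbd
    (fun t ht => SqSumLe.of_le (ha t ht) hM (le_max_left _ _))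
    (fun k => by rw [ha0]; simp [β]) hβd had
  filter_upwards [hβ, ae_restrict_mem measurableSet_Ioo] with t h1 h2
  rw [h1]
  exact huniq t (Ioo_subset_Icc_self h2)

end WeakUniqueness

end ActiveScalar

end

/-! ### The main theorem. -/

open Set Filter Topology ActiveScalar in
theorem mainTheorem7 (d : ℕ) (hd : 2 ≤ d) (s : ℝ) (hs : (d : ℝ) / 2 + 1 < s)
    (𝓣 : NNReal → ActiveScalar.MultiplierMatrix d)
    (hreal : ∀ ν, ActiveScalar.IsReal (𝓣 ν))
    (hdiv : ∀ ν, ActiveScalar.IsDivergenceFree (𝓣 ν))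
    (hzero : ActiveScalar.OrderZeroDrift 𝓣)
    (θ₀ S : ActiveScalar.Torus d → ℝ)
    (hθ₀ : ActiveScalar.MemHs s θ₀) (hS : ActiveScalar.MemHs s S)
    (hθ₀_mean : ∫ x, θ₀ x ∂(ActiveScalar.torusMeasure d) = 0)
    (hS_mean : ∫ x, S x ∂(ActiveScalar.torusMeasure d) = 0) :
    ∃ T : ℝ, 0 < T ∧ ∃ θ : ℝ → ActiveScalar.Torus d → ℝ,
      ActiveScalar.MemLinftyHs T s θ ∧
      ActiveScalar.IsClassicalSolution (𝓣 0) θ₀ S T θ ∧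
      ActiveScalar.IsWeakSolution (𝓣 0) θ₀ S T θ ∧
      (∀ t ∈ Set.Icc (0 : ℝ) T, ∫ x, θ t x ∂(ActiveScalar.torusMeasure d) = 0) ∧
      (∀ θ' : ℝ → ActiveScalar.Torus d → ℝ,
        ActiveScalar.MemLinftyHs T s θ' →
        ActiveScalar.IsClassicalSolution (𝓣 0) θ₀ S T θ' →
        ∀ t ∈ Set.Icc (0 : ℝ) T, θ' t = θ t) ∧
      (∀ θ' : ℝ → ActiveScalar.Torus d → ℝ,
        ActiveScalar.MemLinftyHs T s θ' →
        ActiveScalar.IsWeakSolution (𝓣 0) θ₀ S T θ' →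
        ∀ᵐ t ∂(MeasureTheory.volume.restrict (Set.Ioo 0 T)),
          ∀ᵐ x ∂(ActiveScalar.torusMeasure d), θ' t x = θ t x) := by
  obtain ⟨C₀, hC₀, -, hb⟩ := hzero
  have hm := isVelocitySymbol_driftSymbol (hreal 0) (hdiv 0) hC₀.le hb
  set m := driftSymbol (𝓣 0) with hmdef
  have h1s := one_lt_of_half_dim_lt hs
  have hθ₀b : HsBdd s (fourierCoeff θ₀) (max (hsNorm s θ₀) (hsNorm s S)) :=
    hθ₀.hsBdd (le_max_left _ _)
  have hSb : HsBdd s (fourierCoeff S) (max (hsNorm s θ₀) (hsNorm s S)) :=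
    hS.hsBdd (le_max_right _ _)
  have hM₀ : 0 ≤ max (hsNorm s θ₀) (hsNorm s S) := (hsNorm_nonneg s θ₀).trans (le_max_left _ _)
  obtain ⟨T₁, M, hT₁, hM, a, ha, ha0, har, had⟩ := exists_real_coeff_solution hm hs hM₀ hθ₀b hSb
    (fourierCoeff_neg θ₀) (fourierCoeff_neg S)
  obtain ⟨K, hK, hKadv⟩ := exists_hsBdd_adv hm hs
  set a' : ℝ → (Fin d → ℤ) → ℂ := fun t k => fourierCoeff S k - adv m (a t) (a t) k with ha'def
  -- Halving puts `[0, T]` inside the open interval `I`, where the coefficients have two-sided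
  -- derivatives, also at `t = 0` and `t = T`.
  set T := T₁ / 2 with hT
  have hT0 : 0 < T := by positivity
  set I := Ioo (-T₁) T₁ with hI
  have hIo : IsOpen I := isOpen_Ioo
  have hsub : Icc 0 T ⊆ I := fun t ht => ⟨by linarith [ht.1], by linarith [ht.2]⟩
  have hIsub : I ⊆ Icc (-T₁) T₁ := Ioo_subset_Icc_self
  have haI : ∀ t ∈ I, HsBdd s (a t) M := fun t ht => ha t (hIsub ht)
  set M' := max (hsNorm s θ₀) (hsNorm s S) + K * (M * M) with hM'def
  have hM' : 0 ≤ M' := by positivity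
  have ha'I : ∀ t ∈ I, HsBdd (s - 1) (a' t) M' := fun t ht =>
    (hSb.weaken (by linarith)).sub (hKadv _ _ M M hM hM (haI t ht) (haI t ht)) hM₀ (by positivity)
  have hadI : ∀ k, ∀ t ∈ I, HasDerivAt (fun t => a t k) (a' t k) t := fun k t ht =>
    (had k t (hIsub ht)).hasDerivAt (Icc_mem_nhds ht.1 ht.2)
  have hac : ∀ k, ContinuousOn (fun t => a t k) I := fun k t ht =>
    (hadI k t ht).continuousAt.continuousWithinAt
  have ha'c : ∀ k, ContinuousOn (fun t => a' t k) I := fun k =>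
    continuousOn_const.sub (continuousOn_adv hm hs hM haI hac k)
  have hsumj : ∀ t ∈ I, Summable fun k => jb k * ‖a t k‖ := fun t ht =>
    (haI t ht).summable_jb_mul hs hM
  have hsum : ∀ t ∈ I, Summable fun k => ‖a t k‖ := fun t ht =>
    summable_of_summable_jb_mul (hsumj t ht)
  let θ : ℝ → Torus d → ℝ := fun t x => (trig (a t) x).re
  have hθc : ∀ t ∈ I, Continuous (θ t) := fun t ht =>
    Complex.continuous_re.comp (continuous_trig (hsum t ht))
  have hθcoef : ∀ t ∈ I, fourierCoeff (θ t) = a t := fun t ht => by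
    rw [← symm_of_real (har t)]
    exact funext fun k => fourierCoeff_re_trig (hsum t ht) k
  have hθmem : ∀ t ∈ I, MemHs s (θ t) ∧ hsNorm s (θ t) ≤ M := fun t ht =>
    HsBdd.memHs ((hθc t ht).memLp_of_hasCompactSupport (HasCompactSupport.of_compactSpace _)) hM
      (by rw [hθcoef t ht]; exact haI t ht)
  have hIoo : Ioo 0 T ⊆ I := Ioo_subset_Icc_self.trans hsub
  have hmemL : MemLinftyHs T s θ := by
    refine ⟨?_, M, (ae_restrict_iff' measurableSet_Ioo).mpr
      (Eventually.of_forall fun t ht => hθmem t (hIoo ht))⟩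
    have h1 : ContinuousOn (fun p : ℝ × Torus d => θ p.1 p.2) (Ioo 0 T ×ˢ univ) :=
      Complex.continuous_re.comp_continuousOn ((continuousOn_trig (by linarith) hM haI hac).mono
        (prod_mono_left hIoo))
    have h2 := h1.aestronglyMeasurable (μ := volume.prod (torusMeasure d))
      (measurableSet_Ioo.prod MeasurableSet.univ)
    rwa [← Measure.prod_restrict, Measure.restrict_univ] at h2
  have hclass : IsClassicalSolution (𝓣 0) θ₀ S T θ := by
    refine ⟨?_, ?_, ?_⟩
    · exact Complex.reCLM.contDiff.comp_contDiffOn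
        ((contDiffOn_trig hs hIo hM hM' haI ha'I hadI ha'c).mono (prod_mono_left hsub))
    · filter_upwards [hθ₀.ae_eq_trig hs] with x hx
      rw [hx]
      simp only [θ, funext ha0]
    · filter_upwards [hS.ae_eq_trig hs] with x hx t ht
      have htI := hsub ht
      have h1 : HasDerivAt (fun τ => θ τ x) (trig (a' t) x).re t :=
        Complex.reCLM.hasFDerivAt.comp_hasDerivAt t
          (hasDerivAt_trig_time hs hIo hM hM' haI ha'I hadI htI x)
      rw [h1.hasDerivWithinAt.derivWithin (uniqueDiffOn_Icc hT0 t ht),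
        sum_drift_mul_partialDeriv hs (hθmem t htI).1 (hθc t htI), hθcoef t htI, hx]
      have hadvs := summable_adv hm (hsumj t htI) (har t)
      have hSs := summable_of_summable_jb_mul (hS.summable_jb_mul hs)
      have h2 : trig (a' t) x = trig (fourierCoeff S) x - trig (adv m (a t) (a t)) x := by
        simp only [trig, ha'def, sub_mul]
        exact (summable_trig hSs x).tsum_sub (summable_trig hadvs x)
      rw [h2, ← ofReal_transport hm (hsumj t htI) (har t), Complex.sub_re, Complex.ofReal_re]
      ring
  have hweak := hclass.isWeakSolution hs hT0 hm hS hmemL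
  have hwuniq : ∀ θ' : ℝ → Torus d → ℝ, MemLinftyHs T s θ' → IsWeakSolution (𝓣 0) θ₀ S T θ' →
      ∀ᵐ t ∂(volume.restrict (Ioo 0 T)), ∀ᵐ x ∂(torusMeasure d), θ' t x = θ t x := by
    intro θ' hmem' hw'
    have h1 := hw'.ae_fourierCoeff_eq hs hT0 hm hθ₀ hS hmem' hM (fun t ht => haI t (hsub ht)) ha0
      fun k t ht => (hadI k t (hsub ht)).hasDerivWithinAt
    obtain ⟨M₁, hM₁⟩ := hmem'.2
    filter_upwards [h1, hM₁] with t h2 h3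
    filter_upwards [h3.1.ae_eq_trig hs] with x hx
    rw [hx, h2]
  refine ⟨T, hT0, θ, hmemL, hclass, hweak, fun t ht => ?_, fun θ' hmem' hcl' => ?_, hwuniq⟩
  · have hcoef0 : ∀ f : Torus d → ℝ, fourierCoeff f 0 = ((∫ x, f x ∂(torusMeasure d) : ℝ) : ℂ) := by
      intro f
      rw [fourierCoeff_eq, ← integral_complex_ofReal]
      simp [UnitAddTorus.mFourier_zero]
    -- The zero mode of the nonlinearity and that of the source both vanish, so the zero mode of the
    -- solution is constant in time.
    have h1 : ∀ τ ∈ Icc 0 T, HasDerivWithinAt (fun τ => a τ 0) 0 (Icc 0 T) τ := fun τ hτ => by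
      have h2 := (hadI 0 τ (hsub hτ)).hasDerivWithinAt (s := Icc 0 T)
      simp only [ha'def, adv_zero_mode hm, hcoef0, hS_mean, Complex.ofReal_zero, sub_zero] at h2
      exact h2
    have h3 := eq_add_integral_of_hasDerivWithinAt (f := fun τ => a τ 0) (g := fun _ => 0) le_rfl
      hT0.le h1 continuousOn_const ht
    simp only [ha0, hcoef0, hθ₀_mean, Complex.ofReal_zero, intervalIntegral.integral_zero,
      add_zero] at h3
    have h4 := hcoef0 (θ t)
    rw [hθcoef t (hsub ht), h3] at h4
    exact_mod_cast h4.symm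
  · have hw' := hwuniq θ' hmem' (hcl'.isWeakSolution hs hT0 hm hS hmem')
    -- Continuity in `x` removes the null sets in space; continuity in `t` at fixed `x` then removes
    -- the null set of times.
    have h1 : ∀ᵐ t ∂(volume.restrict (Ioo 0 T)), θ' t = θ t := by
      filter_upwards [hw', ae_restrict_mem measurableSet_Ioo] with t h2 ht
      exact (Continuous.ae_eq_iff_eq (torusMeasure d)
        (continuous_of_contDiffOn hcl'.1 (Ioo_subset_Icc_self ht)) (hθc t (hIoo ht))).mp h2
    obtain ⟨G₁, -, hG₁⟩ := exists_time_derivative hT0 hcl'.1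
    obtain ⟨G₂, -, hG₂⟩ := exists_time_derivative hT0 hclass.1
    intro t ht
    funext x
    refine Measure.eqOn_Icc_of_ae_eq volume hT0.ne (f := fun t => θ' t x) (g := fun t => θ t x)
      ?_ (fun t ht => (hG₁ x t ht).continuousWithinAt)
      (fun t ht => (hG₂ x t ht).continuousWithinAt) ht
    rw [← restrict_Ioo_eq_restrict_Icc]
    exact h1.mono fun t ht => congrFun ht x
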